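/- Let $d\ge 2$, $m\ge 1$, and let $E\subset\mathbb R^d$ be compact and Ahlfors–David regular: with $\alpha=\dim_{\mathcal H}(E)$, there are a Borel measure $\mu$ with $\mu(\mathbb R^d\setminus E)=0$ and a constant $C>0$ such that $C^{-1}\delta^{\alpha}\le\mu(B_\delta(x))\le C\delta^{\alpha}$ for all $x\in E$ and $0<\delta\le 1$. Let $\phi_1,\dots,\phi_m:\mathbb R^d\times\mathbb R^d\to\mathbb R$ be $C^\infty$, let $T=T_1\times\dots\times T_m$ with each $T_l\subset\mathbb R$ an interval, and let $\psi\in C_c^\infty(\mathbb R^d\times\mathbb R^d)$ be a real-valued cut-off function with $\psi(x,y)=1$ for all $(x,y)\in E\times E$ such that $(\phi_1(x,y),\dots,\phi_m(x,y))\in T$. Assume that at every $(x,y)\in\operatorname{supp}\psi$ with $(\phi_1(x,y),\dots,\phi_m(x,y))\in T$ the vectors $\nabla_x\phi_1(x,y),\dots,\nabla_x\phi_m(x,y)$ are linearly independent, and so are $\nabla_y\phi_1(x,y),\dots,\nabla_y\phi_m(x,y)$. For $t\in T$ define the generalized Radon transform $$T_{\phi_t}f(x)=\int_{\{y:\ \phi_l(x,y)=t_l,\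 1\le l\le m\}}f(y)\,\psi(x,y)\,d\sigma_{x,t}(y),$$ where $\sigma_{x,t}$ is the $(d-m)$-dimensional surface measure on the level set. Suppose that for some $s>0$ the operators $T_{\phi_t}$ map $L^2(\mathbb R^d)$ to the Sobolev space $L^2_s(\mathbb R^d)$ with a bound uniform in $t\in T$, that is, there is a constant $C'$ with $\|T_{\phi_t}f\|_{L^2_s}\le C'\|f\|_{L^2}$ for all $t\in T$ and all complex-valued $f\in C_c^\infty(\mathbb R^d)$, where $\|g\|_{L^2_s}=\|(1+|\xi|^2)^{s/2}\,\widehat g\,\|_{L^2}$. Suppose also that $\dim_{\mathcal H}(E)>d-s$. Then for every $t\in T$ the set $S_t(E)=\{(x,y)\in E\times E:\ \phi_l(x,y)=t_l,\ 1\le l\le m\}$ satisfies $$\overline{\dim}_{\mathcal M}(S_t(E))\le 2\dim_{\mathcal H}(E)-m,$$ where $\overline{\dim}_{\mathcal M}(S)=\limsup_{\delta\to0^+}\log N(S,\delta)/\log(1/\delta)$, with $N(S,\delta)$ the least number of balls of radius $\delta$ centred in $S$ that cover $S$, and $\overline{\dim}_{\mathcal M}(\emptyset)=-\infty$. -/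

import Mathlib

open MeasureTheory Filter Topology
open scoped ENNReal NNReal ContDiff

noncomputable section

/-- A subset `E` of a metric space is Ahlfors-David regular if it carries a Borel measure `μ` with
`C⁻¹ δ ^ α ≤ μ (B(x, δ)) ≤ C δ ^ α` for all `x ∈ E` and all small scales `0 < δ ≤ 1`, where `α` is
the Hausdorff dimension of `E`. -/
def IsAhlforsDavidRegular {X : Type*} [MetricSpace X] [MeasurableSpace X] [BorelSpace X]
    (E : Set X) : Prop :=
  ∃ μ : Measure X, μ Eᶜ = 0 ∧ ∃ C : ℝ, 0 < C ∧ ∀ x ∈ E, ∀ δ : ℝ, 0 < δ → δ ≤ 1 →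
    ENNReal.ofReal (C⁻¹ * δ ^ (dimH E).toReal) ≤ μ (Metric.ball x δ) ∧
      μ (Metric.ball x δ) ≤ ENNReal.ofReal (C * δ ^ (dimH E).toReal)

/-- The upper Minkowski (box-counting) dimension `limsup_{δ → 0+} log N(S, δ) / log (1 / δ)`, where
`N(S, δ)` is the least number of balls of radius `δ` centred in `S` that cover `S`.
The empty set has dimension `-∞`. -/
def upperMinkowskiDim {X : Type*} [MetricSpace X] (S : Set X) : EReal :=
  limsup (fun δ : ℝ =>
    ENNReal.log ((Metric.coveringNumber δ.toNNReal S : ℕ∞) : ℝ≥0∞) /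
      ((Real.log (1 / δ) : ℝ) : EReal)) (𝓝[>] (0 : ℝ))

/-- The generalized Radon transform
`T f (x) = ∫_{y : φ_l(x, y) = t_l for all l} f(y) ψ(x, y) dσ_{x,t}(y)`, where `σ_{x,t}` is the
surface measure of the level set, that is the `(d - m)`-dimensional Hausdorff measure, normalized
so that it is Lebesgue measure on `(d - m)`-dimensional planes. -/
def generalizedRadonTransform {d m : ℕ}
    (φ : Fin m → EuclideanSpace ℝ (Fin d) × EuclideanSpace ℝ (Fin d) → ℝ)
    (ψ : EuclideanSpace ℝ (Fin d) × EuclideanSpace ℝ (Fin d) → ℝ)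
    (t : Fin m → ℝ) (f : EuclideanSpace ℝ (Fin d) → ℂ) (x : EuclideanSpace ℝ (Fin d)) : ℂ :=
  ∫ y in {y : EuclideanSpace ℝ (Fin d) | ∀ l, φ l (x, y) = t l},
    f y * (ψ (x, y) : ℂ) ∂(Measure.euclideanHausdorffMeasure (d - m))

/-- `g ∈ L²` lies in the Sobolev space `L²_s`, with norm at most `R`: the distribution
`𝓕⁻¹ (1 + |ξ|²)^{s/2} 𝓕 g` is a function in `L²` of norm at most `R`. -/
def SobolevNormLE {d : ℕ} (s : ℝ) (g : EuclideanSpace ℝ (Fin d) → ℂ) (R : ℝ) : Prop :=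
  ∃ hg : MemLp g 2 volume, ∃ h : Lp ℂ 2 (volume : Measure (EuclideanSpace ℝ (Fin d))),
    TemperedDistribution.besselPotential (EuclideanSpace ℝ (Fin d)) ℂ s
        (Lp.toTemperedDistribution (hg.toLp g)) = Lp.toTemperedDistribution h ∧
      ‖h‖ ≤ R

/-- An operator `A`, given on smooth compactly supported functions, is bounded from `L²` to `L²_s`
with constant `C`. As these functions are dense in `L²`, this says that `A` extends to a bounded
operator from `L²` to `L²_s` of norm at most `C`. -/
def IsL2SobolevBounded {d : ℕ} (s C : ℝ)
    (A : (EuclideanSpace ℝ (Fin d) → ℂ) → EuclideanSpace ℝ (Fin d) → ℂ) : Prop :=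
  ∀ f : EuclideanSpace ℝ (Fin d) → ℂ, ContDiff ℝ ∞ f → HasCompactSupport f →
    SobolevNormLE s (A f) (C * (eLpNorm f 2 volume).toReal)

/-- `S_t(E) = {(x, y) ∈ E × E : φ_l(x, y) = t_l for all l}`. -/
def pairedLevelSet {d m : ℕ}
    (φ : Fin m → EuclideanSpace ℝ (Fin d) × EuclideanSpace ℝ (Fin d) → ℝ)
    (t : Fin m → ℝ) (E : Set (EuclideanSpace ℝ (Fin d))) :
    Set (EuclideanSpace ℝ (Fin d) × EuclideanSpace ℝ (Fin d)) :=
  {p | p.1 ∈ E ∧ p.2 ∈ E ∧ ∀ l, φ l p = t l}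

end

open Set Module FourierTransform
open scoped SchwartzMap

/-! Write `α` for the dimension of `E` and let `f` be the regular measure `μ` mollified at scale
`δ`. Everything rests on two bounds for the bilinear form `∫ T f · f`, where `T` is the Radon
transform at the fixed level `t`.

Lower bound. Within `δ` of `E` one has `f ≳ δ ^ (α - d)`. Let `P` be a `2δ`-separated subset of
`S_t(E)`. For every `x` within a small multiple of `δ` of `p.1`, the level set over `x` has surface
measure `≳ δ ^ (d - m)` in the `δ`-ball around `p.2`. So each `p ∈ P` contributes `≳ δ ^ (2 (α - d))
· δ ^ (d - m) · δ ^ d = δ ^ (2 α - m)`, and separation keeps these contributions disjoint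
(`exists_card_le_of_separated`).

Upper bound. The form is bounded uniformly in `δ` (`exists_norm_integral_sumTransform_mul_self_le`),
hence `card P ≲ δ ^ (-(2 α - m))`, and packing numbers control covering numbers. The mollifications
are uniformly Frostman (`exists_mollification`), which gives the energy bound `∫_{|ξ| ≤ R} |𝓕 f|² ≲
R ^ (d - α)` (`exists_setIntegral_norm_sq_fourier_le`). Cut the second factor `f` into dyadic
frequency pieces of size `A`, and the first at frequency `A ^ (1 + κ)`
(`exists_norm_integral_dyadic_le`): - Frequencies below the cut: duality between `L²_s` and
`L²_{-s}` gives a gain `A ^ (-s)` against two energy factors, of total size `A ^ ((1 + κ/2) (d -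
α))`. As `s > d - α`, a small `κ` leaves a negative power of `A`. - Frequencies above the cut: `T`
barely moves frequencies. In a chart `y = γ(x, w)` of the level set, the form becomes an oscillatory
integral with phase `2π (⟨ξ, γ(x, w)⟩ - ⟨η, x⟩)`. Independence of the `x`-gradients makes `γ` a
submersion, so repeated integration by parts gains any power of `|η| / |ξ|`
(`exists_norm_pow_mul_integral_oscillation_le`).

The pieces sum geometrically in `A`. Independence of the `y`-gradients makes the level sets graphs
over `(d - m)`-dimensional space. An area formula turns Hausdorff measure on them into Lebesgue
measure with a smooth density, and a partition of unity writes `T` as a finite sum of such integrals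
(`exists_generalizedRadonTransform_eq_sum`). -/

/-! ### Comparison of the Hausdorff measures of two images. -/

theorem hausdorffMeasure_image_le_of_dist_le {X Y Z : Type*} [MetricSpace Y] [MetricSpace Z]
    [MeasurableSpace Y] [BorelSpace Y] [MeasurableSpace Z] [BorelSpace Z]
    {f : X → Y} {h : X → Z} {s : Set X} {C : ℝ≥0} {k : ℝ} (hk : 0 ≤ k)
    (hfh : ∀ x ∈ s, ∀ y ∈ s, dist (f x) (f y) ≤ C * dist (h x) (h y)) :
    μH[k] (f '' s) ≤ (C : ℝ≥0∞) ^ k * μH[k] (h '' s) := by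
  rcases s.eq_empty_or_nonempty with rfl | ⟨x₀, -⟩
  · simp
  have : Nonempty X := ⟨x₀⟩
  classical
  -- `u` selects preimages under `h`. Points with equal `h`-value have equal `f`-value, so `f ∘ u`
  -- carries `h '' s` onto `f '' s` although `h` need not be injective.
  set u : Z → X := fun z => Function.invFunOn h s z
  have hu : ∀ z ∈ h '' s, u z ∈ s ∧ h (u z) = z := fun z hz =>
    ⟨Function.invFunOn_mem hz, Function.invFunOn_eq hz⟩
  have hL : LipschitzOnWith C (f ∘ u) (h '' s) := by
    refine LipschitzOnWith.of_dist_le_mul fun z hz w hw => ?_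
    have := hfh _ (hu z hz).1 _ (hu w hw).1
    rwa [(hu z hz).2, (hu w hw).2] at this
  have heq : (f ∘ u) '' (h '' s) = f '' s := by
    rw [image_image]
    refine image_congr fun x hx => ?_
    have hx' := hu (h x) (mem_image_of_mem h hx)
    have := hfh _ hx'.1 _ hx
    rw [hx'.2, dist_self, mul_zero] at this
    exact dist_le_zero.1 this
  rw [← heq]
  exact hL.hausdorffMeasure_image_le hk

theorem euclideanHausdorffMeasure_image_le_of_dist_le {X Y Z : Type*} [MetricSpace Y]
    [MetricSpace Z] [MeasurableSpace Y] [BorelSpace Y] [MeasurableSpace Z] [BorelSpace Z]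
    {f : X → Y} {h : X → Z} {s : Set X} {C : ℝ≥0} {k : ℕ}
    (hfh : ∀ x ∈ s, ∀ y ∈ s, dist (f x) (f y) ≤ C * dist (h x) (h y)) :
    μHE[k] (f '' s) ≤ (C : ℝ≥0∞) ^ k * μHE[k] (h '' s) := by
  have := hausdorffMeasure_image_le_of_dist_le (k := k) (by positivity) hfh
  simp only [Measure.euclideanHausdorffMeasure_def, Measure.smul_apply, Measure.nnreal_smul_coe_apply]
  rw [mul_left_comm]
  gcongr
  simpa using this

/-! ### The area formula for graphs. -/

section Area

variable {k : ℕ} {F : Type*} [NormedAddCommGroup F] [MeasurableSpace F] [BorelSpace F]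

local notation "V" => EuclideanSpace ℝ (Fin k)

/-- The measure `A ↦ μHE[k] (g '' A)` for a map with a Lipschitz left inverse `π`. -/
theorem map_restrict_image_apply {g : V → F} {W A : Set V} {π : F → V} (hπ : Measurable π)
    (hleft : ∀ w ∈ W, π (g w) = w) (hA : MeasurableSet A) :
    ((μHE[k] : Measure F).restrict (g '' W)).map π A = μHE[k] (g '' (W ∩ A)) := by
  rw [Measure.map_apply hπ hA, Measure.restrict_apply (hπ hA)]
  congr 1
  ext y
  constructor
  · rintro ⟨hy, w, hw, rfl⟩
    exact ⟨w, ⟨hw, by simpa [hleft w hw] using hy⟩, rfl⟩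
  · rintro ⟨w, ⟨hw, hwA⟩, rfl⟩
    exact ⟨by simpa [hleft w hw] using hwA, w, hw, rfl⟩

variable [InnerProductSpace ℝ F]

theorem euclideanHausdorffMeasure_linear_image (A : V →L[ℝ] F) (s : Set V) :
    μHE[k] (A '' s) = ENNReal.ofReal (LinearMap.normDet (A : V →ₗ[ℝ] F)) * volume s := by
  have := LinearMap.euclideanHausdorffMeasure_image_eq_normDet_mul_volume (A : V →ₗ[ℝ] F) s
  rw [finrank_euclideanSpace_fin] at this
  exact this

/-- From `π ∘ g = id` with `π` a contraction, neither `g` nor `g'` shrinks distances near `w`. The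
error `δ ‖x - y‖` of strict differentiability is therefore a relative error for both maps, and the
images of a small ball under `g` and `g'` have measures agreeing up to `(1 + δ) ^ k`. -/
theorem tendsto_euclideanHausdorffMeasure_image_closedBall {g : V → F} {g' : V →L[ℝ] F} {w : V}
    (hg : HasStrictFDerivAt g g' w) {π : F →L[ℝ] V} (hπ : ‖π‖ ≤ 1)
    (hleft : ∀ᶠ v in 𝓝 w, π (g v) = v) :
    Tendsto (fun r => μHE[k] (g '' Metric.closedBall w r) / volume (Metric.closedBall w r))
      (𝓝[>] (0 : ℝ)) (𝓝 (ENNReal.ofReal (LinearMap.normDet (g' : V →ₗ[ℝ] F)))) := by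
  set J := ENNReal.ofReal (LinearMap.normDet (g' : V →ₗ[ℝ] F)) with hJ
  have hπ' : ∀ y, ‖π y‖ ≤ ‖y‖ := fun y => (π.le_opNorm y).trans (by nlinarith [norm_nonneg y])
  have hlin : ∀ v, π (g' v) = v := by
    have h1 : HasFDerivAt (fun v => π (g v)) (π.comp g') w :=
      π.hasFDerivAt.comp w hg.hasFDerivAt
    have h2 : HasFDerivAt (fun v => π (g v)) (ContinuousLinearMap.id ℝ V) w :=
      (hasFDerivAt_id w).congr_of_eventuallyEq hleft
    have := h1.unique h2
    intro v
    simpa using congrArg (fun L => L v) this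
  -- two-sided comparison
  have key : ∀ δ : ℝ≥0, 0 < δ → ∀ᶠ r in 𝓝[>] (0 : ℝ),
      μHE[k] (g '' Metric.closedBall w r) / volume (Metric.closedBall w r)
          ≤ ((1 + δ : ℝ≥0) : ℝ≥0∞) ^ k * J ∧
      J ≤ ((1 + δ : ℝ≥0) : ℝ≥0∞) ^ k *
        (μHE[k] (g '' Metric.closedBall w r) / volume (Metric.closedBall w r)) := by
    intro δ hδ
    obtain ⟨s, hs, happ⟩ := hg.approximates_deriv_on_nhds (Or.inr hδ)
    obtain ⟨ε, hε, hball⟩ := Metric.mem_nhds_iff.1 (inter_mem hs hleft)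
    have : ∀ᶠ r in 𝓝[>] (0 : ℝ), r < ε ∧ 0 < r := by
      filter_upwards [Ioo_mem_nhdsGT hε] with r hr using ⟨hr.2, hr.1⟩
    filter_upwards [this] with r ⟨hr, hr0⟩
    have hsub : Metric.closedBall w r ⊆ s ∩ {v | π (g v) = v} :=
      (Metric.closedBall_subset_ball hr).trans hball
    have hv0 : volume (Metric.closedBall w r) ≠ 0 :=
      (Metric.measure_closedBall_pos volume w hr0).ne'
    have hvt : volume (Metric.closedBall w r) ≠ ⊤ := measure_closedBall_lt_top.ne
    have e1 : ∀ x ∈ Metric.closedBall w r, ∀ y ∈ Metric.closedBall w r,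
        dist (g x) (g y) ≤ (1 + δ : ℝ≥0) * dist (g' x) (g' y) := by
      intro x hx y hy
      have h1 := happ _ (hsub hx).1 _ (hsub hy).1
      have h2 : ‖x - y‖ ≤ ‖g' x - g' y‖ := by
        have := hπ' (g' x - g' y)
        rwa [map_sub, hlin, hlin] at this
      rw [dist_eq_norm, dist_eq_norm]
      have h3 : ‖g x - g y‖ ≤ ‖g x - g y - g' (x - y)‖ + ‖g' x - g' y‖ := by
        rw [← map_sub]; simpa using norm_add_le (g x - g y - g' (x - y)) (g' (x - y))
      push_cast
      nlinarith [δ.2]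
    have e2 : ∀ x ∈ Metric.closedBall w r, ∀ y ∈ Metric.closedBall w r,
        dist (g' x) (g' y) ≤ (1 + δ : ℝ≥0) * dist (g x) (g y) := by
      intro x hx y hy
      have h1 := happ _ (hsub hx).1 _ (hsub hy).1
      have h2 : ‖x - y‖ ≤ ‖g x - g y‖ := by
        have := hπ' (g x - g y)
        rwa [map_sub, (hsub hx).2, (hsub hy).2] at this
      rw [dist_eq_norm, dist_eq_norm]
      have h3 : ‖g' x - g' y‖ ≤ ‖g x - g y - g' (x - y)‖ + ‖g x - g y‖ := by
        rw [← map_sub, norm_sub_rev (g x - g y)]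
        simpa using norm_add_le (g' (x - y) - (g x - g y)) (g x - g y)
      push_cast
      nlinarith [δ.2]
    have i1 := euclideanHausdorffMeasure_image_le_of_dist_le (k := k) e1
    have i2 := euclideanHausdorffMeasure_image_le_of_dist_le (k := k) e2
    rw [euclideanHausdorffMeasure_linear_image] at i1 i2
    constructor
    · rw [ENNReal.div_le_iff hv0 hvt]
      rwa [mul_assoc]
    · rw [← mul_div_assoc, ENNReal.le_div_iff_mul_le (Or.inl hv0) (Or.inl hvt)]
      exact i2
  have hcont : Tendsto (fun δ : ℝ≥0 => ((1 + δ : ℝ≥0) : ℝ≥0∞) ^ k) (𝓝[>] 0) (𝓝 1) := by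
    have : Continuous (fun δ : ℝ≥0 => ((1 + δ : ℝ≥0) : ℝ≥0∞) ^ k) := by fun_prop
    have := (this.tendsto 0).mono_left (nhdsWithin_le_nhds (s := Ioi 0))
    simpa using this
  have hJt : J ≠ ⊤ := ENNReal.ofReal_ne_top
  -- Both halves let `δ → 0` in `key`.
  refine tendsto_order.2 ⟨fun a ha => ?_, fun a ha => ?_⟩
  · have h1 : Tendsto (fun δ : ℝ≥0 => ((1 + δ : ℝ≥0) : ℝ≥0∞) ^ k * a) (𝓝[>] 0) (𝓝 (1 * a)) :=
      ENNReal.Tendsto.mul_const hcont (Or.inl one_ne_zero)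
    rw [one_mul] at h1
    obtain ⟨δ, h2, h3⟩ := ((h1.eventually (gt_mem_nhds ha)).and self_mem_nhdsWithin).exists
    filter_upwards [key δ h3] with r hr
    by_contra hcon
    push Not at hcon
    exact absurd (hr.2.trans (mul_le_mul_right hcon _)) (not_le.2 h2)
  · have h1 : Tendsto (fun δ : ℝ≥0 => ((1 + δ : ℝ≥0) : ℝ≥0∞) ^ k * J) (𝓝[>] 0) (𝓝 (1 * J)) :=
      ENNReal.Tendsto.mul_const hcont (Or.inl one_ne_zero)
    rw [one_mul] at h1
    obtain ⟨δ, h2, h3⟩ := ((h1.eventually (gt_mem_nhds ha)).and self_mem_nhdsWithin).exists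
    filter_upwards [key δ h3] with r hr
    exact hr.1.trans_lt h2

/-- **Area formula** for a `C¹` map that has a linear left inverse of norm at most one. -/
theorem map_restrict_image_eq_withDensity {g : V → F} {W : Set V} (hW : IsOpen W)
    (hg : ContDiffOn ℝ 1 g W) {L : ℝ≥0} (hL : LipschitzOnWith L g W) {π : F →L[ℝ] V} (hπ : ‖π‖ ≤ 1)
    (hleft : ∀ w ∈ W, π (g w) = w) :
    ((μHE[k] : Measure F).restrict (g '' W)).map π =
      (volume.restrict W).withDensity
        (fun w => ENNReal.ofReal (LinearMap.normDet (fderiv ℝ g w : V →ₗ[ℝ] F))) := by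
  set ν := ((μHE[k] : Measure F).restrict (g '' W)).map π with hν
  have hνA : ∀ A, MeasurableSet A → ν A = μHE[k] (g '' (W ∩ A)) := fun A hA =>
    map_restrict_image_apply π.continuous.measurable hleft hA
  -- The Lipschitz bound makes `ν` locally finite and absolutely continuous, so it is determined by
  -- its derivative along small balls, which the preceding lemma computes.
  have hle : ν ≤ ((L : ℝ≥0∞) ^ k) • volume.restrict W := by
    refine Measure.le_iff.2 fun A hA => ?_
    rw [hνA A hA, Measure.smul_apply, Measure.restrict_apply hA, inter_comm A W, smul_eq_mul]
    have := euclideanHausdorffMeasure_image_le_of_dist_le (k := k) (f := g) (h := id)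
      (s := W ∩ A) (C := L) (fun x hx y hy => hL.dist_le_mul x hx.1 y hy.1)
    rwa [image_id, EuclideanSpace.euclideanHausdorffMeasure_eq_volume] at this
  have hfin : IsLocallyFiniteMeasure ν := by
    refine ⟨fun x => ⟨Metric.ball x 1, Metric.ball_mem_nhds x one_pos, ?_⟩⟩
    refine (hle _).trans_lt ?_
    rw [Measure.smul_apply, smul_eq_mul]
    exact ENNReal.mul_lt_top (by simp)
      ((Measure.restrict_apply_le _ _).trans_lt measure_ball_lt_top)
  have hac : ν ≪ volume :=
    (Measure.absolutelyContinuous_of_le hle).trans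
      ((Measure.smul_absolutelyContinuous).trans Measure.restrict_le_self.absolutelyContinuous)
  have hνW : ν Wᶜ = 0 := by
    rw [hνA _ hW.measurableSet.compl]; simp
  have hden : ∀ᵐ w ∂(volume : Measure V), w ∈ W → ν.rnDeriv volume w =
      ENNReal.ofReal (LinearMap.normDet (fderiv ℝ g w : V →ₗ[ℝ] F)) := by
    filter_upwards [Besicovitch.ae_tendsto_rnDeriv ν volume] with w hw hwW
    have hst : HasStrictFDerivAt g (fderiv ℝ g w) w :=
      (hg.contDiffAt (hW.mem_nhds hwW)).hasStrictFDerivAt one_ne_zero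
    have h2 := tendsto_euclideanHausdorffMeasure_image_closedBall hst hπ
      (by filter_upwards [hW.mem_nhds hwW] with v hv using hleft v hv)
    refine tendsto_nhds_unique hw (h2.congr' ?_)
    obtain ⟨ε, hε, hball⟩ := Metric.isOpen_iff.1 hW w hwW
    filter_upwards [Ioo_mem_nhdsGT hε] with r hr
    rw [hνA _ Metric.isClosed_closedBall.measurableSet,
      inter_eq_self_of_subset_right ((Metric.closedBall_subset_ball hr.2).trans hball)]
  rw [← Measure.withDensity_rnDeriv_eq ν volume hac]
  refine Measure.ext fun A hA => ?_
  rw [withDensity_apply _ hA, withDensity_apply _ hA, Measure.restrict_restrict hA]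
  -- The ball computation says nothing off `W`, but `ν` has no mass there.
  have h0 : ∫⁻ a in A ∩ Wᶜ, ν.rnDeriv volume a = 0 := by
    rw [← withDensity_apply _ (hA.inter hW.measurableSet.compl),
      Measure.withDensity_rnDeriv_eq ν volume hac]
    exact measure_mono_null inter_subset_right hνW
  rw [← lintegral_inter_add_sdiff _ A hW.measurableSet, sdiff_eq, h0, add_zero]
  refine setLIntegral_congr_fun_ae (hA.inter hW.measurableSet) ?_
  filter_upwards [hden] with w hw hwA using hw hwA.2

end Area

/-! ### Smoothness of the Jacobian factor. -/

section NormDet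

variable {k : ℕ} {F : Type*} [NormedAddCommGroup F] [InnerProductSpace ℝ F]

local notation "V" => EuclideanSpace ℝ (Fin k)

theorem normDet_eq_sqrt_det_gram (A : V →L[ℝ] F) :
    LinearMap.normDet (A : V →ₗ[ℝ] F) =
      √(Matrix.det (Matrix.of fun i j : Fin k => inner ℝ (A (EuclideanSpace.basisFun (Fin k) ℝ i))
        (A (EuclideanSpace.basisFun (Fin k) ℝ j)))) := by
  have h := LinearMap.normDet_sq_eq_det_gram (A : V →ₗ[ℝ] F) (EuclideanSpace.basisFun (Fin k) ℝ)
  have h' : LinearMap.normDet (A : V →ₗ[ℝ] F) ^ 2 = _ := h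
  rw [← Real.sqrt_sq (LinearMap.normDet_nonneg (A : V →ₗ[ℝ] F)), h']
  rfl

theorem contDiff_det_gram : ContDiff ℝ ∞ (fun A : V →L[ℝ] F =>
      Matrix.det (Matrix.of fun i j : Fin k => inner ℝ (A (EuclideanSpace.basisFun (Fin k) ℝ i))
        (A (EuclideanSpace.basisFun (Fin k) ℝ j)))) := by
  simp only [Matrix.det_apply, Matrix.of_apply]
  refine ContDiff.sum fun σ _ => ContDiff.const_smul _ (contDiff_prod fun i _ => ?_)
  exact ContDiff.inner ℝ (by fun_prop) (by fun_prop)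

theorem continuous_normDet :
    Continuous fun A : V →L[ℝ] F => LinearMap.normDet (A : V →ₗ[ℝ] F) := by
  simp only [normDet_eq_sqrt_det_gram]
  exact Real.continuous_sqrt.comp contDiff_det_gram.continuous

/-- The Gram determinant is polynomial in the entries, so its square root is smooth where it does
not vanish, that is, at injective maps. -/
theorem contDiffAt_normDet {A : V →L[ℝ] F} (hA : Function.Injective A) :
    ContDiffAt ℝ ∞ (fun A : V →L[ℝ] F => LinearMap.normDet (A : V →ₗ[ℝ] F)) A := by
  have h0 : LinearMap.normDet (A : V →ₗ[ℝ] F) ≠ 0 :=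
    ((A : V →ₗ[ℝ] F).normDet_ne_zero_tfae.out 0 4).2 hA
  simp only [normDet_eq_sqrt_det_gram] at h0 ⊢
  refine ContDiffAt.sqrt contDiff_det_gram.contDiffAt fun h => h0 ?_
  rw [h, Real.sqrt_zero]

end NormDet

/-! ### Integrals over graphs. -/

section AreaIntegral

variable {k d : ℕ}

local notation "V" => EuclideanSpace ℝ (Fin k)
local notation "F" => EuclideanSpace ℝ (Fin d)

/-- On the graph, `h` equals `(h ∘ g) ∘ π`, so its integral is one against the pushforward under
`π`, which the area formula identifies. Integrability is recorded too: the partition of unity and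
the final lower bound both need it. -/
theorem integral_image_eq_integral_normDet {g : V → F} {W : Set V} (hW : IsOpen W)
    (hg : ContDiffOn ℝ 1 g W) {L : ℝ≥0} (hL : LipschitzOnWith L g W) {π : F →L[ℝ] V} (hπ : ‖π‖ ≤ 1)
    (hleft : ∀ w ∈ W, π (g w) = w) {h : F → ℂ} (hh : Continuous h) :
    (IntegrableOn (fun w => (LinearMap.normDet (fderiv ℝ g w : V →ₗ[ℝ] F) : ℂ) * h (g w)) W →
      IntegrableOn h (g '' W) μHE[k]) ∧
    ∫ y in g '' W, h y ∂μHE[k] =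
      ∫ w in W, (LinearMap.normDet (fderiv ℝ g w : V →ₗ[ℝ] F) : ℂ) * h (g w) := by
  have hinj : InjOn g W := fun x hx y hy hxy => by rw [← hleft x hx, hxy, hleft y hy]
  have hmeas : MeasurableSet (g '' W) :=
    hW.measurableSet.image_of_continuousOn_injOn hg.continuousOn hinj
  have harea := map_restrict_image_eq_withDensity hW hg hL hπ hleft
  have hcd : ContinuousOn (fun w => LinearMap.normDet (fderiv ℝ g w : V →ₗ[ℝ] F)) W :=
    continuous_normDet.comp_continuousOn (hg.continuousOn_fderiv_of_isOpen hW le_rfl)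
  have hdm : AEMeasurable (fun w => (LinearMap.normDet (fderiv ℝ g w : V →ₗ[ℝ] F)).toNNReal)
      (volume.restrict W) := (hcd.aemeasurable hW.measurableSet).real_toNNReal
  have hsm : AEStronglyMeasurable (h ∘ g)
      (((μHE[k] : Measure F).restrict (g '' W)).map π) := by
    rw [harea]
    exact ((hh.comp_continuousOn hg.continuousOn).aestronglyMeasurable hW.measurableSet).mono_ac
      (withDensity_absolutelyContinuous _ _)
  have heq : ∀ y ∈ g '' W, h y = (h ∘ g) (π y) := by
    rintro _ ⟨w, hw, rfl⟩
    simp [hleft w hw]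
  have hreal : ∀ w, ((LinearMap.normDet (fderiv ℝ g w : V →ₗ[ℝ] F)).toNNReal) • (h ∘ g) w =
      (LinearMap.normDet (fderiv ℝ g w : V →ₗ[ℝ] F) : ℂ) * h (g w) := fun w => by
    rw [NNReal.smul_def, Real.coe_toNNReal _ (LinearMap.normDet_nonneg _)]
    simp
  constructor
  · intro hi
    refine (integrableOn_congr_fun heq hmeas).2 ?_
    have : Integrable (h ∘ g) (((μHE[k] : Measure F).restrict (g '' W)).map π) := by
      rw [harea]
      refine (integrable_withDensity_iff_integrable_smul₀ hdm).2 ?_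
      simp only [hreal]
      exact hi
    exact (integrable_map_measure hsm π.continuous.aemeasurable).1 this
  · rw [setIntegral_congr_fun hmeas heq, ← integral_map π.continuous.aemeasurable hsm, harea]
    rw [show (fun w => ENNReal.ofReal (LinearMap.normDet (fderiv ℝ g w : V →ₗ[ℝ] F))) =
      fun w => (((LinearMap.normDet (fderiv ℝ g w : V →ₗ[ℝ] F)).toNNReal : ℝ≥0) : ℝ≥0∞) from rfl,
      integral_withDensity_eq_integral_smul₀ hdm]
    simp only [hreal]

end AreaIntegral

theorem contDiff_of_contDiffAt_tsupport {E G : Type*} [NormedAddCommGroup E] [NormedSpace ℝ E]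
    [NormedAddCommGroup G] [NormedSpace ℝ G] {n : WithTop ℕ∞} {f : E → G}
    (h : ∀ x ∈ tsupport f, ContDiffAt ℝ n f x) : ContDiff ℝ n f := by
  refine contDiff_iff_contDiffAt.2 fun x => ?_
  by_cases hx : x ∈ tsupport f
  · exact h x hx
  · exact contDiffAt_const.congr_of_eventuallyEq (notMem_tsupport_iff_eventuallyEq.1 hx)

/-! ### Oscillatory integrals with a submersive phase. -/

section NonstationaryPhase

variable {d : ℕ} {P : Type*}

local notation "F" => EuclideanSpace ℝ (Fin d)

/-- The oscillating factor `exp (i (⟨ξ, γ p⟩ + ⟨η, q p⟩))`. -/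
noncomputable def oscFactor (γ q : P → F) (ξ η : F) (p : P) : ℂ :=
  Complex.exp (((inner ℝ ξ (γ p) + inner ℝ η (q p) : ℝ) : ℂ) * Complex.I)

theorem norm_oscFactor (γ q : P → F) (ξ η : F) (p : P) : ‖oscFactor γ q ξ η p‖ = 1 :=
  Complex.norm_exp_ofReal_mul_I _

variable [NormedAddCommGroup P] [NormedSpace ℝ P]

theorem contDiff_oscFactor {γ q : P → F} (hγ : ContDiff ℝ ∞ γ) (hq : ContDiff ℝ ∞ q) (ξ η : F) :
    ContDiff ℝ ∞ (oscFactor γ q ξ η) := by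
  refine ContDiff.cexp (ContDiff.mul (Complex.ofRealCLM.contDiff.comp ?_) contDiff_const)
  exact (ContDiff.inner ℝ contDiff_const hγ).add (ContDiff.inner ℝ contDiff_const hq)

theorem fderiv_oscFactor {γ q : P → F} (hγ : ContDiff ℝ ∞ γ) (hq : ContDiff ℝ ∞ q) (ξ η : F)
    (p u : P) : fderiv ℝ (oscFactor γ q ξ η) p u =
      oscFactor γ q ξ η p * Complex.I *
        ((inner ℝ ξ (fderiv ℝ γ p u) + inner ℝ η (fderiv ℝ q p u) : ℝ) : ℂ) := by
  have h1 := (hγ.differentiable (by simp) p).hasFDerivAt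
  have h2 := (hq.differentiable (by simp) p).hasFDerivAt
  have h3 : HasFDerivAt (fun p => inner ℝ ξ (γ p) + inner ℝ η (q p))
      ((innerSL ℝ ξ).comp (fderiv ℝ γ p) + (innerSL ℝ η).comp (fderiv ℝ q p)) p :=
    ((innerSL ℝ ξ).hasFDerivAt.comp p h1).add ((innerSL ℝ η).hasFDerivAt.comp p h2)
  have h4 := ((Complex.ofRealCLM.hasFDerivAt.comp p h3).mul_const Complex.I).cexp
  have h5 : HasFDerivAt (oscFactor γ q ξ η) _ p := h4
  rw [h5.fderiv]
  simp [oscFactor]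
  ring

variable [FiniteDimensional ℝ P] [MeasurableSpace P] [BorelSpace P] (μ : Measure P)
  [μ.IsAddHaarMeasure]

theorem integral_fderiv_mul_of_hasCompactSupport {h b : P → ℂ} (hh : ContDiff ℝ ∞ h)
    (hb : ContDiff ℝ ∞ b) (hbc : HasCompactSupport b) (u : P) :
    ∫ p, fderiv ℝ h p u * b p ∂μ = -∫ p, h p * fderiv ℝ b p u ∂μ := by
  have hb' : Continuous fun p => fderiv ℝ b p u :=
    (hb.continuous_fderiv (by simp)).clm_apply continuous_const
  have hh' : Continuous fun p => fderiv ℝ h p u :=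
    (hh.continuous_fderiv (by simp)).clm_apply continuous_const
  have hbc' : HasCompactSupport fun p => fderiv ℝ b p u := hbc.fderiv_apply (𝕜 := ℝ) u
  rw [integral_mul_fderiv_eq_neg_fderiv_mul_of_integrable, neg_neg]
  · exact (hh'.mul hb.continuous).integrable_of_hasCompactSupport hbc.mul_left
  · exact (hh.continuous.mul hb').integrable_of_hasCompactSupport hbc'.mul_left
  · exact (hh.continuous.mul hb.continuous).integrable_of_hasCompactSupport hbc.mul_left
  · exact fun x _ => hh.differentiable (by simp) x
  · exact fun x _ => hb.differentiable (by simp) x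

/-- **Nonstationary phase**: when `γ` is a submersion on the support of the amplitude,
the oscillatory integral decays rapidly in `ξ`. -/
theorem exists_norm_pow_mul_integral_oscillation_le {γ q : P → F} (hγ : ContDiff ℝ ∞ γ)
    (hq : ContDiff ℝ ∞ q) {Ω : Set P} (R : F →L[ℝ] P)
    (hR : ∀ p ∈ Ω, ∃ e : F ≃L[ℝ] F, (fderiv ℝ γ p).comp R = e) (N : ℕ) :
    ∀ a : P → ℂ, ContDiff ℝ ∞ a → HasCompactSupport a → tsupport a ⊆ Ω →
      ∃ C : ℝ, 0 ≤ C ∧ ∀ ξ η : F,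
        ‖ξ‖ ^ N * ‖∫ p, oscFactor γ q ξ η p * a p ∂μ‖ ≤ C * (1 + ‖η‖) ^ N := by
  induction N with
  | zero =>
    intro a ha hac _
    refine ⟨∫ p, ‖a p‖ ∂μ, integral_nonneg fun _ => norm_nonneg _, fun ξ η => ?_⟩
    simp only [pow_zero, one_mul, mul_one]
    refine (norm_integral_le_integral_norm _).trans_eq ?_
    simp [norm_oscFactor]
  | succ N ih =>
    intro a ha hac haΩ
    set e := EuclideanSpace.basisFun (Fin d) ℝ with he
    -- `R (v j p)` is a direction along which `γ` moves by `e j`. Off `Ω` the operator may be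
    -- non-invertible and `inverse` takes the value `0`; this is harmless, since `v` occurs only
    -- multiplied by the amplitude `a`.
    set v : Fin d → P → F := fun j p => ContinuousLinearMap.inverse ((fderiv ℝ γ p).comp R) (e j)
      with hv
    have hv1 : ∀ j, ∀ p ∈ Ω, fderiv ℝ γ p (R (v j p)) = e j := by
      intro j p hp
      obtain ⟨A, hA⟩ := hR p hp
      have h1 : ((fderiv ℝ γ p).comp R) (v j p) = e j := by
        simp only [hv, hA, ContinuousLinearMap.inverse_equiv]
        simp
      exact h1
    have hv2 : ∀ j, ∀ p ∈ Ω, ContDiffAt ℝ ∞ (v j) p := by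
      intro j p hp
      obtain ⟨A, hA⟩ := hR p hp
      have h1 : ContDiffAt ℝ ∞ (fun p => (fderiv ℝ γ p).comp R) p :=
        ((hγ.fderiv_right (m := ∞) (by simp)).clm_comp contDiff_const).contDiffAt
      have h2 : ContDiffAt ℝ ∞ ContinuousLinearMap.inverse ((fderiv ℝ γ p).comp R) := by
        rw [hA]; exact contDiffAt_map_inverse A
      exact (h2.comp p h1).clm_apply contDiffAt_const
    set b : Fin d → Fin d → P → ℂ := fun j l p => a p * ((v j p l : ℝ) : ℂ) with hb
    have hbs : ∀ j l, tsupport (b j l) ⊆ tsupport a := fun j l => tsupport_mul_subset_left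
    have hbc : ∀ j l, HasCompactSupport (b j l) := fun j l => hac.mul_right
    have hbd : ∀ j l, ContDiff ℝ ∞ (b j l) := by
      intro j l
      refine contDiff_of_contDiffAt_tsupport fun p hp => ?_
      refine ha.contDiffAt.mul (Complex.ofRealCLM.contDiff.contDiffAt.comp p ?_)
      exact (EuclideanSpace.proj l).contDiff.contDiffAt.comp p (hv2 j p (haΩ (hbs j l hp)))
    have hzero : ∀ p, p ∉ tsupport a → ∀ j l, b j l p = 0 ∧ fderiv ℝ (b j l) p = 0 := by
      intro p hp j l
      have hp' : p ∉ tsupport (b j l) := fun h => hp (hbs j l h)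
      exact ⟨image_eq_zero_of_notMem_tsupport hp', fderiv_of_notMem_tsupport ℝ hp'⟩
    -- the amplitudes produced by one integration by parts
    set a₁ : Fin d → P → ℂ := fun j p => ∑ l, fderiv ℝ (b j l) p (R (e l)) with ha₁
    set a₂ : Fin d → Fin d → P → ℂ := fun j i p =>
      ∑ l, b j l p * ((fderiv ℝ q p (R (e l)) i : ℝ) : ℂ) with ha₂
    have hs₁ : ∀ j, Function.support (a₁ j) ⊆ tsupport a := by
      intro j p hp
      by_contra hpa
      exact hp (by simp [ha₁, hzero p hpa])
    have hs₂ : ∀ j i, Function.support (a₂ j i) ⊆ tsupport a := by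
      intro j i p hp
      by_contra hpa
      exact hp (by simp [ha₂, hzero p hpa])
    have h₁ : ∀ j, ∃ C : ℝ, 0 ≤ C ∧ ∀ ξ η : F,
        ‖ξ‖ ^ N * ‖∫ p, oscFactor γ q ξ η p * a₁ j p ∂μ‖ ≤ C * (1 + ‖η‖) ^ N := by
      intro j
      refine ih _ ?_ ?_ ?_
      · exact ContDiff.sum fun l _ => ((hbd j l).fderiv_right (m := ∞) (by simp)).clm_apply
          contDiff_const
      · exact HasCompactSupport.of_support_subset_isCompact hac (hs₁ j)
      · exact (closure_minimal (hs₁ j) (isClosed_tsupport a)).trans haΩ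
    have h₂ : ∀ j i, ∃ C : ℝ, 0 ≤ C ∧ ∀ ξ η : F,
        ‖ξ‖ ^ N * ‖∫ p, oscFactor γ q ξ η p * a₂ j i p ∂μ‖ ≤ C * (1 + ‖η‖) ^ N := by
      intro j i
      refine ih _ ?_ ?_ ?_
      · refine ContDiff.sum fun l _ => (hbd j l).mul (Complex.ofRealCLM.contDiff.comp ?_)
        exact (EuclideanSpace.proj i).contDiff.comp
          ((hq.fderiv_right (m := ∞) (by simp)).clm_apply contDiff_const)
      · exact HasCompactSupport.of_support_subset_isCompact hac (hs₂ j i)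
      · exact (closure_minimal (hs₂ j i) (isClosed_tsupport a)).trans haΩ
    choose C₁ hC₁0 hC₁ using h₁
    choose C₂ hC₂0 hC₂ using h₂
    -- Differentiating the oscillating factor along `R (v j p)` brings down exactly `i ξ_j` from
    -- `γ`, plus a term linear in `η` from `q`.
    have hpt : ∀ ξ η j p, ∑ l, fderiv ℝ (oscFactor γ q ξ η) p (R (e l)) * b j l p =
        ((ξ j : ℝ) : ℂ) * Complex.I * (oscFactor γ q ξ η p * a p) +
          ∑ i, ((η i : ℝ) : ℂ) * Complex.I * (oscFactor γ q ξ η p * a₂ j i p) := by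
      intro ξ η j p
      by_cases hp : p ∈ tsupport a
      · have hvsum : v j p = ∑ l, v j p l • e l := by
          conv_lhs => rw [← e.sum_repr (v j p)]
          simp [he]
        have hγv : ∑ l, v j p l * inner ℝ ξ (fderiv ℝ γ p (R (e l))) = ξ j := by
          have h1 := hv1 j p (haΩ hp)
          rw [hvsum] at h1
          simp only [map_sum, map_smul] at h1
          have h2 := congrArg (fun z => inner ℝ ξ z) h1
          simp only [inner_sum, inner_smul_right] at h2
          rw [h2]
          simp [he, EuclideanSpace.inner_single_right]
        have hqv : ∀ l, inner ℝ η (fderiv ℝ q p (R (e l))) =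
            ∑ i, η i * (fderiv ℝ q p (R (e l)) i) := by
          intro l
          simp [PiLp.inner_apply, mul_comm]
        simp only [fderiv_oscFactor hγ hq, ha₂, hb]
        rw [← hγv]
        simp only [hqv]
        push_cast
        simp only [Finset.mul_sum, Finset.sum_mul, mul_add, add_mul, Finset.sum_add_distrib]
        congr 1
        · exact Finset.sum_congr rfl fun l _ => by ring
        · rw [Finset.sum_comm]
          exact Finset.sum_congr rfl fun i _ => Finset.sum_congr rfl fun l _ => by ring
      · simp [ha₂, hzero p hp, image_eq_zero_of_notMem_tsupport hp]
    have hosc : ∀ ξ η, ContDiff ℝ ∞ (oscFactor γ q ξ η) := contDiff_oscFactor hγ hq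
    have hint : ∀ ξ η (f : P → ℂ), Continuous f → Function.support f ⊆ tsupport a →
        Integrable (fun p => oscFactor γ q ξ η p * f p) μ := fun ξ η f hf hs =>
      ((hosc ξ η).continuous.mul hf).integrable_of_hasCompactSupport
        (HasCompactSupport.of_support_subset_isCompact hac hs).mul_left
    have hint₂ : ∀ ξ η j i, Integrable (fun p => oscFactor γ q ξ η p * a₂ j i p) μ := by
      intro ξ η j i
      refine hint ξ η _ ?_ (hs₂ j i)
      refine continuous_finsetSum _ fun l _ => (hbd j l).continuous.mul
        (Complex.continuous_ofReal.comp ?_)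
      exact (EuclideanSpace.proj i).continuous.comp
          ((hq.continuous_fderiv (by simp)).clm_apply continuous_const)
    -- One integration by parts trades a factor `ξ_j` for a new amplitude `a₁`, and for amplitudes
    -- `a₂` weighted by `η_i`. Treating `η` as a weight avoids any lower bound on the gradient of
    -- the full phase, and costs one power of `1 + ‖η‖` per power of `‖ξ‖`.
    have key : ∀ ξ η j, ((ξ j : ℝ) : ℂ) * Complex.I * ∫ p, oscFactor γ q ξ η p * a p ∂μ =
        -(∫ p, oscFactor γ q ξ η p * a₁ j p ∂μ) -
          ∑ i, ((η i : ℝ) : ℂ) * Complex.I * ∫ p, oscFactor γ q ξ η p * a₂ j i p ∂μ := by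
      intro ξ η j
      have hibp : ∫ p, oscFactor γ q ξ η p * a₁ j p ∂μ =
          -∫ p, ∑ l, fderiv ℝ (oscFactor γ q ξ η) p (R (e l)) * b j l p ∂μ := by
        rw [integral_finsetSum, ← Finset.sum_neg_distrib]
        · simp only [integral_fderiv_mul_of_hasCompactSupport μ (hosc ξ η) (hbd j _) (hbc j _),
            neg_neg, ha₁, Finset.mul_sum]
          rw [integral_finsetSum]
          intro l _
          refine hint ξ η _ (((hbd j l).continuous_fderiv (by simp)).clm_apply continuous_const) ?_
          intro p hp
          by_contra hpa
          exact hp (by simp [hzero p hpa])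
        · intro l _
          refine Continuous.integrable_of_hasCompactSupport ?_ (hbc j l).mul_left
          exact (((hosc ξ η).continuous_fderiv (by simp)).clm_apply continuous_const).mul
            (hbd j l).continuous
      rw [hibp]
      simp only [hpt]
      rw [integral_add, integral_const_mul, integral_finsetSum]
      · simp only [integral_const_mul]
        ring
      · exact fun i _ => (hint₂ ξ η j i).const_mul _
      · exact (hint ξ η a ha.continuous subset_closure).const_mul _
      · exact integrable_finsetSum _ fun i _ => (hint₂ ξ η j i).const_mul _
    refine ⟨∑ j, (C₁ j + ∑ i, C₂ j i), Finset.sum_nonneg fun j _ => add_nonneg (hC₁0 j)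
      (Finset.sum_nonneg fun i _ => hC₂0 j i), fun ξ η => ?_⟩
    set I := ∫ p, oscFactor γ q ξ η p * a p ∂μ with hI
    have hξ : ‖ξ‖ ≤ ∑ j, ‖ξ j‖ := by
      conv_lhs => rw [← e.sum_repr ξ]
      refine (norm_sum_le _ _).trans (Finset.sum_le_sum fun j _ => ?_)
      simp [he, norm_smul]
    have hj : ∀ j, ‖ξ‖ ^ N * (‖ξ j‖ * ‖I‖) ≤ (C₁ j + ∑ i, C₂ j i) * (1 + ‖η‖) ^ (N + 1) := by
      intro j
      have h1 : ‖ξ j‖ * ‖I‖ = ‖((ξ j : ℝ) : ℂ) * Complex.I * I‖ := by simp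
      rw [h1, key]
      have h2 : ‖-(∫ p, oscFactor γ q ξ η p * a₁ j p ∂μ) -
          ∑ i, ((η i : ℝ) : ℂ) * Complex.I * ∫ p, oscFactor γ q ξ η p * a₂ j i p ∂μ‖ ≤
          ‖∫ p, oscFactor γ q ξ η p * a₁ j p ∂μ‖ +
            ∑ i, ‖η‖ * ‖∫ p, oscFactor γ q ξ η p * a₂ j i p ∂μ‖ := by
        refine (norm_sub_le _ _).trans ?_
        rw [norm_neg]
        gcongr
        refine (norm_sum_le _ _).trans (Finset.sum_le_sum fun i _ => ?_)
        have : ‖((η i : ℝ) : ℂ) * Complex.I‖ ≤ ‖η‖ := by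
          simpa using PiLp.norm_apply_le η i
        rw [norm_mul]
        gcongr
      refine (mul_le_mul_of_nonneg_left h2 (by positivity)).trans ?_
      have hη : (1 : ℝ) ≤ 1 + ‖η‖ := by linarith [norm_nonneg η]
      have hη0 : ‖η‖ ≤ 1 + ‖η‖ := by linarith
      have hpow : (0 : ℝ) ≤ (1 + ‖η‖) ^ N := by positivity
      rw [mul_add, add_mul, Finset.mul_sum, Finset.sum_mul]
      refine add_le_add ?_ (Finset.sum_le_sum fun i _ => ?_)
      · refine (hC₁ j ξ η).trans ?_
        exact mul_le_mul_of_nonneg_left (pow_le_pow_right₀ hη (Nat.le_succ N)) (hC₁0 j)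
      · calc ‖ξ‖ ^ N * (‖η‖ * ‖∫ p, oscFactor γ q ξ η p * a₂ j i p ∂μ‖)
            = ‖η‖ * (‖ξ‖ ^ N * ‖∫ p, oscFactor γ q ξ η p * a₂ j i p ∂μ‖) := by ring
          _ ≤ (1 + ‖η‖) * (C₂ j i * (1 + ‖η‖) ^ N) := by
              refine mul_le_mul hη0 (hC₂ j i ξ η) (by positivity) (by positivity)
          _ = C₂ j i * (1 + ‖η‖) ^ (N + 1) := by ring
    calc ‖ξ‖ ^ (N + 1) * ‖I‖ = ‖ξ‖ ^ N * (‖ξ‖ * ‖I‖) := by ring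
      _ ≤ ‖ξ‖ ^ N * ((∑ j, ‖ξ j‖) * ‖I‖) := by gcongr
      _ = ∑ j, ‖ξ‖ ^ N * (‖ξ j‖ * ‖I‖) := by rw [Finset.sum_mul, Finset.mul_sum]
      _ ≤ _ := by rw [Finset.sum_mul]; exact Finset.sum_le_sum fun j _ => hj j

end NonstationaryPhase

/-! ### Charts of the level sets. -/

section Chart

variable {d m k : ℕ}

local notation "F" => EuclideanSpace ℝ (Fin d)
local notation "V" => EuclideanSpace ℝ (Fin k)

/-- A parametrization near `p₀` of the level set `{Φ = t}` as a family, smooth in `x`, of graphs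
over a `k`-dimensional space, which is moreover a submersion onto the `y` space. -/
structure LevelSetChart (k : ℕ) (Φ : F × F → Fin m → ℝ) (t : Fin m → ℝ) (p₀ : F × F) where
  O : Set (F × F)
  Ω : Set (F × EuclideanSpace ℝ (Fin k))
  γ : F × EuclideanSpace ℝ (Fin k) → F
  π : F →L[ℝ] EuclideanSpace ℝ (Fin k)
  R : F →L[ℝ] F × EuclideanSpace ℝ (Fin k)
  L : ℝ≥0
  isOpen_O : IsOpen O
  mem_O : p₀ ∈ O
  isOpen_Ω : IsOpen Ω
  norm_π_le : ‖π‖ ≤ 1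
  contDiffOn_γ : ContDiffOn ℝ ∞ γ Ω
  lipschitzOnWith_γ : LipschitzOnWith L γ Ω
  π_γ : ∀ p ∈ Ω, π (γ p) = p.2
  Φ_γ : ∀ p ∈ Ω, Φ (p.1, γ p) = t
  mem_Ω : ∀ q ∈ O, Φ q = t → (q.1, π q.2) ∈ Ω
  γ_π : ∀ q ∈ O, Φ q = t → γ (q.1, π q.2) = q.2
  submersion : ∀ p ∈ Ω, ∃ e : F ≃L[ℝ] F, (fderiv ℝ γ p).comp R = e

/-- The map is the orthogonal projection onto `ker A`, which has dimension `d - m = k`, read in an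
orthonormal basis. -/
theorem exists_contraction_injective_on_ker (hk : m + k = d) {A : F →L[ℝ] Fin m → ℝ}
    (hA : Function.Surjective A) :
    ∃ π : F →L[ℝ] V, ‖π‖ ≤ 1 ∧ ∀ v, A v = 0 → π v = 0 → v = 0 := by
  set K := LinearMap.ker (A : F →ₗ[ℝ] Fin m → ℝ) with hK
  have hfin : finrank ℝ K = k := by
    have h1 := LinearMap.finrank_range_add_finrank_ker (A : F →ₗ[ℝ] Fin m → ℝ)
    rw [LinearMap.range_eq_top.2 hA, finrank_top, finrank_euclideanSpace_fin, finrank_fin_fun] at h1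
    change m + finrank ℝ K = d at h1
    omega
  let b := (stdOrthonormalBasis ℝ K).reindex (finCongr hfin)
  let r : K ≃ₗᵢ[ℝ] V := b.repr
  refine ⟨(r.toContinuousLinearEquiv : K →L[ℝ] V).comp K.orthogonalProjectionOnto, ?_, ?_⟩
  · refine ContinuousLinearMap.opNorm_le_bound _ zero_le_one fun x => ?_
    have h1 : ‖r (K.orthogonalProjectionOnto x)‖ = ‖K.orthogonalProjectionOnto x‖ := r.norm_map _
    refine h1.trans_le ((K.orthogonalProjectionOnto.le_opNorm x).trans ?_)
    gcongr
    exact K.orthogonalProjectionOnto_norm_le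
  · intro v hv hπ
    have h1 : K.orthogonalProjectionOnto v = 0 := r.map_eq_zero_iff.1 hπ
    have h2 : ((⟨v, hv⟩ : K) : F) = v := rfl
    rw [← h2, K.orthogonalProjectionOnto_mem_subspace_eq_self] at h1
    rw [← h2, h1]; rfl

/-- The inverse function theorem applies to `(x, y) ↦ (x, Φ(x, y), π y)`, with `π` injective on the
kernel of the `y`-derivative; `γ` is the `y`-component of the inverse on the slice `Φ = t`.
Surjectivity of the `y`-derivative gives the chart, and that of the `x`-derivative makes `γ` a
submersion. -/
theorem nonempty_levelSetChart (hk : m + k = d) {Φ : F × F → Fin m → ℝ} (hΦ : ContDiff ℝ ∞ Φ)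
    {t : Fin m → ℝ} {p₀ : F × F} (hp₀ : Φ p₀ = t)
    (hx : Function.Surjective ((fderiv ℝ Φ p₀).comp (ContinuousLinearMap.inl ℝ F F)))
    (hy : Function.Surjective ((fderiv ℝ Φ p₀).comp (ContinuousLinearMap.inr ℝ F F))) :
    Nonempty (LevelSetChart k Φ t p₀) := by
  obtain ⟨π, hπ, hker⟩ := exists_contraction_injective_on_ker (k := k) hk hy
  set Ψ : F × F → F × ((Fin m → ℝ) × V) := fun q => (q.1, (Φ q, π q.2)) with hΨdef
  have hΨ : ContDiff ℝ ∞ Ψ :=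
    contDiff_fst.prodMk (hΦ.prodMk (π.contDiff.comp contDiff_snd))
  set M : F × F → (F × F →L[ℝ] F × ((Fin m → ℝ) × V)) := fun q =>
    (ContinuousLinearMap.fst ℝ F F).prod
      ((fderiv ℝ Φ q).prod (π.comp (ContinuousLinearMap.snd ℝ F F))) with hM
  have hMd : ∀ q, HasFDerivAt Ψ (M q) q := fun q =>
    hasFDerivAt_fst.prodMk ((hΦ.differentiable (by simp) q).hasFDerivAt.prodMk
      (π.hasFDerivAt.comp q hasFDerivAt_snd))
  have hMc : Continuous M := by
    have : M = fderiv ℝ Ψ := funext fun q => (hMd q).fderiv.symm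
    rw [this]
    exact hΨ.continuous_fderiv (by simp)
  have hinj : Function.Injective (M p₀) := by
    refine (injective_iff_map_eq_zero _).2 fun ⟨u, v⟩ huv => ?_
    simp only [hM, ContinuousLinearMap.prod_apply, Prod.mk_eq_zero, ContinuousLinearMap.coe_fst',
      ContinuousLinearMap.comp_apply, ContinuousLinearMap.coe_snd'] at huv
    obtain ⟨rfl, h1, h2⟩ := huv
    simp [hker v h1 h2]
  have hfr : finrank ℝ (F × F) = finrank ℝ (F × ((Fin m → ℝ) × V)) := by
    simp only [finrank_prod, finrank_euclideanSpace_fin, finrank_fin_fun, hk]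
  let M₀ : (F × F) ≃L[ℝ] F × ((Fin m → ℝ) × V) :=
    (LinearEquiv.ofInjectiveOfFinrankEq (M p₀ : F × F →ₗ[ℝ] F × ((Fin m → ℝ) × V)) hinj
      hfr).toContinuousLinearEquiv
  have hM₀ : (M₀ : F × F →L[ℝ] F × ((Fin m → ℝ) × V)) = M p₀ := by
    ext x <;> rfl
  -- Smoothness of the local inverse is needed on a neighbourhood, so the chart is restricted to
  -- points where the derivative stays invertible.
  set U : Set (F × F) := M ⁻¹' range ((↑) : ((F × F) ≃L[ℝ] F × ((Fin m → ℝ) × V)) → _) with hU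
  have hUo : IsOpen U := ContinuousLinearEquiv.isOpen.preimage hMc
  have hpU : p₀ ∈ U := ⟨M₀, hM₀⟩
  have hst : HasFDerivAt Ψ (M₀ : F × F →L[ℝ] F × ((Fin m → ℝ) × V)) p₀ := hM₀ ▸ hMd p₀
  set e := hΨ.contDiffAt.toOpenPartialHomeomorph Ψ hst (by simp) with he
  have hecoe : (e : F × F → F × ((Fin m → ℝ) × V)) = Ψ :=
    hΨ.contDiffAt.toOpenPartialHomeomorph_coe hst (by simp)
  have hpe : p₀ ∈ e.source := hΨ.contDiffAt.mem_toOpenPartialHomeomorph_source hst (by simp)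
  set ι : F × V → F × ((Fin m → ℝ) × V) := fun p => (p.1, (t, p.2)) with hι
  have hιs : ContDiff ℝ ∞ ι := contDiff_fst.prodMk (contDiff_const.prodMk contDiff_snd)
  set Ω₀ : Set (F × V) := ι ⁻¹' (e.target ∩ e.symm ⁻¹' U) with hΩ₀
  have hΩ₀o : IsOpen Ω₀ := (e.isOpen_inter_preimage_symm hUo).preimage hιs.continuous
  set γ : F × V → F := fun p => (e.symm (ι p)).2 with hγ
  have hsymm : ∀ p ∈ Ω₀, Ψ (e.symm (ι p)) = ι p := fun p hp => by
    rw [← hecoe]; exact e.right_inv hp.1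
  have hγ1 : ∀ p ∈ Ω₀, e.symm (ι p) = (p.1, γ p) := fun p hp =>
    Prod.ext (by simpa only [hΨdef, hι] using congrArg Prod.fst (hsymm p hp)) rfl
  have hγΦ : ∀ p ∈ Ω₀, Φ (p.1, γ p) = t := fun p hp => by
    rw [← hγ1 p hp]; exact congrArg (fun z => z.2.1) (hsymm p hp)
  have hγπ : ∀ p ∈ Ω₀, π (γ p) = p.2 := fun p hp =>
    congrArg (fun z => z.2.2) (hsymm p hp)
  have hγs : ContDiffOn ℝ ∞ γ Ω₀ := by
    intro p hp
    obtain ⟨N, hN⟩ := hp.2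
    have h1 : HasFDerivAt e (N : F × F →L[ℝ] F × ((Fin m → ℝ) × V)) (e.symm (ι p)) := by
      rw [hecoe, hN]; exact hMd _
    have h2 : ContDiffAt ℝ ∞ e (e.symm (ι p)) := by rw [hecoe]; exact hΨ.contDiffAt
    have h3 := e.contDiffAt_symm hp.1 h1 h2
    exact (contDiff_snd.contDiffAt.comp p (h3.comp p hιs.contDiffAt)).contDiffWithinAt
  have hback : ∀ q ∈ e.source, Φ q = t → ι (q.1, π q.2) = e q := by
    intro q _ hq
    rw [hecoe]
    simp only [hι, hΨdef, hq]
  set b : F × V := (p₀.1, π p₀.2) with hb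
  have hbΩ : b ∈ Ω₀ := by
    have h1 := hback p₀ hpe hp₀
    refine ⟨?_, ?_⟩
    · rw [h1]; exact e.map_source hpe
    · rw [mem_preimage, h1, e.left_inv hpe]; exact hpU
  have hγb : γ b = p₀.2 := by
    simp only [hγ, hb, hback p₀ hpe hp₀, e.left_inv hpe]
  have hγat : ContDiffAt ℝ ∞ γ b := hγs.contDiffAt (hΩ₀o.mem_nhds hbΩ)
  have hG : HasFDerivAt γ (fderiv ℝ γ b) b := (hγat.differentiableAt (by simp)).hasFDerivAt
  have hGπ : ∀ u w, π (fderiv ℝ γ b (u, w)) = w := by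
    intro u w
    have h1 : HasFDerivAt (fun p => π (γ p)) (π.comp (fderiv ℝ γ b)) b := π.hasFDerivAt.comp b hG
    have h2 : HasFDerivAt (fun p => π (γ p)) (ContinuousLinearMap.snd ℝ F V) b :=
      hasFDerivAt_snd.congr_of_eventuallyEq (by
        filter_upwards [hΩ₀o.mem_nhds hbΩ] with p hp using hγπ p hp)
    simpa using congrArg (fun L => L (u, w)) (h1.unique h2)
  have hGΦ : ∀ u w, fderiv ℝ Φ p₀ (u, fderiv ℝ γ b (u, w)) = 0 := by
    intro u w
    have h0 : HasFDerivAt Φ (fderiv ℝ Φ p₀) (b.1, γ b) := by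
      rw [hγb]; exact (hΦ.differentiable (by simp) p₀).hasFDerivAt
    have h1 : HasFDerivAt (fun p : F × V => Φ (p.1, γ p))
        ((fderiv ℝ Φ p₀).comp ((ContinuousLinearMap.fst ℝ F V).prod (fderiv ℝ γ b))) b :=
      h0.comp b (hasFDerivAt_fst.prodMk hG)
    have h2 : HasFDerivAt (fun p : F × V => Φ (p.1, γ p)) (0 : F × V →L[ℝ] Fin m → ℝ) b :=
      (hasFDerivAt_const t b).congr_of_eventuallyEq (by
        filter_upwards [hΩ₀o.mem_nhds hbΩ] with p hp using hγΦ p hp)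
    simpa using congrArg (fun L => L (u, w)) (h1.unique h2)
  -- To hit `v`, move `x` by a `u` whose effect on `Φ` cancels that of moving `y` by `-v`... that
  -- is, `D_x Φ u = - D_y Φ v`. Then `Dγ (u, π v)` and `v` agree under both `D_y Φ` and `π`, hence
  -- coincide.
  have hsurj : Function.Surjective (fderiv ℝ γ b) := by
    intro v
    obtain ⟨u, hu⟩ := hx (-(fderiv ℝ Φ p₀ (0, v)))
    refine ⟨(u, π v), ?_⟩
    rw [← sub_eq_zero]
    refine hker _ ?_ ?_
    · have h1 := hGΦ u (π v)
      have h2 : ((0 : F), fderiv ℝ γ b (u, π v) - v) =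
          (u, fderiv ℝ γ b (u, π v)) - (u, 0) - (0, v) := by ext <;> simp
      have h3 : fderiv ℝ Φ p₀ (u, 0) = -(fderiv ℝ Φ p₀ (0, v)) := hu
      rw [ContinuousLinearMap.comp_apply, ContinuousLinearMap.inr_apply, h2, map_sub, map_sub, h1,
        h3]
      simp
    · rw [map_sub, hGπ, sub_self]
  -- A right inverse of the derivative at the base point serves nearby as well, because `Dγ ∘ R`
  -- stays invertible on an open set.
  obtain ⟨R₀, hR₀⟩ := (fderiv ℝ γ b : F × V →ₗ[ℝ] F).exists_rightInverse_of_surjective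
    (LinearMap.range_eq_top.2 hsurj)
  set R : F →L[ℝ] F × V := LinearMap.toContinuousLinearMap R₀ with hR
  have hRb : (fderiv ℝ γ b).comp R = ContinuousLinearEquiv.refl ℝ F := by
    ext1 v
    exact LinearMap.congr_fun hR₀ v
  set D : F × V → (F →L[ℝ] F) := fun p => (fderiv ℝ γ p).comp R with hD
  have hDc : ContinuousOn D Ω₀ :=
    (hγs.continuousOn_fderiv_of_isOpen hΩ₀o (by simp)).clm_comp continuousOn_const
  set Ω₁ : Set (F × V) := Ω₀ ∩ D ⁻¹' range ((↑) : (F ≃L[ℝ] F) → F →L[ℝ] F) with hΩ₁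
  have hΩ₁o : IsOpen Ω₁ := hDc.isOpen_inter_preimage hΩ₀o ContinuousLinearEquiv.isOpen
  have hbΩ₁ : b ∈ Ω₁ := ⟨hbΩ, ⟨_, hRb.symm⟩⟩
  obtain ⟨L, S, hS, hL⟩ := (hγat.hasStrictFDerivAt (by simp)).exists_lipschitzOnWith
  set Ω : Set (F × V) := Ω₁ ∩ interior S with hΩ
  have hΩo : IsOpen Ω := hΩ₁o.inter isOpen_interior
  have hbΩ' : b ∈ Ω := ⟨hbΩ₁, mem_interior_iff_mem_nhds.2 hS⟩
  have hΩ₀' : Ω ⊆ Ω₀ := fun p hp => hp.1.1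
  have hproj : Continuous fun q : F × F => (q.1, π q.2) := by fun_prop
  exact ⟨{
    O := e.source ∩ (fun q : F × F => (q.1, π q.2)) ⁻¹' Ω
    Ω := Ω
    γ := γ
    π := π
    R := R
    L := L
    isOpen_O := e.open_source.inter (hΩo.preimage hproj)
    mem_O := ⟨hpe, hbΩ'⟩
    isOpen_Ω := hΩo
    norm_π_le := hπ
    contDiffOn_γ := hγs.mono hΩ₀'
    lipschitzOnWith_γ := hL.mono fun p hp => interior_subset hp.2
    π_γ := fun p hp => hγπ p (hΩ₀' hp)
    Φ_γ := fun p hp => hγΦ p (hΩ₀' hp)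
    mem_Ω := fun q hq _ => hq.2
    γ_π := fun q hq hqt => by simp only [hγ, hback q hq.1 hqt, e.left_inv hq.1]
    submersion := fun p hp => by
      obtain ⟨E, hE⟩ := hp.1.2
      exact ⟨E, hE.symm⟩ }⟩

end Chart

open scoped Manifold in
theorem exists_contDiff_cutoff {E : Type*} [NormedAddCommGroup E] [NormedSpace ℝ E]
    [FiniteDimensional ℝ E] {K U : Set E} (hK : IsCompact K) (hU : IsOpen U) (hKU : K ⊆ U) :
    ∃ θ : E → ℝ, ContDiff ℝ ∞ θ ∧ HasCompactSupport θ ∧ tsupport θ ⊆ U ∧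
      K ⊆ interior {x | θ x = 1} ∧ ∀ x, θ x ∈ Icc (0 : ℝ) 1 := by
  obtain ⟨L, hL, hKL, hLU⟩ := exists_compact_between hK hU hKU
  obtain ⟨f, h1, h0, h01⟩ := exists_contMDiffMap_one_nhds_of_subset_interior (n := (⊤ : ℕ∞))
    𝓘(ℝ, E) hK.isClosed hKL
  have hs : tsupport f ⊆ L := closure_minimal (fun x hx => by
    by_contra hxL; exact hx (h0 x hxL)) hL.isClosed
  refine ⟨f, f.contMDiff.contDiff, hL.of_isClosed_subset (isClosed_tsupport _) hs,
    hs.trans hLU, ?_, h01⟩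
  exact subset_interior_iff_mem_nhdsSet.2 h1

/-! ### The Radon transform as a finite sum of smooth surface integrals. -/

section Localization

variable {d m k : ℕ}

local notation "F" => EuclideanSpace ℝ (Fin d)
local notation "V" => EuclideanSpace ℝ (Fin k)

/-- A smooth compactly supported family of surface integrals `x ↦ ∫ f (γ (x, w)) a (x, w) dw`,
where `γ` is a submersion near the support of `a`. -/
structure SurfaceIntegralFamily (d k : ℕ) where
  γ : EuclideanSpace ℝ (Fin d) × EuclideanSpace ℝ (Fin k) → EuclideanSpace ℝ (Fin d)
  a : EuclideanSpace ℝ (Fin d) × EuclideanSpace ℝ (Fin k) → ℝ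
  Ω : Set (EuclideanSpace ℝ (Fin d) × EuclideanSpace ℝ (Fin k))
  R : EuclideanSpace ℝ (Fin d) →L[ℝ] EuclideanSpace ℝ (Fin d) × EuclideanSpace ℝ (Fin k)
  contDiff_γ : ContDiff ℝ ∞ γ
  contDiff_a : ContDiff ℝ ∞ a
  hasCompactSupport_a : HasCompactSupport a
  tsupport_a_subset : tsupport a ⊆ Ω
  submersion : ∀ p ∈ Ω, ∃ e : EuclideanSpace ℝ (Fin d) ≃L[ℝ] EuclideanSpace ℝ (Fin d),
    (fderiv ℝ γ p).comp R = e

/-- The surface integral of `f` at `x`. -/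
noncomputable def SurfaceIntegralFamily.transform (c : SurfaceIntegralFamily d k) (f : F → ℂ)
    (x : F) : ℂ :=
  ∫ w : V, f (c.γ (x, w)) * (c.a (x, w) : ℂ)

/-- The area formula in each slice `x = const` gives the density `χ · J`, with `J` the Jacobian of
`w ↦ γ(x, w)`. It is smooth because this map has the left inverse `π`, hence an injective
derivative. -/
theorem LevelSetChart.exists_surfaceIntegralFamily {Φ : F × F → Fin m → ℝ} (hΦ : ContDiff ℝ ∞ Φ)
    {t : Fin m → ℝ} {p₀ : F × F} (c : LevelSetChart k Φ t p₀) {χ : F × F → ℝ}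
    (hχ : ContDiff ℝ ∞ χ) (hχc : HasCompactSupport χ) (hχO : tsupport χ ⊆ c.O) :
    ∃ b : SurfaceIntegralFamily d k, ∀ f : F → ℂ, Continuous f → ∀ x,
      IntegrableOn (fun y => f y * (χ (x, y) : ℂ)) {y | Φ (x, y) = t} μHE[k] ∧
      ∫ y in {y | Φ (x, y) = t}, f y * (χ (x, y) : ℂ) ∂μHE[k] = b.transform f x := by
  classical
  set J : F × V → ℝ := fun p => LinearMap.normDet
    (((fderiv ℝ c.γ p).comp (ContinuousLinearMap.inr ℝ F V) : V →L[ℝ] F) : V →ₗ[ℝ] F) with hJ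
  have hγd : ∀ p ∈ c.Ω, ContDiffAt ℝ ∞ c.γ p := fun p hp =>
    c.contDiffOn_γ.contDiffAt (c.isOpen_Ω.mem_nhds hp)
  have hslice : ∀ p ∈ c.Ω, HasFDerivAt (fun w => c.γ (p.1, w))
      ((fderiv ℝ c.γ p).comp (ContinuousLinearMap.inr ℝ F V)) p.2 := by
    intro p hp
    have h1 : HasFDerivAt c.γ (fderiv ℝ c.γ p) (p.1, p.2) :=
      ((hγd p hp).differentiableAt (by simp)).hasFDerivAt
    exact h1.comp p.2 (hasFDerivAt_prodMk_right p.1 p.2)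
  have hinj : ∀ p ∈ c.Ω, Function.Injective
      ((fderiv ℝ c.γ p).comp (ContinuousLinearMap.inr ℝ F V)) := by
    intro p hp
    have h1 : HasFDerivAt (fun w => c.π (c.γ (p.1, w)))
        (c.π.comp ((fderiv ℝ c.γ p).comp (ContinuousLinearMap.inr ℝ F V))) p.2 :=
      c.π.hasFDerivAt.comp p.2 (hslice p hp)
    have h2 : HasFDerivAt (fun w => c.π (c.γ (p.1, w))) (ContinuousLinearMap.id ℝ V) p.2 := by
      refine (hasFDerivAt_id p.2).congr_of_eventuallyEq ?_
      have : ∀ᶠ w in 𝓝 p.2, (p.1, w) ∈ c.Ω :=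
        (Continuous.prodMk_right p.1).continuousAt.eventually (c.isOpen_Ω.mem_nhds hp)
      filter_upwards [this] with w hw using c.π_γ _ hw
    have h3 := h1.unique h2
    refine Function.LeftInverse.injective (g := c.π) fun v => ?_
    simpa using congrArg (fun L => L v) h3
  have hJd : ∀ p ∈ c.Ω, ContDiffAt ℝ ∞ J p := by
    intro p hp
    have h1 : ContDiffAt ℝ ∞ (fun p => (fderiv ℝ c.γ p).comp (ContinuousLinearMap.inr ℝ F V)) p :=
      ((hγd p hp).fderiv_right (m := ∞) (by simp)).clm_comp contDiffAt_const
    exact (contDiffAt_normDet (hinj p hp)).comp p h1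
  set K : Set (F × V) := (fun q : F × F => (q.1, c.π q.2)) '' (tsupport χ ∩ {q | Φ q = t}) with hK
  have hclosed : IsClosed {q | Φ q = t} := isClosed_eq hΦ.continuous continuous_const
  have hKc : IsCompact K := (hχc.isCompact.inter_right hclosed).image (by fun_prop)
  have hKΩ : K ⊆ c.Ω := by
    rintro _ ⟨q, hq, rfl⟩
    exact c.mem_Ω q (hχO hq.1) hq.2
  -- Extension by zero stays smooth, since the support lies in the compact subset `K` of `Ω`.
  set a : F × V → ℝ := fun p => if p ∈ c.Ω then χ (p.1, c.γ p) * J p else 0 with ha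
  have hsupp : ∀ p, a p ≠ 0 → p ∈ K := by
    intro p hp
    by_cases hpΩ : p ∈ c.Ω
    · simp only [ha, hpΩ, if_true] at hp
      refine ⟨(p.1, c.γ p), ⟨subset_closure (left_ne_zero_of_mul hp), c.Φ_γ p hpΩ⟩, ?_⟩
      simp [c.π_γ p hpΩ]
    · simp [ha, hpΩ] at hp
  have hats : tsupport a ⊆ K := closure_minimal hsupp hKc.isClosed
  have had : ContDiff ℝ ∞ a := by
    refine contDiff_of_contDiffAt_tsupport fun p hp => ?_
    have hpΩ := hKΩ (hats hp)
    have h1 : ContDiffAt ℝ ∞ (fun p => χ (p.1, c.γ p) * J p) p :=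
      (hχ.contDiffAt.comp p (contDiffAt_fst.prodMk (hγd p hpΩ))).mul (hJd p hpΩ)
    refine h1.congr_of_eventuallyEq ?_
    filter_upwards [c.isOpen_Ω.mem_nhds hpΩ] with q hq
    simp [ha, hq]
  obtain ⟨θ, hθd, hθc, hθΩ, hθ1, -⟩ := exists_contDiff_cutoff hKc c.isOpen_Ω hKΩ
  -- The cut-off makes `γ` globally smooth without changing it near the support of `a`.
  set γ' : F × V → F := fun p => θ p • c.γ p with hγ'
  have hγ'd : ContDiff ℝ ∞ γ' := by
    refine contDiff_of_contDiffAt_tsupport fun p hp => ?_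
    exact hθd.contDiffAt.smul (hγd p (hθΩ (tsupport_smul_subset_left θ c.γ hp)))
  have hγ'eq : ∀ p ∈ interior {x | θ x = 1}, γ' p = c.γ p := fun p hp => by
    have : θ p = 1 := interior_subset (s := {x | θ x = 1}) hp
    simp [hγ', this]
  set b : SurfaceIntegralFamily d k :=
    { γ := γ'
      a := a
      Ω := c.Ω ∩ interior {x | θ x = 1}
      R := c.R
      contDiff_γ := hγ'd
      contDiff_a := had
      hasCompactSupport_a := hKc.of_isClosed_subset (isClosed_tsupport _) hats
      tsupport_a_subset := fun p hp => ⟨hKΩ (hats hp), hθ1 (hats hp)⟩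
      submersion := by
        intro p hp
        have : fderiv ℝ γ' p = fderiv ℝ c.γ p := by
          refine Filter.EventuallyEq.fderiv_eq ?_
          filter_upwards [isOpen_interior.mem_nhds hp.2] with q hq using hγ'eq q hq
        rw [this]
        exact c.submersion p hp.1 } with hb
  refine ⟨b, fun f hf x => ?_⟩
  set W : Set V := {w | (x, w) ∈ c.Ω} with hW
  have hWo : IsOpen W := c.isOpen_Ω.preimage (Continuous.prodMk_right x)
  set g : V → F := fun w => c.γ (x, w) with hg
  set h : F → ℂ := fun y => f y * (χ (x, y) : ℂ) with hh
  have hhc : Continuous h := by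
    have := hχ.continuous
    fun_prop
  have hgd : ContDiffOn ℝ 1 g W := fun w hw => by
    have h1 : ContDiffAt ℝ ∞ c.γ (x, w) := hγd (x, w) hw
    have h2 : ContDiffAt ℝ ∞ g w := h1.comp w (contDiffAt_const.prodMk contDiffAt_id)
    exact (h2.of_le (by simp)).contDiffWithinAt
  have hgL : LipschitzOnWith c.L g W := by
    refine LipschitzOnWith.of_dist_le_mul fun w hw w' hw' => ?_
    have := c.lipschitzOnWith_γ.dist_le_mul (x, w) hw (x, w') hw'
    simpa [Prod.dist_eq] using this
  have hgπ : ∀ w ∈ W, c.π (g w) = w := fun w hw => c.π_γ (x, w) hw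
  obtain ⟨hi, heq⟩ := integral_image_eq_integral_normDet hWo hgd hgL c.norm_π_le hgπ hhc
  have hZ : MeasurableSet {y | Φ (x, y) = t} :=
    (hclosed.preimage (Continuous.prodMk_right x)).measurableSet
  have hsub : g '' W ⊆ {y | Φ (x, y) = t} := by
    rintro _ ⟨w, hw, rfl⟩
    exact c.Φ_γ (x, w) hw
  -- A point of the level set missed by the graph lies outside `c.O`, where `χ` vanishes.
  have hvanish : ∀ y ∈ {y | Φ (x, y) = t} \ g '' W, h y = 0 := by
    rintro y ⟨hy, hyW⟩
    by_contra hne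
    have hχy : χ (x, y) ≠ 0 := fun h0 => hne (by simp [hh, h0])
    have hO : (x, y) ∈ c.O := hχO (subset_closure hχy)
    exact hyW ⟨c.π y, c.mem_Ω _ hO hy, c.γ_π _ hO hy⟩
  have hcongr : ∀ w ∈ W, (LinearMap.normDet (fderiv ℝ g w : V →ₗ[ℝ] F) : ℂ) * h (g w) =
      f (b.γ (x, w)) * (b.a (x, w) : ℂ) := by
    intro w hw
    have h1 : fderiv ℝ g w = (fderiv ℝ c.γ (x, w)).comp (ContinuousLinearMap.inr ℝ F V) :=
      (hslice (x, w) hw).fderiv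
    have h2 : a (x, w) = χ (x, g w) * J (x, w) := by
      have hw' : (x, w) ∈ c.Ω := hw
      simp [ha, hw', hg]
    by_cases h0 : a (x, w) = 0
    · have : (χ (x, g w) : ℂ) * (J (x, w) : ℂ) = 0 := by exact_mod_cast h2 ▸ h0
      simp only [hb, h0, hh, h1]
      have h3 : (J (x, w) : ℂ) * (f (g w) * (χ (x, g w) : ℂ)) =
        f (g w) * ((χ (x, g w) : ℂ) * (J (x, w) : ℂ)) := by ring
      rw [this, mul_zero] at h3
      simpa [hJ] using h3
    · have h4 : γ' (x, w) = g w := hγ'eq _ (hθ1 (hsupp _ h0))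
      simp only [hb, h4, h2, hh, h1, hJ]
      push_cast
      ring
  have hcont : Continuous fun w => f (b.γ (x, w)) * (b.a (x, w) : ℂ) := by
    have h1 := b.contDiff_γ.continuous
    have h2 := b.contDiff_a.continuous
    fun_prop
  have hcs : HasCompactSupport fun w => f (b.γ (x, w)) * (b.a (x, w) : ℂ) := by
    refine HasCompactSupport.mul_left ?_
    have h1 : HasCompactSupport (fun w => b.a (x, w)) :=
      HasCompactSupport.of_support_subset_isCompact
        (b.hasCompactSupport_a.isCompact.image continuous_snd)
        fun w hw => ⟨(x, w), subset_closure hw, rfl⟩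
    exact h1.comp_left (g := fun r : ℝ => (r : ℂ)) (by simp)
  have hint := hcont.integrable_of_hasCompactSupport (μ := volume) hcs
  have hion : IntegrableOn h (g '' W) μHE[k] :=
    hi ((integrableOn_congr_fun hcongr hWo.measurableSet).2 hint.integrableOn)
  refine ⟨hion.of_forall_sdiff_eq_zero hZ hvanish, ?_⟩
  rw [setIntegral_eq_of_subset_of_forall_sdiff_eq_zero hZ hsub hvanish, heq,
    setIntegral_congr_fun hWo.measurableSet hcongr,
    setIntegral_eq_integral_of_forall_compl_eq_zero]
  · rfl
  · intro w hw
    have : a (x, w) = 0 := by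
      have hw' : (x, w) ∉ c.Ω := hw
      simp [ha, hw']
    simp [hb, this]

-- The part of the level set meeting the support of `ψ` is compact, so finitely many charts cover
-- it, and a subordinate partition of unity cuts `ψ` into pieces each living in one chart.
open scoped Manifold in
theorem exists_generalizedRadonTransform_eq_sum (hk : m + k = d)
    {φ : Fin m → F × F → ℝ} (hφ : ∀ l, ContDiff ℝ ∞ (φ l)) {ψ : F × F → ℝ}
    (hψ : ContDiff ℝ ∞ ψ) (hψc : HasCompactSupport ψ) {t : Fin m → ℝ}
    (hx : ∀ p ∈ tsupport ψ, (∀ l, φ l p = t l) → Function.Surjective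
      ((fderiv ℝ (fun q l => φ l q) p).comp (ContinuousLinearMap.inl ℝ F F)))
    (hy : ∀ p ∈ tsupport ψ, (∀ l, φ l p = t l) → Function.Surjective
      ((fderiv ℝ (fun q l => φ l q) p).comp (ContinuousLinearMap.inr ℝ F F))) :
    ∃ (ι : Type) (_ : Fintype ι) (b : ι → SurfaceIntegralFamily d k),
      ∀ f : F → ℂ, Continuous f → ∀ x,
        IntegrableOn (fun y => f y * (ψ (x, y) : ℂ)) {y | ∀ l, φ l (x, y) = t l} μHE[d - m] ∧
        generalizedRadonTransform φ ψ t f x = ∑ i, (b i).transform f x := by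
  obtain rfl : k = d - m := by omega
  set Φ : F × F → Fin m → ℝ := fun q l => φ l q with hΦdef
  have hΦ : ContDiff ℝ ∞ Φ := contDiff_pi.2 hφ
  have hΦt : ∀ p, Φ p = t ↔ ∀ l, φ l p = t l := fun p => funext_iff
  set S : Set (F × F) := tsupport ψ ∩ {q | Φ q = t} with hS
  have hSc : IsCompact S :=
    hψc.isCompact.inter_right (isClosed_eq hΦ.continuous continuous_const)
  have hchart : ∀ p : S, Nonempty (LevelSetChart (d - m) Φ t p) := fun p =>
    nonempty_levelSetChart hk hΦ p.2.2 (hx p p.2.1 ((hΦt _).1 p.2.2)) (hy p p.2.1 ((hΦt _).1 p.2.2))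
  let c : ∀ p : S, LevelSetChart (d - m) Φ t p := fun p => (hchart p).some
  obtain ⟨s, hs⟩ := hSc.elim_finite_subcover (fun p : S => (c p).O) (fun p => (c p).isOpen_O)
    (fun p hp => mem_iUnion.2 ⟨⟨p, hp⟩, (c ⟨p, hp⟩).mem_O⟩)
  obtain ⟨ρ, hρ⟩ := SmoothPartitionOfUnity.exists_isSubordinate 𝓘(ℝ, F × F) hSc.isClosed
    (fun i : s => (c i).O) (fun i => (c i).isOpen_O) (fun p hp => by
      obtain ⟨i, hi, hpi⟩ := mem_iUnion₂.1 (hs hp)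
      exact mem_iUnion.2 ⟨⟨i, hi⟩, hpi⟩)
  have hρd : ∀ i, ContDiff ℝ ∞ (ρ i) := fun i => (ρ i).contMDiff.contDiff
  have hpiece := fun i : s => (c i).exists_surfaceIntegralFamily hΦ
    (χ := fun q => ρ i q * ψ q) ((hρd i).mul hψ) hψc.mul_left
    ((tsupport_mul_subset_left).trans (hρ i))
  choose b hb using hpiece
  refine ⟨s, inferInstance, b, fun f hf x => ?_⟩
  have hset : {y | ∀ l, φ l (x, y) = t l} = {y | Φ (x, y) = t} := by
    ext y; exact (hΦt _).symm
  have hZ : MeasurableSet {y | Φ (x, y) = t} :=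
    ((isClosed_eq hΦ.continuous continuous_const).preimage
      (Continuous.prodMk_right x)).measurableSet
  have hsum : EqOn (fun y => f y * (ψ (x, y) : ℂ))
      (fun y => ∑ i : s, f y * ((ρ i (x, y) * ψ (x, y) : ℝ) : ℂ)) {y | Φ (x, y) = t} := by
    intro y hy
    by_cases h0 : ψ (x, y) = 0
    · simp [h0]
    · have hyS : (x, y) ∈ S := ⟨subset_closure h0, hy⟩
      have h1 : ∑ i : s, ρ i (x, y) = 1 := by
        rw [← finsum_eq_sum_of_fintype]; exact ρ.sum_eq_one hyS
      have h2 : ψ (x, y) = ∑ i : s, ρ i (x, y) * ψ (x, y) := by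
        rw [← Finset.sum_mul, h1, one_mul]
      simp only [← Finset.mul_sum]
      congr 1
      exact_mod_cast h2
  have hint := fun i => (hb i f hf x).1
  rw [hset]
  constructor
  · exact (integrableOn_congr_fun hsum hZ).2 (integrable_finsetSum _ fun i _ => hint i)
  · rw [generalizedRadonTransform, hset, setIntegral_congr_fun hZ hsum, integral_finsetSum]
    · exact Finset.sum_congr rfl fun i _ => (hb i f hf x).2
    · exact fun i _ => hint i

end Localization

/-! ### Fourier energy of Frostman densities. -/

section Energy

variable {d : ℕ}

local notation "F" => EuclideanSpace ℝ (Fin d)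

/-- `f` has mass at most `M`, and mass at most `M r ^ α` on balls of radius `r`. -/
structure IsFrostman (α M : ℝ) (f : F → ℂ) : Prop where
  integral_norm_le : ∫ y, ‖f y‖ ≤ M
  setIntegral_norm_le : ∀ x r, 0 < r → ∫ y in Metric.ball x r, ‖f y‖ ≤ M * r ^ α

/-- On the support of `b` the phase `2π ⟨x, ξ⟩` is at most `1 / 2` in absolute value, so `𝓕 g ξ` is
within `1 / 2` of the total mass `1`. -/
theorem one_half_le_norm_fourier_of_tsupport_subset {g : 𝓢(F, ℂ)} {b : F → ℝ}
    (hgb : ∀ x, g x = (b x : ℂ)) (hb0 : ∀ x, 0 ≤ b x) (hb1 : ∫ x, b x = 1) {r R : ℝ}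
    (hbs : Function.support b ⊆ Metric.ball 0 r) (hrR : 2 * Real.pi * r * R ≤ 1 / 2)
    {ξ : F} (hξ : ‖ξ‖ ≤ R) : 1 / 2 ≤ ‖𝓕 g ξ‖ := by
  have hbi : Integrable b := by
    by_contra h
    rw [integral_undef h] at hb1
    exact zero_ne_one hb1
  have hgi : Integrable (fun x => (b x : ℂ)) := hbi.ofReal
  have h1 : 𝓕 g ξ - 1 = ∫ x, (Complex.exp (((-2 * Real.pi * inner ℝ x ξ : ℝ) : ℂ) * Complex.I) - 1)
      * (b x : ℂ) := by
    rw [SchwartzMap.fourier_coe, Real.fourier_eq']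
    have h2 : (1 : ℂ) = ∫ x, (b x : ℂ) := by rw [integral_complex_ofReal, hb1]; simp
    conv_lhs => rw [h2]
    rw [← integral_sub]
    · refine integral_congr_ae (Eventually.of_forall fun x => ?_)
      simp only [hgb, smul_eq_mul]
      ring
    · refine hgi.norm.mono' ?_ (Eventually.of_forall fun x => ?_)
      · have h2 : Continuous fun v : F =>
            Complex.exp (((-2 * Real.pi * inner ℝ v ξ : ℝ) : ℂ) * Complex.I) • g v := by
          have h3 := g.continuous
          fun_prop
        exact h2.aestronglyMeasurable
      · rw [norm_smul, Complex.norm_exp_ofReal_mul_I, one_mul, hgb]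
    · exact hgi
  have h3 : ‖𝓕 g ξ - 1‖ ≤ 1 / 2 := by
    rw [h1]
    refine (norm_integral_le_integral_norm _).trans ?_
    calc ∫ x, ‖(Complex.exp (((-2 * Real.pi * inner ℝ x ξ : ℝ) : ℂ) * Complex.I) - 1) * (b x : ℂ)‖
        ≤ ∫ x, (1 / 2) * b x := by
          refine integral_mono_of_nonneg (Eventually.of_forall fun x => norm_nonneg _)
            (hbi.const_mul _) (Eventually.of_forall fun x => ?_)
          simp only
          rw [norm_mul, Complex.norm_real, Real.norm_of_nonneg (hb0 x)]
          by_cases hx : b x = 0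
          · simp [hx]
          refine mul_le_mul_of_nonneg_right ?_ (hb0 x)
          have hx' : ‖x‖ < r := by simpa using hbs hx
          rw [mul_comm]
          refine (Real.norm_exp_I_mul_ofReal_sub_one_le).trans ?_
          have h4 : |inner ℝ x ξ| ≤ r * R :=
            (abs_real_inner_le_norm x ξ).trans
              (mul_le_mul hx'.le hξ (norm_nonneg _) ((norm_nonneg _).trans hx'.le))
          rw [Real.norm_eq_abs, abs_mul, abs_mul, abs_of_pos Real.pi_pos]
          norm_num
          nlinarith [Real.pi_pos]
      _ = 1 / 2 := by rw [integral_const_mul, hb1, mul_one]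
  have h5 : (1 : ℝ) ≤ ‖𝓕 g ξ‖ + ‖𝓕 g ξ - 1‖ := by
    have := norm_sub_le (𝓕 g ξ) (𝓕 g ξ - 1)
    simpa using this
  linarith

/-- Convolve `f` with a bump of width about `1 / R`, whose transform is at least `1 / 2` up to
frequency `R`. By Plancherel the energy is at most `4 ‖h‖₂² ≤ 4 ‖h‖_∞ ‖h‖₁` for the convolution `h`;
the Frostman condition gives `‖h‖_∞ ≲ R ^ (d - α)` and `‖h‖₁ ≤ M`. -/
theorem exists_setIntegral_norm_sq_fourier_le (hd : 0 < d) {α M : ℝ} (hM : 0 ≤ M) :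
    ∃ C : ℝ, 0 ≤ C ∧ ∀ f : 𝓢(F, ℂ), IsFrostman α M f → ∀ R : ℝ, 1 ≤ R →
      ∫ ξ in Metric.closedBall 0 R, ‖𝓕 f ξ‖ ^ 2 ≤ C * R ^ ((d : ℝ) - α) := by
  have : Nonempty (Fin d) := ⟨⟨0, hd⟩⟩
  -- Chosen so that `2π · (ρ / R) · R = 1 / 2`.
  set ρ : ℝ := 1 / (4 * Real.pi) with hρ
  have hρ0 : 0 < ρ := by positivity
  set v : ℝ := volume.real (Metric.closedBall (0 : F) 1) with hv
  have hv0 : 0 < v := ENNReal.toReal_pos (Metric.measure_closedBall_pos _ _ one_pos).ne'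
    measure_closedBall_lt_top.ne
  set A : ℝ := 1 / ((ρ / 2) ^ d * v) with hA
  have hA0 : 0 < A := by positivity
  refine ⟨4 * (A * (M * ρ ^ α) * M), by positivity, fun f hf R hR => ?_⟩
  have hR0 : 0 < R := one_pos.trans_le hR
  let b : ContDiffBump (0 : F) := ⟨ρ / (2 * R), ρ / R, by positivity, by
    rw [div_lt_div_iff₀ (by positivity) hR0]; nlinarith⟩
  set bn : F → ℝ := b.normed volume with hbn
  have hbn0 : ∀ x, 0 ≤ bn x := fun x => b.nonneg_normed x
  have hbnc : Continuous bn := b.continuous_normed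
  have hbncs : HasCompactSupport bn := b.hasCompactSupport_normed
  have hbni : Integrable bn := b.integrable_normed
  have hbnle : ∀ x, bn x ≤ A * R ^ d := by
    intro x
    refine (b.normed_le_div_measure_closedBall_rIn volume x).trans_eq ?_
    have : volume.real (Metric.closedBall (0 : F) b.rIn) = (ρ / (2 * R)) ^ d * v := by
      have h1 := Measure.addHaar_real_closedBall' (volume : Measure F) 0
        (r := ρ / (2 * R)) (by positivity)
      rwa [finrank_euclideanSpace_fin] at h1
    rw [this, hA, show ρ / 2 = ρ / (2 * R) * R by field_simp, mul_pow]
    field_simp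
  set g : 𝓢(F, ℂ) := HasCompactSupport.toSchwartzMap (f := fun x => (bn x : ℂ))
    (hbncs.comp_left (g := fun r : ℝ => (r : ℂ)) (by simp))
    (Complex.ofRealCLM.contDiff.comp b.contDiff_normed) with hg
  have hgb : ∀ x, g x = (bn x : ℂ) := fun x => rfl
  set h : 𝓢(F, ℂ) := SchwartzMap.convolution (ContinuousLinearMap.mul ℂ ℂ) f g with hh
  have hhF : ∀ ξ, 𝓕 h ξ = 𝓕 f ξ * 𝓕 g ξ := by
    intro ξ
    rw [hh, SchwartzMap.fourier_convolution]
    rfl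
  have hlow : ∀ ξ ∈ Metric.closedBall (0 : F) R, ‖𝓕 f ξ‖ ^ 2 ≤ 4 * ‖𝓕 h ξ‖ ^ 2 := by
    intro ξ hξ
    have h1 : 1 / 2 ≤ ‖𝓕 g ξ‖ := by
      refine one_half_le_norm_fourier_of_tsupport_subset hgb hbn0 b.integral_normed
        (r := ρ / R) (R := R) b.support_normed_eq.subset ?_ (by simpa using hξ)
      rw [hρ]
      field_simp
      norm_num
    rw [hhF, norm_mul, mul_pow]
    have h2 : (1 / 2) ^ 2 ≤ ‖𝓕 g ξ‖ ^ 2 := pow_le_pow_left₀ (by norm_num) h1 2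
    nlinarith [sq_nonneg ‖𝓕 f ξ‖]
  have hsqi : ∀ u : 𝓢(F, ℂ), Integrable (fun ξ => ‖u ξ‖ ^ 2) := fun u =>
    (memLp_two_iff_integrable_sq_norm u.continuous.aestronglyMeasurable).1 (u.memLp 2 volume)
  -- the convolution is bounded and has controlled mass
  set n : F → ℝ := fun x => ∫ y, ‖f y‖ * bn (x - y) with hn
  have hni : ∀ x, Integrable fun y => ‖f y‖ * bn (x - y) := fun x => by
    refine (f.integrable.norm.mul_const (A * R ^ d)).mono' ?_ (Eventually.of_forall fun y => ?_)
    · exact (f.continuous.norm.mul (hbnc.comp (by fun_prop))).aestronglyMeasurable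
    · rw [Real.norm_of_nonneg (mul_nonneg (norm_nonneg _) (hbn0 _))]
      exact mul_le_mul_of_nonneg_left (hbnle _) (norm_nonneg _)
  have hhn : ∀ x, ‖h x‖ ≤ n x := by
    intro x
    rw [hh, SchwartzMap.convolution_apply, MeasureTheory.convolution_def]
    refine (norm_integral_le_integral_norm _).trans_eq ?_
    refine integral_congr_ae (Eventually.of_forall fun y => ?_)
    simp [hgb, Real.norm_of_nonneg (hbn0 _)]
  have hnle : ∀ x, n x ≤ A * (M * ρ ^ α) * R ^ ((d : ℝ) - α) := by
    intro x
    have h1 : n x = ∫ y in Metric.ball x (ρ / R), ‖f y‖ * bn (x - y) := by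
      rw [setIntegral_eq_integral_of_forall_compl_eq_zero]
      intro y hy
      have : x - y ∉ Function.support bn := by
        rw [hbn, b.support_normed_eq]
        simpa [← dist_eq_norm, dist_comm] using hy
      rw [Function.notMem_support.1 this, mul_zero]
    have h2 : ∫ y in Metric.ball x (ρ / R), ‖f y‖ * bn (x - y) ≤
        ∫ y in Metric.ball x (ρ / R), ‖f y‖ * (A * R ^ d) :=
      setIntegral_mono (hni x).integrableOn (f.integrable.norm.mul_const _).integrableOn
        fun y => mul_le_mul_of_nonneg_left (hbnle _) (norm_nonneg _)
    rw [h1]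
    refine h2.trans ?_
    rw [integral_mul_const]
    calc (∫ y in Metric.ball x (ρ / R), ‖f y‖) * (A * R ^ d)
        ≤ (M * (ρ / R) ^ α) * (A * R ^ d) := by
          gcongr
          exact hf.setIntegral_norm_le x _ (by positivity)
      _ = _ := by
          rw [Real.div_rpow hρ0.le hR0.le, Real.rpow_sub hR0, Real.rpow_natCast]
          ring
  have hnint : Integrable n ∧ ∫ x, n x ≤ M := by
    have h0 : Integrable (fun y => ‖f y‖) volume := f.integrable.norm
    have h1 := h0.integrable_convolution (ContinuousLinearMap.mul ℝ ℝ) hbni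
    have h2 := integral_convolution (ContinuousLinearMap.mul ℝ ℝ) h0 hbni
    have h3 : (convolution (fun y => ‖f y‖) bn (ContinuousLinearMap.mul ℝ ℝ) volume) = n := by
      funext x
      rfl
    rw [h3] at h1 h2
    refine ⟨h1, ?_⟩
    rw [h2]
    simp only [ContinuousLinearMap.mul_apply', hbn, b.integral_normed, mul_one]
    exact hf.integral_norm_le
  calc ∫ ξ in Metric.closedBall 0 R, ‖𝓕 f ξ‖ ^ 2
      ≤ ∫ ξ in Metric.closedBall 0 R, 4 * ‖𝓕 h ξ‖ ^ 2 :=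
        setIntegral_mono_on (hsqi _).integrableOn ((hsqi _).const_mul 4).integrableOn
          Metric.isClosed_closedBall.measurableSet hlow
    _ ≤ ∫ ξ, 4 * ‖𝓕 h ξ‖ ^ 2 :=
        setIntegral_le_integral ((hsqi _).const_mul 4)
          (Eventually.of_forall fun ξ => by positivity)
    _ = 4 * ∫ x, ‖h x‖ ^ 2 := by rw [integral_const_mul, SchwartzMap.integral_norm_sq_fourier]
    _ ≤ 4 * ∫ x, (A * (M * ρ ^ α) * R ^ ((d : ℝ) - α)) * n x := by
        refine mul_le_mul_of_nonneg_left ?_ (by norm_num)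
        refine integral_mono (hsqi h) (hnint.1.const_mul _) fun x => ?_
        have h1 := hhn x
        have h2 := hnle x
        have h3 := norm_nonneg (h x)
        simp only [sq]
        exact mul_le_mul (h1.trans h2) h1 h3 (h3.trans (h1.trans h2))
    _ ≤ 4 * ((A * (M * ρ ^ α) * R ^ ((d : ℝ) - α)) * M) := by
        rw [integral_const_mul]
        gcongr
        exact hnint.2
    _ = 4 * (A * (M * ρ ^ α) * M) * R ^ ((d : ℝ) - α) := by ring

end Energy

/-! ### Pairing `L²_s` with `L²_{-s}`. -/

section Duality

variable {d k : ℕ}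

local notation "F" => EuclideanSpace ℝ (Fin d)
local notation "V" => EuclideanSpace ℝ (Fin k)

theorem norm_integral_mul_le_sqrt_mul_sqrt {X : Type*} [MeasurableSpace X] {μ : Measure X}
    {f g : X → ℂ} (hf : MemLp f 2 μ) (hg : MemLp g 2 μ) :
    ‖∫ x, f x * g x ∂μ‖ ≤ √(∫ x, ‖f x‖ ^ 2 ∂μ) * √(∫ x, ‖g x‖ ^ 2 ∂μ) := by
  refine (norm_integral_le_integral_norm _).trans ?_
  simp only [norm_mul]
  have h := integral_mul_norm_le_Lp_mul_Lq (μ := μ) (f := f) (g := g) Real.HolderConjugate.two_two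
    (by simpa using hf) (by simpa using hg)
  simpa [Real.sqrt_eq_rpow] using h

theorem norm_sq_eq_integral_norm_sq {X : Type*} [MeasurableSpace X] {μ : Measure X}
    (h : Lp ℂ 2 μ) : ‖h‖ ^ 2 = ∫ x, ‖h x‖ ^ 2 ∂μ := by
  have h1 := L2.inner_def (𝕜 := ℂ) h h
  have h2 : inner ℂ h h = ((‖h‖ : ℂ)) ^ 2 := inner_self_eq_norm_sq_to_K (𝕜 := ℂ) h
  have h3 : ∀ x, inner ℂ (h x) (h x) = ((‖h x‖ ^ 2 : ℝ) : ℂ) := fun x => by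
    rw [Complex.ofReal_pow]; exact inner_self_eq_norm_sq_to_K (𝕜 := ℂ) (h x)
  rw [h2] at h1
  simp only [h3] at h1
  rw [integral_complex_ofReal] at h1
  exact_mod_cast h1

/-- Testing the Bessel potential identity on `𝓕 w`, with `w = (1 + |ξ|²) ^ (-s/2) 𝓕⁻ G`, moves the
weight onto `G`; Cauchy–Schwarz and Plancherel finish. The inverse transform of `G` appears because
the pairing is bilinear, without conjugation. -/
theorem SobolevNormLE.norm_integral_mul_le {s R : ℝ} {g : F → ℂ} (h : SobolevNormLE s g R)
    (G : 𝓢(F, ℂ)) :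
    ‖∫ x, g x * G x‖ ≤ R * √(∫ ξ, (1 + ‖ξ‖ ^ 2) ^ (-s) * ‖𝓕⁻ G ξ‖ ^ 2) := by
  obtain ⟨hg, u, hu, hR⟩ := h
  have htg : ∀ r : ℝ, Function.HasTemperateGrowth
      (fun x : F => (((1 + ‖x‖ ^ 2) ^ (r / 2) : ℝ) : ℂ)) := fun r => by fun_prop
  set w : 𝓢(F, ℂ) := SchwartzMap.smulLeftCLM ℂ
    (fun x : F => (((1 + ‖x‖ ^ 2) ^ (-s / 2) : ℝ) : ℂ)) (𝓕⁻ G) with hw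
  have hwx : ∀ ξ, w ξ = (((1 + ‖ξ‖ ^ 2) ^ (-s / 2) : ℝ) : ℂ) * 𝓕⁻ G ξ := fun ξ => by
    rw [hw, SchwartzMap.smulLeftCLM_apply_apply (htg (-s))]; rfl
  have h1 := congrArg (fun D => D (𝓕 w)) hu
  simp only [TemperedDistribution.besselPotential,
    TemperedDistribution.fourierMultiplierCLM_apply_apply, fourierInv_fourier_eq,
    Lp.toTemperedDistribution_apply] at h1
  have h2 : SchwartzMap.smulLeftCLM ℂ (fun x : F => (((1 + ‖x‖ ^ 2) ^ (s / 2) : ℝ) : ℂ)) w = 𝓕⁻ G := by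
    ext ξ
    rw [SchwartzMap.smulLeftCLM_apply_apply (htg s), hwx, smul_eq_mul, ← mul_assoc,
      ← Complex.ofReal_mul, ← Real.rpow_add (by positivity)]
    have : s / 2 + -s / 2 = 0 := by ring
    simp [this]
  rw [h2, fourier_fourierInv_eq] at h1
  have h3 : ∫ x, g x * G x = ∫ x, (𝓕 w) x * u x := by
    simp only [smul_eq_mul] at h1
    rw [← h1]
    refine integral_congr_ae ?_
    filter_upwards [hg.coeFn_toLp] with x hx
    rw [hx, mul_comm]
  rw [h3]
  refine (norm_integral_mul_le_sqrt_mul_sqrt ((𝓕 w).memLp 2 volume) (Lp.memLp u)).trans ?_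
  rw [← norm_sq_eq_integral_norm_sq, Real.sqrt_sq (norm_nonneg u), mul_comm,
    SchwartzMap.integral_norm_sq_fourier]
  have h4 : ∫ x, ‖w x‖ ^ 2 = ∫ ξ, (1 + ‖ξ‖ ^ 2) ^ (-s) * ‖𝓕⁻ G ξ‖ ^ 2 := by
    refine integral_congr_ae (Eventually.of_forall fun ξ => ?_)
    simp only [hwx, norm_mul, mul_pow, Complex.norm_real]
    rw [Real.norm_of_nonneg (by positivity), ← Real.rpow_natCast, ← Real.rpow_mul (by positivity)]
    congr 2
    push_cast
    ring
  rw [h4]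
  gcongr

/-- The sum of finitely many surface integral families. -/
noncomputable def sumTransform {ι : Type*} [Fintype ι] (b : ι → SurfaceIntegralFamily d k)
    (f : F → ℂ) (x : F) : ℂ :=
  ∑ i, (b i).transform f x

variable {ι : Type*} [Fintype ι] (b : ι → SurfaceIntegralFamily d k)

theorem sumTransform_congr {f g : F → ℂ}
    (h : ∀ i, ∀ p ∈ tsupport (b i).a, f ((b i).γ p) = g ((b i).γ p)) :
    sumTransform b f = sumTransform b g := by
  funext x
  refine Finset.sum_congr rfl fun i _ => ?_
  refine integral_congr_ae (Eventually.of_forall fun w => ?_)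
  by_cases hp : (x, w) ∈ tsupport (b i).a
  · simp only [h i _ hp]
  · simp [image_eq_zero_of_notMem_tsupport hp]

/-- The Sobolev hypothesis concerns compactly supported functions. The transform sees `f` only on
the compact images of the amplitude supports, so a Schwartz `f` may be multiplied by a cut-off
first. -/
theorem norm_integral_sumTransform_mul_le {s C : ℝ} (hC : 0 ≤ C)
    (hS : IsL2SobolevBounded s C (sumTransform b)) (f G : 𝓢(F, ℂ)) :
    ‖∫ x, sumTransform b f x * G x‖ ≤
      C * √(∫ x, ‖f x‖ ^ 2) * √(∫ ξ, (1 + ‖ξ‖ ^ 2) ^ (-s) * ‖𝓕⁻ G ξ‖ ^ 2) := by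
  have hK : IsCompact (⋃ i, (b i).γ '' tsupport (b i).a) :=
    isCompact_iUnion fun i => (b i).hasCompactSupport_a.isCompact.image (b i).contDiff_γ.continuous
  obtain ⟨θ, hθd, hθc, -, hθ1, hθ01⟩ := exists_contDiff_cutoff hK isOpen_univ (subset_univ _)
  set g : F → ℂ := fun x => (θ x : ℂ) * f x with hg
  have hgd : ContDiff ℝ ∞ g := (Complex.ofRealCLM.contDiff.comp hθd).mul f.smooth'
  have hgc : HasCompactSupport g :=
    (hθc.comp_left (g := fun r : ℝ => (r : ℂ)) (by simp)).mul_right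
  have hfg : sumTransform b f = sumTransform b g := by
    refine sumTransform_congr b fun i p hp => ?_
    have : θ ((b i).γ p) = 1 :=
      interior_subset (s := {x | θ x = 1}) (hθ1 (mem_iUnion.2 ⟨i, p, hp, rfl⟩))
    simp [hg, this]
  rw [hfg]
  refine ((hS g hgd hgc).norm_integral_mul_le G).trans ?_
  refine mul_le_mul_of_nonneg_right (mul_le_mul_of_nonneg_left ?_ hC) (Real.sqrt_nonneg _)
  have hg2 : MemLp g 2 := hgd.continuous.memLp_of_hasCompactSupport hgc
  have hf2 : MemLp f 2 volume := f.memLp 2 volume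
  have h1 : (eLpNorm g 2 volume).toReal ≤ (eLpNorm f 2 volume).toReal := by
    refine ENNReal.toReal_mono hf2.2.ne (eLpNorm_mono fun x => ?_)
    rw [hg, norm_mul, Complex.norm_real, Real.norm_of_nonneg (hθ01 x).1]
    exact mul_le_of_le_one_left (norm_nonneg _) (hθ01 x).2
  refine h1.trans_eq ?_
  rw [eq_comm, Real.sqrt_eq_iff_mul_self_eq (integral_nonneg fun x => by positivity)
    ENNReal.toReal_nonneg, ← sq]
  have h2 := norm_sq_eq_integral_norm_sq (hf2.toLp f)
  rw [Lp.norm_toLp] at h2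
  rw [h2]
  refine integral_congr_ae ?_
  filter_upwards [hf2.coeFn_toLp] with x hx
  rw [hx]

end Duality

/-! ### Pairings with widely separated frequencies. -/

section HighFrequency

variable {d k : ℕ}

local notation "F" => EuclideanSpace ℝ (Fin d)
local notation "V" => EuclideanSpace ℝ (Fin k)

theorem SurfaceIntegralFamily.integral_transform_mul (c : SurfaceIntegralFamily d k) {f G : F → ℂ}
    (hf : Continuous f) (hG : Continuous G) :
    Integrable (fun x => c.transform f x * G x) ∧
    ∫ x, c.transform f x * G x = ∫ p : F × V, f (c.γ p) * G p.1 * (c.a p : ℂ) := by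
  have hγ := c.contDiff_γ.continuous
  have ha := c.contDiff_a.continuous
  have hi : Integrable (fun p : F × V => f (c.γ p) * G p.1 * (c.a p : ℂ))
      ((volume : Measure F).prod (volume : Measure V)) := by
    refine Continuous.integrable_of_hasCompactSupport (by fun_prop) (HasCompactSupport.mul_left ?_)
    exact c.hasCompactSupport_a.comp_left (g := fun r : ℝ => (r : ℂ)) (by simp)
  have heq : ∀ x, c.transform f x * G x = ∫ w : V, f (c.γ (x, w)) * G x * (c.a (x, w) : ℂ) := by
    intro x
    rw [SurfaceIntegralFamily.transform, ← integral_mul_const]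
    refine integral_congr_ae (Eventually.of_forall fun w => ?_)
    ring
  constructor
  · simp only [heq]
    exact hi.integral_prod_left
  · simp only [heq]
    exact (integral_prod _ hi).symm

theorem integral_sumTransform_mul {ι : Type*} [Fintype ι] (b : ι → SurfaceIntegralFamily d k)
    {f G : F → ℂ} (hf : Continuous f) (hG : Continuous G) :
    Integrable (fun x => sumTransform b f x * G x) ∧
    ∫ x, sumTransform b f x * G x =
      ∑ i, ∫ p : F × V, f ((b i).γ p) * G p.1 * ((b i).a p : ℂ) := by
  have h := fun i => (b i).integral_transform_mul hf hG
  simp only [sumTransform, Finset.sum_mul]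
  constructor
  · exact integrable_finsetSum _ fun i _ => (h i).1
  · rw [integral_finsetSum _ fun i _ => (h i).1]
    exact Finset.sum_congr rfl fun i _ => (h i).2

/-- By Fubini, the pairing becomes an average over frequency pairs of the oscillatory integrals
bounded by nonstationary phase. -/
theorem integral_superposition_eq {P : Type*} [NormedAddCommGroup P] [NormedSpace ℝ P]
    [FiniteDimensional ℝ P] [MeasurableSpace P] [BorelSpace P] {μ : Measure P} [SigmaFinite μ]
    {γ q : P → F} (hγ : Continuous γ) (hq : Continuous q) {a : P → ℂ} (ha : Integrable a μ)
    {f₁ g₁ : F → ℂ} (hf : Integrable f₁) (hg : Integrable g₁) :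
    ∫ p, (∫ ξ, Complex.exp (((2 * Real.pi * inner ℝ ξ (γ p) : ℝ) : ℂ) * Complex.I) • f₁ ξ) *
        (∫ η, Complex.exp (((-2 * Real.pi * inner ℝ η (q p) : ℝ) : ℂ) * Complex.I) • g₁ η) * a p ∂μ =
      ∫ z : F × F, f₁ z.1 * g₁ z.2 *
        ∫ p, oscFactor γ q ((2 * Real.pi) • z.1) ((-2 * Real.pi) • z.2) p * a p ∂μ := by
  have hosc : Continuous fun u : P × (F × F) =>
      oscFactor γ q ((2 * Real.pi) • u.2.1) ((-2 * Real.pi) • u.2.2) u.1 := by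
    unfold oscFactor
    fun_prop
  have hint : Integrable (fun u : P × (F × F) => oscFactor γ q ((2 * Real.pi) • u.2.1)
      ((-2 * Real.pi) • u.2.2) u.1 * (a u.1 * (f₁ u.2.1 * g₁ u.2.2)))
      (μ.prod ((volume : Measure F).prod (volume : Measure F))) := by
    refine (ha.mul_prod (hf.mul_prod hg)).bdd_mul (c := 1) hosc.aestronglyMeasurable ?_
    exact Eventually.of_forall fun u => (norm_oscFactor _ _ _ _ _).le
  have h1 : ∀ p, (∫ ξ, Complex.exp (((2 * Real.pi * inner ℝ ξ (γ p) : ℝ) : ℂ) * Complex.I) • f₁ ξ) *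
        (∫ η, Complex.exp (((-2 * Real.pi * inner ℝ η (q p) : ℝ) : ℂ) * Complex.I) • g₁ η) * a p =
      ∫ z : F × F, oscFactor γ q ((2 * Real.pi) • z.1) ((-2 * Real.pi) • z.2) p *
        (a p * (f₁ z.1 * g₁ z.2)) := by
    intro p
    rw [← integral_prod_mul, ← integral_mul_const]
    refine integral_congr_ae (Eventually.of_forall fun z => ?_)
    simp only [oscFactor, inner_smul_left, smul_eq_mul]
    simp only [Complex.ofReal_add, add_mul, Complex.exp_add]
    simp
    ring
  simp only [h1]
  rw [integral_integral_swap hint]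
  refine integral_congr_ae (Eventually.of_forall fun z => ?_)
  simp only
  rw [← integral_const_mul]
  refine integral_congr_ae (Eventually.of_forall fun p => ?_)
  ring

theorem SurfaceIntegralFamily.exists_norm_integral_le (c : SurfaceIntegralFamily d k) (n : ℕ) :
    ∃ C : ℝ, 0 ≤ C ∧ ∀ (f G : 𝓢(F, ℂ)) (r A M : ℝ), 1 ≤ r → 1 ≤ A → 0 ≤ M →
      (∀ ξ, ‖𝓕 f ξ‖ ≤ M) → (∀ ξ, ‖ξ‖ < r → 𝓕 f ξ = 0) →
      (∀ η, ‖𝓕⁻ G η‖ ≤ M) → (∀ η, 2 * A < ‖η‖ → 𝓕⁻ G η = 0) →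
      ‖∫ p : F × V, f (c.γ p) * G p.1 * (c.a p : ℂ)‖ ≤
        C * M ^ 2 * (A ^ (d + (n + (d + 1))) / r ^ n) := by
  -- Of the `N` powers of decay, `n` produce `r ^ (-n)` and `d + 1` make the integral over `ξ`
  -- converge.
  set N := n + (d + 1) with hN
  have hhaar : (volume : Measure (F × V)).IsAddHaarMeasure :=
    inferInstanceAs ((volume : Measure F).prod (volume : Measure V)).IsAddHaarMeasure
  obtain ⟨C, hC0, hC⟩ := exists_norm_pow_mul_integral_oscillation_le (volume : Measure (F × V))
    c.contDiff_γ contDiff_fst c.R c.submersion N (fun p => (c.a p : ℂ))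
    (Complex.ofRealCLM.contDiff.comp c.contDiff_a)
    (c.hasCompactSupport_a.comp_left (g := fun r : ℝ => (r : ℂ)) (by simp))
    ((closure_mono fun p hp => by simpa using hp).trans c.tsupport_a_subset)
  set I₁ : ℝ := ∫ ξ : F, (1 + ‖ξ‖) ^ (-((d + 1 : ℕ) : ℝ)) with hI₁
  set v : ℝ := volume.real (Metric.closedBall (0 : F) 1) with hv
  have hint₁ : Integrable fun ξ : F => (1 + ‖ξ‖) ^ (-((d + 1 : ℕ) : ℝ)) :=
    integrable_one_add_norm (by rw [finrank_euclideanSpace_fin]; push_cast; linarith)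
  have hI₁0 : 0 ≤ I₁ := integral_nonneg fun ξ => by positivity
  have hv0 : 0 ≤ v := measureReal_nonneg
  refine ⟨C * (2 ^ (d + 1) * I₁) * (2 ^ d * v * (1 + 4 * Real.pi) ^ N), by positivity,
    fun f G r A M hr hA hM hf hfr hG hGA => ?_⟩
  have hr0 : 0 < r := one_pos.trans_le hr
  have hA0 : 0 < A := one_pos.trans_le hA
  have hac : Integrable (fun p : F × V => (c.a p : ℂ)) :=
    (Complex.continuous_ofReal.comp c.contDiff_a.continuous).integrable_of_hasCompactSupport
      (c.hasCompactSupport_a.comp_left (g := fun r : ℝ => (r : ℂ)) (by simp))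
  have hrew : ∫ p : F × V, f (c.γ p) * G p.1 * (c.a p : ℂ) = ∫ z : F × F, 𝓕 f z.1 * 𝓕⁻ G z.2 *
      ∫ p, oscFactor c.γ Prod.fst ((2 * Real.pi) • z.1) ((-2 * Real.pi) • z.2) p * (c.a p : ℂ) := by
    rw [← integral_superposition_eq c.contDiff_γ.continuous continuous_fst hac (𝓕 f).integrable
      (𝓕⁻ G).integrable]
    refine integral_congr_ae (Eventually.of_forall fun p => ?_)
    simp only
    rw [← Real.fourierInv_eq', ← Real.fourier_eq', ← SchwartzMap.fourierInv_coe,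
      ← SchwartzMap.fourier_coe, fourierInv_fourier_eq, fourier_fourierInv_eq]
  rw [hrew]
  -- `u₁` and `u₂` are integrable majorants in `ξ` and `η`. On the support of `𝓕⁻ G` one has `1 + 2π
  -- ‖η‖ ≤ (1 + 4π) A`, the source of the second constant.
  set u₁ : F → ℝ := fun ξ => M * (2 ^ (d + 1) / r ^ n * (1 + ‖ξ‖) ^ (-((d + 1 : ℕ) : ℝ))) with hu₁
  set u₂ : F → ℝ := (Metric.closedBall (0 : F) (2 * A)).indicator
    fun _ => M * ((1 + 4 * Real.pi) ^ N * A ^ N) with hu₂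
  have hu₁i : Integrable u₁ := (hint₁.const_mul _).const_mul _
  have hu₂i : Integrable u₂ := (integrable_indicator_iff Metric.isClosed_closedBall.measurableSet).2
    (integrableOn_const measure_closedBall_lt_top.ne)
  have hu₁0 : ∀ ξ, 0 ≤ u₁ ξ := fun ξ => by positivity
  have hu₂0 : ∀ ξ, 0 ≤ u₂ ξ := fun ξ => indicator_nonneg (fun _ _ => by positivity) _
  have hbd : ∀ z : F × F, ‖𝓕 f z.1 * 𝓕⁻ G z.2 *
      ∫ p, oscFactor c.γ Prod.fst ((2 * Real.pi) • z.1) ((-2 * Real.pi) • z.2) p * (c.a p : ℂ)‖ ≤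
      C * (u₁ z.1 * u₂ z.2) := by
    rintro ⟨ξ, η⟩
    have hrhs : 0 ≤ C * (u₁ ξ * u₂ η) := mul_nonneg hC0 (mul_nonneg (hu₁0 _) (hu₂0 _))
    by_cases hξ : ‖ξ‖ < r
    · simpa [hfr ξ hξ] using hrhs
    by_cases hη : 2 * A < ‖η‖
    · simpa [hGA η hη] using hrhs
    push Not at hξ hη
    set K := ‖∫ p, oscFactor c.γ Prod.fst ((2 * Real.pi) • ξ) ((-2 * Real.pi) • η) p * (c.a p : ℂ)‖
      with hK
    have hξ0 : 0 < ‖ξ‖ := hr0.trans_le hξ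
    have h1 := hC ((2 * Real.pi) • ξ) ((-2 * Real.pi) • η)
    rw [← hK] at h1
    have h2pi : (1 : ℝ) ≤ 2 * Real.pi := by linarith [Real.pi_gt_three]
    have hn1 : ‖(2 * Real.pi) • ξ‖ = 2 * Real.pi * ‖ξ‖ := by
      rw [norm_smul, Real.norm_of_nonneg (by positivity)]
    have hn2 : ‖(-2 * Real.pi) • η‖ = 2 * Real.pi * ‖η‖ := by
      rw [norm_smul, Real.norm_eq_abs, abs_mul, abs_of_pos Real.pi_pos]; norm_num
    rw [hn1, hn2] at h1
    have h2 : ‖ξ‖ ^ N * K ≤ C * ((1 + 4 * Real.pi) ^ N * A ^ N) := by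
      calc ‖ξ‖ ^ N * K ≤ (2 * Real.pi * ‖ξ‖) ^ N * K := by
            gcongr
            exact le_mul_of_one_le_left hξ0.le h2pi
        _ ≤ C * (1 + 2 * Real.pi * ‖η‖) ^ N := h1
        _ ≤ C * ((1 + 4 * Real.pi) * A) ^ N := by
            gcongr
            nlinarith [Real.pi_pos]
        _ = _ := by rw [mul_pow]
    have h3 : K ≤ C * ((1 + 4 * Real.pi) ^ N * A ^ N) *
        (2 ^ (d + 1) / r ^ n * (1 + ‖ξ‖) ^ (-((d + 1 : ℕ) : ℝ))) := by
      have h4 : 1 / ‖ξ‖ ^ N ≤ 2 ^ (d + 1) / r ^ n * (1 + ‖ξ‖) ^ (-((d + 1 : ℕ) : ℝ)) := by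
        rw [Real.rpow_neg (by positivity), Real.rpow_natCast, ← div_eq_mul_inv, div_div,
          div_le_div_iff₀ (by positivity) (by positivity), one_mul, hN, pow_add ‖ξ‖ n]
        have h5 : r ^ n ≤ ‖ξ‖ ^ n := pow_le_pow_left₀ hr0.le hξ n
        have h6 : (1 + ‖ξ‖) ^ (d + 1) ≤ 2 ^ (d + 1) * ‖ξ‖ ^ (d + 1) := by
          rw [← mul_pow]
          exact pow_le_pow_left₀ (by positivity) (by linarith) _
        calc r ^ n * (1 + ‖ξ‖) ^ (d + 1) ≤ ‖ξ‖ ^ n * (2 ^ (d + 1) * ‖ξ‖ ^ (d + 1)) := by gcongr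
          _ = 2 ^ (d + 1) * (‖ξ‖ ^ n * ‖ξ‖ ^ (d + 1)) := by ring
      calc K = (‖ξ‖ ^ N * K) * (1 / ‖ξ‖ ^ N) := by field_simp
        _ ≤ _ := by gcongr
    have hηb : u₂ η = M * ((1 + 4 * Real.pi) ^ N * A ^ N) := by
      rw [hu₂, indicator_of_mem]
      simpa using hη
    rw [norm_mul, norm_mul, hηb]
    calc ‖𝓕 f ξ‖ * ‖𝓕⁻ G η‖ * K ≤ M * M * (C * ((1 + 4 * Real.pi) ^ N * A ^ N) *
        (2 ^ (d + 1) / r ^ n * (1 + ‖ξ‖) ^ (-((d + 1 : ℕ) : ℝ)))) := by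
          gcongr
          · exact hf ξ
          · exact hG η
      _ = _ := by simp only [hu₁]; ring
  have hprodi : Integrable (fun z : F × F => C * (u₁ z.1 * u₂ z.2)) :=
    (hu₁i.mul_prod hu₂i).const_mul C
  refine (norm_integral_le_of_norm_le hprodi (Eventually.of_forall hbd)).trans_eq ?_
  have hvol : volume.real (Metric.closedBall (0 : F) (2 * A)) = (2 * A) ^ d * v := by
    have h1 := Measure.addHaar_real_closedBall' (volume : Measure F) 0 (r := 2 * A) (by positivity)
    rwa [finrank_euclideanSpace_fin] at h1
  have e1 : ∫ z : F × F, C * (u₁ z.1 * u₂ z.2) = C * ((∫ ξ, u₁ ξ) * ∫ η, u₂ η) := by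
    rw [integral_const_mul]
    congr 1
    exact integral_prod_mul u₁ u₂
  have e2 : ∫ ξ, u₁ ξ = M * (2 ^ (d + 1) / r ^ n * I₁) := by
    simp only [hu₁, integral_const_mul, hI₁]
  have e3 : ∫ η, u₂ η = (2 * A) ^ d * v * (M * ((1 + 4 * Real.pi) ^ N * A ^ N)) := by
    rw [hu₂, integral_indicator Metric.isClosed_closedBall.measurableSet, setIntegral_const, hvol,
      smul_eq_mul]
  rw [e1, e2, e3, pow_add A d N, mul_pow]
  ring

end HighFrequency

/-! ### Dyadic summation and the uniform bound on the bilinear form. -/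

section Dyadic

variable {d k : ℕ}

local notation "F" => EuclideanSpace ℝ (Fin d)
local notation "V" => EuclideanSpace ℝ (Fin k)

theorem exists_schwartzMap_eq_mul {χ : F → ℝ} (hχ : ContDiff ℝ ∞ χ) (hχc : HasCompactSupport χ)
    (f : 𝓢(F, ℂ)) : ∃ g : 𝓢(F, ℂ), ∀ ξ, g ξ = (χ ξ : ℂ) * f ξ := by
  have h : Function.HasTemperateGrowth (fun ξ => (χ ξ : ℂ)) := by
    refine HasCompactSupport.hasTemperateGrowth (hχc.comp_left (g := fun r : ℝ => (r : ℂ)) (by simp))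
      (Complex.ofRealCLM.contDiff.comp hχ)
  exact ⟨SchwartzMap.smulLeftCLM ℂ (fun ξ => (χ ξ : ℂ)) f,
    fun ξ => by rw [SchwartzMap.smulLeftCLM_apply_apply h]; rfl⟩

/-- There is a smooth low-pass filter of frequency `r`. -/
theorem exists_lowPass {r : ℝ} (hr : 0 < r) : ∃ χ : F → ℝ, ContDiff ℝ ∞ χ ∧ HasCompactSupport χ ∧
    (∀ ξ, χ ξ ∈ Icc 0 1) ∧ (∀ ξ, ‖ξ‖ ≤ r → χ ξ = 1) ∧ ∀ ξ, 2 * r ≤ ‖ξ‖ → χ ξ = 0 := by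
  let χ : ContDiffBump (0 : F) := ⟨r, 2 * r, hr, by linarith⟩
  refine ⟨χ, χ.contDiff, χ.hasCompactSupport, fun ξ => ⟨χ.nonneg, χ.le_one⟩, fun ξ h => ?_,
    fun ξ h => ?_⟩
  · exact χ.one_of_mem_closedBall (by simpa using h)
  · exact χ.zero_of_le_dist (by simpa using h)

theorem sumTransform_add {ι : Type*} [Fintype ι] (b : ι → SurfaceIntegralFamily d k) {f g : F → ℂ}
    (hf : Continuous f) (hg : Continuous g) (x : F) :
    sumTransform b (fun y => f y + g y) x = sumTransform b f x + sumTransform b g x := by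
  have h : ∀ i, ∀ u : F → ℂ, Continuous u →
      Integrable fun w : V => u ((b i).γ (x, w)) * ((b i).a (x, w) : ℂ) := by
    intro i u hu
    have h1 := (b i).contDiff_γ.continuous
    have h2 := (b i).contDiff_a.continuous
    refine Continuous.integrable_of_hasCompactSupport (by fun_prop) (HasCompactSupport.mul_left ?_)
    exact ((b i).hasCompactSupport_a.comp_left (g := fun r : ℝ => (r : ℂ)) (by simp)).comp_isClosedEmbedding
      (Isometry.of_dist_eq fun w w' => by simp [Prod.dist_eq] : Isometry (Prod.mk x)).isClosedEmbedding
  simp only [sumTransform, SurfaceIntegralFamily.transform, ← Finset.sum_add_distrib]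
  refine Finset.sum_congr rfl fun i _ => ?_
  rw [← integral_add (h i f hf) (h i g hg)]
  simp only [add_mul]

theorem integral_norm_sq_le_of_fourier_le {g f : 𝓢(F, ℂ)} {R : ℝ} (h : ∀ ξ, ‖𝓕 g ξ‖ ≤ ‖𝓕 f ξ‖)
    (h0 : ∀ ξ, R ≤ ‖ξ‖ → 𝓕 g ξ = 0) :
    ∫ x, ‖g x‖ ^ 2 ≤ ∫ ξ in Metric.closedBall 0 R, ‖𝓕 f ξ‖ ^ 2 := by
  rw [← SchwartzMap.integral_norm_sq_fourier,
    ← integral_indicator Metric.isClosed_closedBall.measurableSet]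
  refine integral_mono_of_nonneg (Eventually.of_forall fun x => by positivity)
    (((𝓕 f).memLp 2 volume).integrable_norm_pow (by simp) |>.indicator
      Metric.isClosed_closedBall.measurableSet) (Eventually.of_forall fun ξ => ?_)
  by_cases hξ : ξ ∈ Metric.closedBall (0 : F) R
  · simp only [indicator_of_mem hξ]
    have := h ξ
    gcongr
  · have : R ≤ ‖ξ‖ := by simpa using (not_le.1 (by simpa using hξ)).le
    simp [h0 ξ this, indicator_of_notMem hξ]

theorem setIntegral_norm_sq_fourierInv (f : 𝓢(F, ℂ)) (R : ℝ) :
    ∫ ξ in Metric.closedBall 0 R, ‖𝓕⁻ f ξ‖ ^ 2 = ∫ ξ in Metric.closedBall 0 R, ‖𝓕 f ξ‖ ^ 2 := by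
  have h : ∀ ξ, 𝓕⁻ f ξ = 𝓕 f (-ξ) := fun ξ => by
    rw [SchwartzMap.fourier_coe, SchwartzMap.fourierInv_coe, Real.fourierInv_eq_fourier_neg]
  rw [← integral_indicator Metric.isClosed_closedBall.measurableSet,
    ← integral_indicator Metric.isClosed_closedBall.measurableSet,
    ← integral_neg_eq_self]
  congr 1
  funext ξ
  simp [indicator, h]

theorem integral_rpow_mul_norm_sq_le {G f : 𝓢(F, ℂ)} {s R B : ℝ} (hs : 0 ≤ s) (hB : 0 < B)
    (h : ∀ ξ, ‖𝓕⁻ G ξ‖ ≤ ‖𝓕⁻ f ξ‖)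
    (h0 : ∀ ξ, 𝓕⁻ G ξ ≠ 0 → ‖ξ‖ ≤ R ∧ B ≤ 1 + ‖ξ‖ ^ 2) :
    ∫ ξ, (1 + ‖ξ‖ ^ 2) ^ (-s) * ‖𝓕⁻ G ξ‖ ^ 2 ≤
      B ^ (-s) * ∫ ξ in Metric.closedBall 0 R, ‖𝓕 f ξ‖ ^ 2 := by
  rw [← setIntegral_norm_sq_fourierInv, ← integral_const_mul,
    ← integral_indicator Metric.isClosed_closedBall.measurableSet]
  refine integral_mono_of_nonneg (Eventually.of_forall fun x => by positivity)
    ((((𝓕⁻ f).memLp 2 volume).integrable_norm_pow (by simp) |>.const_mul _).indicator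
      Metric.isClosed_closedBall.measurableSet) (Eventually.of_forall fun ξ => ?_)
  by_cases hξ : 𝓕⁻ G ξ = 0
  · simp only [hξ]
    simpa using indicator_nonneg (fun _ _ => by positivity) ξ
  · obtain ⟨h1, h2⟩ := h0 ξ hξ
    have hξ : ξ ∈ Metric.closedBall (0 : F) R := by simpa using h1
    simp only [indicator_of_mem hξ]
    have := h ξ
    gcongr ?_ * ?_ ^ 2
    exact Real.rpow_le_rpow_of_nonpos hB h2 (by linarith)

theorem IsFrostman.norm_fourier_le {α M : ℝ} {f : 𝓢(F, ℂ)} (hf : IsFrostman α M f) (ξ : F) :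
    ‖𝓕 f ξ‖ ≤ M := by
  refine le_trans ?_ hf.integral_norm_le
  rw [SchwartzMap.fourier_coe]
  exact VectorFourier.norm_fourierIntegral_le_integral_norm ..

theorem IsFrostman.norm_fourierInv_le {α M : ℝ} {f : 𝓢(F, ℂ)} (hf : IsFrostman α M f) (ξ : F) :
    ‖𝓕⁻ f ξ‖ ≤ M := by
  have h : 𝓕⁻ f ξ = 𝓕 f (-ξ) := by
    rw [SchwartzMap.fourier_coe, SchwartzMap.fourierInv_coe, Real.fourierInv_eq_fourier_neg]
  rw [h]
  exact hf.norm_fourier_le _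

variable {ι : Type*} [Fintype ι] (b : ι → SurfaceIntegralFamily d k)

theorem exists_norm_integral_highFrequency_le (n : ℕ) :
    ∃ C : ℝ, 0 ≤ C ∧ ∀ (f G : 𝓢(F, ℂ)) (r A M : ℝ), 1 ≤ r → 1 ≤ A → 0 ≤ M →
      (∀ ξ, ‖𝓕 f ξ‖ ≤ M) → (∀ ξ, ‖ξ‖ < r → 𝓕 f ξ = 0) →
      (∀ η, ‖𝓕⁻ G η‖ ≤ M) → (∀ η, 2 * A < ‖η‖ → 𝓕⁻ G η = 0) →
      ‖∫ x, sumTransform b f x * G x‖ ≤ C * M ^ 2 * (A ^ (d + (n + (d + 1))) / r ^ n) := by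
  choose C hC0 hC using fun i => (b i).exists_norm_integral_le n
  refine ⟨∑ i, C i, Finset.sum_nonneg fun i _ => hC0 i, fun f G r A M hr hA hM h1 h2 h3 h4 => ?_⟩
  rw [(integral_sumTransform_mul b f.continuous G.continuous).2, Finset.sum_mul, Finset.sum_mul]
  exact (norm_sum_le _ _).trans (Finset.sum_le_sum fun i _ => hC i f G r A M hr hA hM h1 h2 h3 h4)

/-- `f` is cut at frequency `A ^ (1 + κ)`. Below the cut the Sobolev gain on `G` beats the energies
of both factors; above it the oscillatory bound applies, `G` having frequencies at most `2 A`. -/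
theorem exists_norm_integral_dyadic_le (hd : 0 < d) {s C₀ α M : ℝ} (hC₀ : 0 ≤ C₀) (hM : 0 ≤ M)
    (hα : α ≤ d) (hs : (d : ℝ) - α < s) (hS : IsL2SobolevBounded s C₀ (sumTransform b)) :
    ∃ C σ : ℝ, 0 ≤ C ∧ 0 < σ ∧ ∀ (f G : 𝓢(F, ℂ)) (A : ℝ), IsFrostman α M f → 1 ≤ A →
      (∀ ξ, ‖𝓕⁻ G ξ‖ ≤ ‖𝓕⁻ f ξ‖) → (∀ ξ, 𝓕⁻ G ξ ≠ 0 → ‖ξ‖ ≤ 2 * A ∧ A ^ 2 / 4 ≤ 1 + ‖ξ‖ ^ 2) →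
      ‖∫ x, sumTransform b f x * G x‖ ≤ C * A ^ (-σ) := by
  obtain ⟨C₁, hC₁, henergy⟩ := exists_setIntegral_norm_sq_fourier_le hd (α := α) hM
  set β : ℝ := d - α with hβ
  have hβ0 : 0 ≤ β := by linarith
  -- With `κ β ≤ s - β`, the exponent `((1 + κ) β + β - 2 s) / 2` of the low part is at most `-(s -
  -- β) / 2`.
  set κ : ℝ := (s - β) / (β + 1) with hκ
  have hκ0 : 0 < κ := by apply div_pos <;> linarith
  -- The high part has exponent `2 d + 1 - κ n`, which is at most `-1` for this `n`.
  obtain ⟨n, hn⟩ := exists_nat_ge ((2 * d + 2) / κ)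
  rw [div_le_iff₀ hκ0] at hn
  obtain ⟨C₂, hC₂, hhigh⟩ := exists_norm_integral_highFrequency_le b n
  set σ : ℝ := min ((s - β) / 2) 1 with hσ
  set K : ℝ := C₀ * √(C₁ * 2 ^ β) * √((1 / 4) ^ (-s) * (C₁ * 2 ^ β)) with hK
  refine ⟨K + C₂ * M ^ 2, σ, by positivity, lt_min (by linarith) one_pos,
    fun f G A hf hA hGf hG => ?_⟩
  have hA0 : 0 < A := by linarith
  set r : ℝ := A ^ (1 + κ) with hr
  have hr1 : 1 ≤ r := Real.one_le_rpow hA (by linarith)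
  obtain ⟨χ, hχ, hχc, hχ01, hχ1, hχ0⟩ := exists_lowPass (d := d) (by linarith : 0 < r)
  obtain ⟨u, hu⟩ := exists_schwartzMap_eq_mul hχ hχc (𝓕 f)
  set g : 𝓢(F, ℂ) := 𝓕⁻ u with hg
  have hFg : ∀ ξ, 𝓕 g ξ = (χ ξ : ℂ) * 𝓕 f ξ := fun ξ => by
    rw [hg, fourier_fourierInv_eq, hu]
  set h : 𝓢(F, ℂ) := f - g with hh
  have hFh : ∀ ξ, 𝓕 h ξ = (1 - χ ξ : ℝ) * 𝓕 f ξ := fun ξ => by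
    have : 𝓕 h = 𝓕 f - 𝓕 g := map_sub (SchwartzMap.fourierTransformCLM ℂ) f g
    rw [this, sub_apply, hFg]
    push_cast
    ring
  have hsplit : ∫ x, sumTransform b f x * G x =
      (∫ x, sumTransform b g x * G x) + ∫ x, sumTransform b h x * G x := by
    rw [← integral_add (integral_sumTransform_mul b g.continuous G.continuous).1
      (integral_sumTransform_mul b h.continuous G.continuous).1]
    refine integral_congr_ae (Eventually.of_forall fun x => ?_)
    simp only
    rw [← add_mul, ← sumTransform_add b g.continuous h.continuous]
    congr 3
    funext y
    simp [hh]
  have hlow : ‖∫ x, sumTransform b g x * G x‖ ≤ K * A ^ (-σ) := by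
    refine (norm_integral_sumTransform_mul_le b hC₀ hS g G).trans ?_
    have e1 : ∫ x, ‖g x‖ ^ 2 ≤ C₁ * 2 ^ β * r ^ β := by
      refine (integral_norm_sq_le_of_fourier_le (f := f) (R := 2 * r) (fun ξ => ?_)
        fun ξ hξ => ?_).trans ((henergy f hf _ (by linarith)).trans_eq ?_)
      · rw [hFg, norm_mul, Complex.norm_real, Real.norm_of_nonneg (hχ01 ξ).1]
        exact mul_le_of_le_one_left (norm_nonneg _) (hχ01 ξ).2
      · rw [hFg, hχ0 ξ hξ]; simp
      · rw [Real.mul_rpow (by norm_num) (by linarith)]; ring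
    have e2 : ∫ ξ, (1 + ‖ξ‖ ^ 2) ^ (-s) * ‖𝓕⁻ G ξ‖ ^ 2 ≤
        (1 / 4) ^ (-s) * (C₁ * 2 ^ β) * (A ^ β * A ^ (-(2 * s))) := by
      refine (integral_rpow_mul_norm_sq_le (f := f) (R := 2 * A) (B := A ^ 2 / 4) (by linarith)
        (by positivity) hGf hG).trans ?_
      have h1 := henergy f hf (2 * A) (by linarith)
      have h2 : (A ^ 2 / 4) ^ (-s) = (1 / 4) ^ (-s) * A ^ (-(2 * s)) := by
        rw [show A ^ 2 / 4 = 1 / 4 * A ^ 2 by ring, Real.mul_rpow (by norm_num) (by positivity),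
          ← Real.rpow_natCast, ← Real.rpow_mul hA0.le]
        congr 2
        push_cast; ring
      rw [h2]
      refine (mul_le_mul_of_nonneg_left h1 (by positivity)).trans_eq ?_
      rw [Real.mul_rpow (by norm_num) hA0.le]
      ring
    have e3 : √(r ^ β) * √(A ^ β * A ^ (-(2 * s))) ≤ A ^ (-σ) := by
      rw [← Real.sqrt_mul (by positivity), hr, ← Real.rpow_mul hA0.le, ← Real.rpow_add hA0,
        ← Real.rpow_add hA0, Real.sqrt_eq_rpow, ← Real.rpow_mul hA0.le]
      refine Real.rpow_le_rpow_of_exponent_le hA ?_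
      have h1 : κ * (β + 1) = s - β := div_mul_cancel₀ _ (by linarith)
      have h2 : σ ≤ (s - β) / 2 := min_le_left _ _
      nlinarith
    calc _ ≤ C₀ * √(C₁ * 2 ^ β * r ^ β) *
        √((1 / 4) ^ (-s) * (C₁ * 2 ^ β) * (A ^ β * A ^ (-(2 * s)))) := by gcongr
      _ = K * (√(r ^ β) * √(A ^ β * A ^ (-(2 * s)))) := by
        have h1 : √(C₁ * 2 ^ β * r ^ β) = √(C₁ * 2 ^ β) * √(r ^ β) := Real.sqrt_mul (by positivity) _
        have h2 : √((1 / 4) ^ (-s) * (C₁ * 2 ^ β) * (A ^ β * A ^ (-(2 * s)))) =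
            √((1 / 4) ^ (-s) * (C₁ * 2 ^ β)) * √(A ^ β * A ^ (-(2 * s))) :=
          Real.sqrt_mul (by positivity) _
        rw [h1, h2, hK]
        ring
      _ ≤ _ := by gcongr
  have hhi : ‖∫ x, sumTransform b h x * G x‖ ≤ C₂ * M ^ 2 * A ^ (-σ) := by
    refine (hhigh h G r A M hr1 hA hM (fun ξ => ?_) (fun ξ hξ => ?_)
      (fun ξ => (hGf ξ).trans (hf.norm_fourierInv_le ξ)) fun ξ hξ => ?_).trans ?_
    · rw [hFh, norm_mul, Complex.norm_real, Real.norm_of_nonneg (by linarith [(hχ01 ξ).2])]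
      exact (mul_le_of_le_one_left (norm_nonneg _) (by linarith [(hχ01 ξ).1])).trans
        (hf.norm_fourier_le ξ)
    · rw [hFh, hχ1 ξ hξ.le]; simp
    · by_contra h0
      linarith [(hG ξ h0).1]
    · gcongr
      rw [hr, ← Real.rpow_natCast, ← Real.rpow_natCast, ← Real.rpow_mul hA0.le,
        ← Real.rpow_sub hA0]
      refine Real.rpow_le_rpow_of_exponent_le hA ?_
      have h2 : σ ≤ 1 := min_le_right _ _
      push_cast
      nlinarith
  rw [hsplit, add_mul]
  exact (norm_add_le _ _).trans (add_le_add hlow hhi)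

/-- The bilinear form of a finite sum of surface integral families which is bounded from `L²` to
`L²_s` is bounded on Frostman densities of exponent `α > d - s`. -/
theorem exists_norm_integral_sumTransform_mul_self_le (hd : 0 < d) {s C₀ α M : ℝ} (hC₀ : 0 ≤ C₀)
    (hM : 0 ≤ M) (hα : α ≤ d) (hs : (d : ℝ) - α < s)
    (hS : IsL2SobolevBounded s C₀ (sumTransform b)) :
    ∃ C : ℝ, ∀ f : 𝓢(F, ℂ), IsFrostman α M f → ‖∫ x, sumTransform b f x * f x‖ ≤ C := by
  obtain ⟨C, σ, hC, hσ, hpiece⟩ := exists_norm_integral_dyadic_le b hd hC₀ hM hα hs hS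
  set q : ℝ := 2 ^ (-σ) with hq
  have hq0 : 0 < q := by positivity
  have hq1 : q < 1 := Real.rpow_lt_one_of_one_lt_of_neg (by norm_num) (by linarith)
  refine ⟨C * (1 - q)⁻¹, fun f hf => ?_⟩
  -- `G J` keeps the frequencies of `f` up to about `2 ^ J`; consecutive differences are the dyadic
  -- pieces.
  have hlow : ∀ J : ℕ, ∃ G : 𝓢(F, ℂ), ∃ χ : F → ℝ, (∀ ξ, 𝓕⁻ G ξ = (χ ξ : ℂ) * 𝓕⁻ f ξ) ∧
      (∀ ξ, χ ξ ∈ Icc 0 1) ∧ (∀ ξ, ‖ξ‖ ≤ 2 ^ J → χ ξ = 1) ∧ ∀ ξ, 2 * 2 ^ J ≤ ‖ξ‖ → χ ξ = 0 := by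
    intro J
    obtain ⟨χ, hχ, hχc, h01, h1, h0⟩ := exists_lowPass (d := d) (by positivity : (0 : ℝ) < 2 ^ J)
    obtain ⟨u, hu⟩ := exists_schwartzMap_eq_mul hχ hχc (𝓕⁻ f)
    exact ⟨𝓕 u, χ, fun ξ => by rw [fourierInv_fourier_eq, hu], h01, h1, h0⟩
  choose G χ hG h01 h1 h0 using hlow
  have hsub : ∀ u v : 𝓢(F, ℂ), ∀ ξ, 𝓕⁻ (u - v) ξ = 𝓕⁻ u ξ - 𝓕⁻ v ξ := fun u v ξ => by
    have : 𝓕⁻ (u - v) = 𝓕⁻ u - 𝓕⁻ v := map_sub (FourierTransform.fourierCLE ℂ 𝓢(F, ℂ)).symm u v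
    rw [this, sub_apply]
  have hint : ∀ u : 𝓢(F, ℂ), Integrable fun x => sumTransform b f x * u x := fun u =>
    (integral_sumTransform_mul b f.continuous u.continuous).1
  have hisub : ∀ u v : 𝓢(F, ℂ), ∫ x, sumTransform b f x * (u - v) x =
      (∫ x, sumTransform b f x * u x) - ∫ x, sumTransform b f x * v x := fun u v => by
    rw [← integral_sub (hint u) (hint v)]
    simp only [sub_apply, mul_sub]
  have hstep : ∀ J : ℕ, ‖∫ x, sumTransform b f x * (G (J + 1) - G J) x‖ ≤ C * q ^ (J + 1) := by
    intro J
    have hmul : ∀ ξ, 𝓕⁻ (G (J + 1) - G J) ξ = ((χ (J + 1) ξ - χ J ξ : ℝ) : ℂ) * 𝓕⁻ f ξ := fun ξ => by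
      rw [hsub, hG, hG]; push_cast; ring
    refine (hpiece f (G (J + 1) - G J) (2 ^ (J + 1)) hf (one_le_pow₀ one_le_two) (fun ξ => ?_)
      fun ξ hξ => ?_).trans_eq ?_
    · rw [hmul, norm_mul, Complex.norm_real]
      refine mul_le_of_le_one_left (norm_nonneg _) (abs_le.2 ⟨?_, ?_⟩)
      · linarith [(h01 (J + 1) ξ).1, (h01 J ξ).2]
      · linarith [(h01 (J + 1) ξ).2, (h01 J ξ).1]
    · rw [hmul] at hξ
      have hne : χ (J + 1) ξ - χ J ξ ≠ 0 := fun h => hξ (by rw [h]; simp)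
      constructor
      · by_contra! h
        refine hne ?_
        rw [h0 (J + 1) ξ h.le, h0 J ξ (by rw [pow_succ] at h; nlinarith [pow_pos (two_pos (α := ℝ)) J]),
          sub_zero]
      · have : (2 : ℝ) ^ J < ‖ξ‖ := by
          by_contra! h
          refine hne ?_
          rw [h1 J ξ h, h1 (J + 1) ξ (h.trans (pow_le_pow_right₀ one_le_two (by omega))), sub_self]
        have h3 : ((2 : ℝ) ^ J) ^ 2 ≤ ‖ξ‖ ^ 2 := by gcongr
        rw [pow_succ 2 J]
        nlinarith
    · rw [hq, ← Real.rpow_natCast, ← Real.rpow_natCast, ← Real.rpow_mul two_pos.le,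
        ← Real.rpow_mul two_pos.le]
      congr 2
      ring
  have hbase : ‖∫ x, sumTransform b f x * G 0 x‖ ≤ C * q ^ 0 := by
    refine (hpiece f (G 0) 1 hf le_rfl (fun ξ => ?_) fun ξ hξ => ?_).trans_eq (by simp)
    · rw [hG, norm_mul, Complex.norm_real, Real.norm_of_nonneg (h01 0 ξ).1]
      exact mul_le_of_le_one_left (norm_nonneg _) (h01 0 ξ).2
    · constructor
      · by_contra! h
        refine hξ ?_
        rw [hG, h0 0 ξ (by simpa using h.le)]
        simp
      · nlinarith [sq_nonneg ‖ξ‖]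
  have hpartial : ∀ J : ℕ, ‖∫ x, sumTransform b f x * G J x‖ ≤
      C * ∑ j ∈ Finset.range (J + 1), q ^ j := by
    intro J
    induction J with
    | zero => simpa using hbase
    | succ J ih =>
      have h2 : ∫ x, sumTransform b f x * G (J + 1) x = (∫ x, sumTransform b f x * G J x) +
          ∫ x, sumTransform b f x * (G (J + 1) - G J) x := by rw [hisub]; ring
      rw [h2, Finset.sum_range_succ, mul_add]
      exact (norm_add_le _ _).trans (add_le_add ih (hstep J))
  have hgeom : ∀ J : ℕ, ∑ j ∈ Finset.range (J + 1), q ^ j ≤ (1 - q)⁻¹ := fun J => by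
    rw [← tsum_geometric_of_lt_one hq0.le hq1]
    exact (summable_geometric_of_lt_one hq0.le hq1).sum_le_tsum _ fun j _ => by positivity
  -- `D` depends on `f`, hence on the mollification scale, but multiplies a factor tending to `0`
  -- with `J`, so it is absent from the final bound.
  set D : ℝ := C₀ * √(∫ x, ‖f x‖ ^ 2) * √(∫ x, ‖𝓕⁻ f x‖ ^ 2) with hD
  have htail : ∀ J : ℕ, ‖∫ x, sumTransform b f x * (f - G J) x‖ ≤
      D * √((((2 : ℝ) ^ J) ^ 2) ^ (-s)) := by
    intro J
    refine (norm_integral_sumTransform_mul_le b hC₀ hS f (f - G J)).trans ?_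
    rw [hD, mul_assoc _ (√(∫ x, ‖𝓕⁻ f x‖ ^ 2)), ← Real.sqrt_mul (integral_nonneg fun x => by positivity)]
    refine mul_le_mul_of_nonneg_left (Real.sqrt_le_sqrt ?_) (by positivity)
    rw [mul_comm, ← integral_const_mul]
    refine integral_mono_of_nonneg (Eventually.of_forall fun x => by positivity)
      (((𝓕⁻ f).memLp 2 volume).integrable_norm_pow (by simp) |>.const_mul _)
      (Eventually.of_forall fun ξ => ?_)
    have hmul : 𝓕⁻ (f - G J) ξ = ((1 - χ J ξ : ℝ) : ℂ) * 𝓕⁻ f ξ := by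
      rw [hsub, hG]; push_cast; ring
    simp only [hmul, norm_mul, Complex.norm_real]
    rw [Real.norm_of_nonneg (by linarith [(h01 J ξ).2])]
    by_cases hξ : ‖ξ‖ ≤ 2 ^ J
    · rw [h1 J ξ hξ]
      simpa using by positivity
    · push Not at hξ
      have h2 : (1 + ‖ξ‖ ^ 2) ^ (-s) ≤ (((2 : ℝ) ^ J) ^ 2) ^ (-s) := by
        refine Real.rpow_le_rpow_of_nonpos (by positivity) ?_ (by linarith)
        have h3 : ((2 : ℝ) ^ J) ^ 2 ≤ ‖ξ‖ ^ 2 := by gcongr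
        linarith
      have h3 : (1 - χ J ξ) * ‖𝓕⁻ f ξ‖ ≤ ‖𝓕⁻ f ξ‖ :=
        mul_le_of_le_one_left (norm_nonneg _) (by linarith [(h01 J ξ).1])
      have h4 : 0 ≤ (1 - χ J ξ) * ‖𝓕⁻ f ξ‖ :=
        mul_nonneg (by linarith [(h01 J ξ).2]) (norm_nonneg _)
      exact mul_le_mul h2 (pow_le_pow_left₀ h4 h3 2) (by positivity) (by positivity)
  have hlim : Tendsto (fun J : ℕ => C * (1 - q)⁻¹ + D * √((((2 : ℝ) ^ J) ^ 2) ^ (-s))) atTop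
      (𝓝 (C * (1 - q)⁻¹ + D * √0)) := by
    refine tendsto_const_nhds.add (tendsto_const_nhds.mul ?_)
    refine (Real.continuous_sqrt.tendsto 0).comp ?_
    refine (tendsto_rpow_neg_atTop (by linarith)).comp ?_
    exact (tendsto_pow_atTop two_ne_zero).comp (tendsto_pow_atTop_atTop_of_one_lt one_lt_two)
  rw [Real.sqrt_zero, mul_zero, add_zero] at hlim
  refine ge_of_tendsto' hlim fun J => ?_
  have h2 : ∫ x, sumTransform b f x * f x = (∫ x, sumTransform b f x * G J x) +
      ∫ x, sumTransform b f x * (f - G J) x := by rw [hisub]; ring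
  rw [h2]
  exact (norm_add_le _ _).trans (add_le_add ((hpartial J).trans
    (mul_le_mul_of_nonneg_left (hgeom J) hC)) (htail J))

end Dyadic

/-! ### Mollifying the regular measure. -/

section Mollification

variable {d : ℕ}

local notation "F" => EuclideanSpace ℝ (Fin d)

/-- A ball meeting `E` sits in a ball of twice the radius centred in `E`; radii above `1 / 2` are
absorbed by the finite total mass. -/
theorem exists_measureReal_ball_le {E : Set F} (hE : IsCompact E) {μ : Measure F} (hμE : μ Eᶜ = 0)
    {α C : ℝ} (hC : 0 < C)
    (hμ : ∀ x ∈ E, ∀ δ : ℝ, 0 < δ → δ ≤ 1 → μ (Metric.ball x δ) ≤ ENNReal.ofReal (C * δ ^ α))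
    (hα : 0 ≤ α) :
    IsFiniteMeasure μ ∧ ∃ C₁ : ℝ, 0 ≤ C₁ ∧ ∀ x r, 0 < r → μ.real (Metric.ball x r) ≤ C₁ * r ^ α := by
  have hfin : IsFiniteMeasure μ := by
    refine ⟨?_⟩
    obtain ⟨s, hs, hsE⟩ := hE.elim_nhds_subcover (fun x => Metric.ball x 1)
      fun x _ => Metric.ball_mem_nhds x one_pos
    have h1 : μ univ ≤ μ E + μ Eᶜ := by
      rw [← union_compl_self E]; exact measure_union_le _ _
    rw [hμE, add_zero] at h1
    refine h1.trans_lt ((measure_mono hsE).trans_lt ?_)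
    refine (measure_biUnion_finset_le s _).trans_lt (ENNReal.sum_lt_top.2 fun x hx => ?_)
    exact (hμ x (hs x hx) 1 one_pos le_rfl).trans_lt ENNReal.ofReal_lt_top
  refine ⟨hfin, max C (μ.real univ) * 2 ^ α, by positivity, fun x r hr => ?_⟩
  by_cases hx : (Metric.ball x r ∩ E).Nonempty
  · obtain ⟨z, hz, hzE⟩ := hx
    have h2 : Metric.ball x r ⊆ Metric.ball z (2 * r) := by
      refine Metric.ball_subset_ball' ?_
      have : dist x z < r := by rw [dist_comm]; exact hz
      linarith
    rw [mul_assoc, ← Real.mul_rpow (by norm_num) hr.le]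
    rcases le_or_gt (2 * r) 1 with h | h
    · refine (measureReal_mono h2).trans ?_
      refine (ENNReal.toReal_le_of_le_ofReal (by positivity)
        (hμ z hzE (2 * r) (by linarith) h)).trans ?_
      gcongr
      exact le_max_left _ _
    · refine (measureReal_mono (subset_univ _)).trans ((le_max_right C _).trans ?_)
      exact le_mul_of_one_le_right (by positivity) (Real.one_le_rpow h.le hα)
  · have : μ (Metric.ball x r) = 0 := by
      refine measure_mono_null (fun y hy hyE => hx ⟨y, hy, hyE⟩) hμE
    rw [measureReal_def, this]
    simpa using by positivity

theorem measureReal_ball_eq (x : F) {r : ℝ} (hr : 0 < r) :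
    volume.real (Metric.ball x r) = r ^ d * volume.real (Metric.ball (0 : F) 1) := by
  rw [measureReal_def, Measure.addHaar_ball_of_pos _ _ hr, ENNReal.toReal_mul,
    ENNReal.toReal_ofReal (by positivity), finrank_euclideanSpace_fin, measureReal_def]

/-- Mollifying a measure at scale `δ` redistributes the mass by at most `ρ`. -/
theorem setIntegral_integral_kernel_le {μ : Measure F} [IsFiniteMeasure μ] {K : F → ℝ}
    (hK : Continuous K) (hK0 : ∀ z, 0 ≤ K z) {κ ρ : ℝ} (hρ : 0 < ρ) (hκ : 0 ≤ κ) (hKle : ∀ z, K z ≤ κ)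
    (hKs : ∀ z, ρ ≤ ‖z‖ → K z = 0) {S T : Set F} (hS : MeasurableSet S) (hT : MeasurableSet T)
    (hST : ∀ x ∈ S, ∀ y, dist x y < ρ → y ∈ T) :
    ∫ x in S, ∫ y, K (x - y) ∂μ ≤
      κ * (ρ ^ d * volume.real (Metric.ball (0 : F) 1)) * μ.real T := by
  have hint : ∀ x, Integrable (fun y => K (x - y)) μ := fun x =>
    Integrable.of_bound (by fun_prop) κ (Eventually.of_forall fun y => by
      rw [Real.norm_of_nonneg (hK0 _)]; exact hKle _)
  rw [integral_eq_lintegral_of_nonneg_ae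
    (Eventually.of_forall fun x => integral_nonneg fun y => hK0 _)]
  swap
  · have h1 : StronglyMeasurable (Function.uncurry fun x y : F => K (x - y)) :=
      Continuous.stronglyMeasurable (by fun_prop)
    exact h1.integral_prod_right.aestronglyMeasurable
  refine ENNReal.toReal_le_of_le_ofReal (by positivity) ?_
  simp_rw [fun x => ofReal_integral_eq_lintegral_ofReal (hint x) (Eventually.of_forall fun y => hK0 _)]
  rw [lintegral_lintegral_swap (by fun_prop)]
  have hin : ∀ y, ∫⁻ x in S, ENNReal.ofReal (K (x - y)) ≤
      T.indicator (fun _ => ENNReal.ofReal κ * volume (Metric.ball (0 : F) ρ)) y := by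
    intro y
    by_cases hy : y ∈ T
    · rw [indicator_of_mem hy]
      have h1 : ∀ x, ENNReal.ofReal (K (x - y)) ≤
          (Metric.ball y ρ).indicator (fun _ => ENNReal.ofReal κ) x := fun x => by
        by_cases hx : x ∈ Metric.ball y ρ
        · rw [indicator_of_mem hx]; exact ENNReal.ofReal_le_ofReal (hKle _)
        · rw [hKs _ (by rw [← dist_eq_norm]; simpa using hx)]; simp
      refine (lintegral_mono' Measure.restrict_le_self h1).trans ?_
      rw [lintegral_indicator measurableSet_ball, setLIntegral_const,
        Measure.addHaar_ball_center volume y]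
    · rw [indicator_of_notMem hy, nonpos_iff_eq_zero, setLIntegral_eq_zero_iff hS (by fun_prop)]
      refine Eventually.of_forall fun x hx => ?_
      rw [hKs, ENNReal.ofReal_zero]
      rw [← dist_eq_norm]
      by_contra! h
      exact hy (hST x hx y h)
  refine (lintegral_mono hin).trans_eq ?_
  rw [lintegral_indicator hT, setLIntegral_const, ← ofReal_measureReal (μ := volume),
    ← ofReal_measureReal (μ := μ), measureReal_ball_eq _ hρ, ← ENNReal.ofReal_mul hκ,
    ← ENNReal.ofReal_mul (by positivity)]

/-- A measure which is Ahlfors-David regular of exponent `α` on a compact set has smooth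
mollifications at every scale, which form a bounded family of Frostman densities. -/
theorem exists_mollification {E : Set F} (hE : IsCompact E) {μ : Measure F} (hμE : μ Eᶜ = 0)
    {α C : ℝ} (hC : 0 < C)
    (hμ : ∀ x ∈ E, ∀ δ : ℝ, 0 < δ → δ ≤ 1 → ENNReal.ofReal (C⁻¹ * δ ^ α) ≤ μ (Metric.ball x δ) ∧
      μ (Metric.ball x δ) ≤ ENNReal.ofReal (C * δ ^ α))
    (hα : 0 ≤ α) (hαd : α ≤ d) :
    ∃ M : ℝ, 0 ≤ M ∧ ∀ δ : ℝ, 0 < δ → δ ≤ 1 → ∃ (f : F → ℝ) (g : 𝓢(F, ℂ)), (∀ x, g x = (f x : ℂ)) ∧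
      (∀ x, 0 ≤ f x) ∧ (∀ x, ∀ z ∈ E, dist x z ≤ δ → C⁻¹ * δ ^ (α - d) ≤ f x) ∧
      (∀ x, f x ≠ 0 → ∃ z ∈ E, dist x z < 3 * δ) ∧ IsFrostman α M g := by
  obtain ⟨hfin, C₁, hC₁, hball⟩ := exists_measureReal_ball_le hE hμE hC
    (fun x hx δ h1 h2 => (hμ x hx δ h1 h2).2) hα
  set v : ℝ := volume.real (Metric.ball (0 : F) 1) with hv
  set M₁ : ℝ := 3 ^ d * v * μ.real univ with hM₁
  set M₂ : ℝ := 3 ^ d * v * (C₁ * 4 ^ α) with hM₂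
  set M₃ : ℝ := v * (C₁ * 3 ^ α) with hM₃
  have hM₁0 : 0 ≤ M₁ := by positivity
  have hM₂0 : 0 ≤ M₂ := by positivity
  have hM₃0 : 0 ≤ M₃ := by positivity
  refine ⟨M₁ + M₂ + M₃, by positivity, fun δ hδ hδ1 => ?_⟩
  -- The plateau of radius `2 δ` ensures that, for `x` within `δ` of `z ∈ E`, the kernel is full on
  -- all of `B(z, δ)`.
  let b : ContDiffBump (0 : F) := ⟨2 * δ, 3 * δ, by linarith, by linarith⟩
  set K : F → ℝ := fun z => δ ^ (-(d : ℝ)) * b z with hKdef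
  have hKd : ContDiff ℝ ∞ K := contDiff_const.mul b.contDiff
  have hKc : HasCompactSupport K := b.hasCompactSupport.mul_left
  have hKcont : Continuous K := hKd.continuous
  have hδd : 0 < δ ^ (-(d : ℝ)) := by positivity
  have hK0 : ∀ z, 0 ≤ K z := fun z => mul_nonneg hδd.le b.nonneg
  have hKle : ∀ z, K z ≤ δ ^ (-(d : ℝ)) := fun z => mul_le_of_le_one_right hδd.le b.le_one
  have hKs : ∀ z, 3 * δ ≤ ‖z‖ → K z = 0 := fun z hz => by
    rw [hKdef]; simp only
    rw [b.zero_of_le_dist (by simpa using hz), mul_zero]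
  have hK1 : ∀ z, ‖z‖ ≤ 2 * δ → K z = δ ^ (-(d : ℝ)) := fun z hz => by
    rw [hKdef]; simp only
    rw [b.one_of_mem_closedBall (by simpa using hz), mul_one]
  have hint : ∀ x, Integrable (fun y => K (x - y)) μ := fun x =>
    Integrable.of_bound (by fun_prop) (δ ^ (-(d : ℝ))) (Eventually.of_forall fun y => by
      rw [Real.norm_of_nonneg (hK0 _)]; exact hKle _)
  set f : F → ℝ := fun x => ∫ y, K (x - y) ∂μ with hf
  have hf0 : ∀ x, 0 ≤ f x := fun x => integral_nonneg fun y => hK0 _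
  have hfd : ContDiff ℝ ∞ f := by
    have h := hKc.contDiff_convolution_right (μ := μ) (f := fun _ : F => (1 : ℝ))
      (ContinuousLinearMap.lsmul ℝ ℝ) (locallyIntegrable_const 1) hKd
    have he : f = convolution (fun _ : F => (1 : ℝ)) K (ContinuousLinearMap.lsmul ℝ ℝ) μ := by
      funext x
      simp [convolution, hf]
    rwa [he]
  have hfs : ∀ x, f x ≠ 0 → ∃ z ∈ E, dist x z < 3 * δ := by
    intro x hx
    by_contra! h
    refine hx (integral_eq_zero_of_ae ?_)
    have hae : ∀ᵐ y ∂μ, y ∈ E := by rw [ae_iff]; exact hμE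
    filter_upwards [hae] with y hy
    exact hKs _ (by rw [← dist_eq_norm]; exact h y hy)
  have hfc : HasCompactSupport f := by
    refine HasCompactSupport.of_support_subset_isCompact (hE.cthickening (r := 3 * δ)) fun x hx => ?_
    obtain ⟨z, hz, hxz⟩ := hfs x hx
    exact Metric.mem_cthickening_of_dist_le x z _ E hz hxz.le
  have hfle : ∀ x, f x ≤ C₁ * 3 ^ α * δ ^ (α - d) := by
    intro x
    have h1 : f x ≤ ∫ y, (Metric.ball x (3 * δ)).indicator (fun _ => δ ^ (-(d : ℝ))) y ∂μ := by
      refine integral_mono (hint x) ((integrable_const _).indicator measurableSet_ball) fun y => ?_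
      by_cases hy : y ∈ Metric.ball x (3 * δ)
      · rw [indicator_of_mem hy]; exact hKle _
      · simp only [indicator_of_notMem hy]
        exact (hKs _ (by rw [← dist_eq_norm, dist_comm]; simpa using hy)).le
    rw [integral_indicator measurableSet_ball, setIntegral_const, smul_eq_mul] at h1
    refine h1.trans ?_
    rw [sub_eq_add_neg, Real.rpow_add hδ, ← mul_assoc]
    refine mul_le_mul_of_nonneg_right ?_ hδd.le
    refine (hball x (3 * δ) (by linarith)).trans_eq ?_
    rw [Real.mul_rpow (by norm_num) hδ.le, mul_assoc]
  have hδdd : δ ^ (-(d : ℝ)) * ((3 * δ) ^ d * v) = 3 ^ d * v := by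
    rw [Real.rpow_neg hδ.le, Real.rpow_natCast, mul_pow]
    field_simp
  have hcg : ContDiff ℝ ∞ fun x => (f x : ℂ) := Complex.ofRealCLM.contDiff.comp hfd
  have hcc : HasCompactSupport fun x => (f x : ℂ) :=
    hfc.comp_left (g := fun r : ℝ => (r : ℂ)) (by simp)
  refine ⟨f, hcc.toSchwartzMap hcg, fun x => rfl, hf0, fun x z hz hxz => ?_, hfs, ?_, ?_⟩
  · have h1 : ∫ y, (Metric.ball z δ).indicator (fun _ => δ ^ (-(d : ℝ))) y ∂μ ≤ f x := by
      refine integral_mono ((integrable_const _).indicator measurableSet_ball) (hint x) fun y => ?_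
      by_cases hy : y ∈ Metric.ball z δ
      · simp only [indicator_of_mem hy]
        refine (hK1 _ ?_).ge
        rw [← dist_eq_norm]
        have := dist_triangle x z y
        rw [Metric.mem_ball, dist_comm] at hy
        linarith
      · simp only [indicator_of_notMem hy]; exact hK0 _
    rw [integral_indicator measurableSet_ball, setIntegral_const, smul_eq_mul] at h1
    refine le_trans ?_ h1
    rw [sub_eq_add_neg, Real.rpow_add hδ, ← mul_assoc]
    refine mul_le_mul_of_nonneg_right ?_ hδd.le
    exact (ENNReal.ofReal_le_iff_le_toReal (measure_ne_top _ _)).1 (hμ z hz δ hδ hδ1).1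
  · have h1 := setIntegral_integral_kernel_le (μ := μ) hKcont hK0 (by positivity : 0 < 3 * δ) hδd.le hKle hKs
      (S := univ) (T := univ) MeasurableSet.univ MeasurableSet.univ fun _ _ _ _ => mem_univ _
    rw [setIntegral_univ, hδdd] at h1
    calc ∫ y, ‖hcc.toSchwartzMap hcg y‖ = ∫ x, f x := by
          refine integral_congr_ae (Eventually.of_forall fun x => ?_)
          exact (Complex.norm_real _).trans (Real.norm_of_nonneg (hf0 x))
      _ ≤ M₁ := h1
      _ ≤ _ := by linarith
  · intro x r hr
    have h2 : ∫ y in Metric.ball x r, ‖hcc.toSchwartzMap hcg y‖ = ∫ y in Metric.ball x r, f y := by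
      refine integral_congr_ae (Eventually.of_forall fun x => ?_)
      exact (Complex.norm_real _).trans (Real.norm_of_nonneg (hf0 x))
    rw [h2]
    have hrα : 0 ≤ r ^ α := by positivity
    -- For `r ≥ δ`, mass moves by less than `3 δ ≤ 3 r`, whence the ball of radius `4 r`. For `r <
    -- δ`, the sup bound `δ ^ (α - d)` suffices because `α ≤ d`.
    rcases le_or_gt δ r with h | h
    · have h1 := setIntegral_integral_kernel_le (μ := μ) hKcont hK0 (by positivity : 0 < 3 * δ) hδd.le hKle hKs
        (S := Metric.ball x r) (T := Metric.ball x (4 * r)) measurableSet_ball measurableSet_ball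
        fun y hy z hz => by
          have := dist_triangle z y x
          rw [Metric.mem_ball] at hy ⊢
          rw [dist_comm] at hz
          linarith
      rw [hδdd] at h1
      calc _ ≤ _ := h1
        _ ≤ 3 ^ d * v * (C₁ * (4 * r) ^ α) := by
          gcongr
          exact hball x _ (by linarith)
        _ = M₂ * r ^ α := by rw [Real.mul_rpow (by norm_num) hr.le]; ring
        _ ≤ _ := mul_le_mul_of_nonneg_right (by linarith) hrα
    · have h1 : ∫ y in Metric.ball x r, f y ≤ ∫ y in Metric.ball x r, C₁ * 3 ^ α * δ ^ (α - d) := by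
        refine integral_mono_of_nonneg (Eventually.of_forall hf0) ?_ (Eventually.of_forall hfle)
        exact integrableOn_const measure_ball_lt_top.ne
      rw [setIntegral_const, smul_eq_mul, measureReal_ball_eq _ hr] at h1
      calc _ ≤ _ := h1
        _ = M₃ * (r ^ d * δ ^ (α - d)) := by ring
        _ ≤ M₃ * r ^ α := by
          gcongr
          have h3 : δ ^ (α - d) ≤ r ^ (α - d) :=
            Real.rpow_le_rpow_of_nonpos hr h.le (by linarith)
          calc r ^ d * δ ^ (α - d) ≤ r ^ d * r ^ (α - d) := by gcongr
            _ = r ^ α := by rw [← Real.rpow_natCast, ← Real.rpow_add hr]; congr 1; ring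
        _ ≤ _ := mul_le_mul_of_nonneg_right (by linarith) hrα

end Mollification

/-! ### Lower bounds for the surface measure near a point. -/

section Packing

variable {d m k : ℕ}

local notation "F" => EuclideanSpace ℝ (Fin d)
local notation "V" => EuclideanSpace ℝ (Fin k)

/-- The contraction `π` does not increase Hausdorff measure, and it maps this piece of the level set
onto a set containing a ball of radius comparable to `δ` in the parameter space. The centre `x`
varies freely in a ball so that integrating in `x` later gives a factor `δ ^ d`. -/
theorem LevelSetChart.exists_le_measure_inter_ball {Φ : F × F → Fin m → ℝ} {t : Fin m → ℝ}
    {p₀ : F × F} (c : LevelSetChart k Φ t p₀) (hp₀ : Φ p₀ = t) :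
    ∃ U ∈ 𝓝 p₀, ∃ ε : ℝ, 0 < ε ∧ ε ≤ 1 ∧ ∀ p ∈ U, Φ p = t → ∀ δ : ℝ, 0 < δ → δ ≤ ε →
      ∀ x, dist x p.1 < ε * δ →
        ENNReal.ofReal (ε * δ ^ k) ≤ μHE[k] ({y | Φ (x, y) = t} ∩ Metric.ball p.2 δ) := by
  have hmem : (p₀.1, c.π p₀.2) ∈ c.Ω := c.mem_Ω p₀ c.mem_O hp₀
  obtain ⟨ρ, hρ, hρΩ⟩ := Metric.isOpen_iff.1 c.isOpen_Ω _ hmem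
  -- `(L + 1) a ≤ 1` keeps the graph over a ball of radius `a δ` inside `B(p.2, δ)`; `a ≤ 1 / 2`
  -- keeps the parameters in `Ω`.
  set a : ℝ := min (1 / ((c.L : ℝ) + 1)) (1 / 2) with ha
  have hL : (0 : ℝ) ≤ c.L := c.L.2
  have ha0 : 0 < a := by positivity
  set v : ℝ := volume.real (Metric.ball (0 : V) 1) with hv
  have hv0 : 0 < v := ENNReal.toReal_pos (Metric.measure_ball_pos _ _ one_pos).ne'
    measure_ball_lt_top.ne
  set ε : ℝ := min (min 1 (ρ / 2)) (min a (a ^ k * v)) with hε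
  have hε0 : 0 < ε := by positivity
  have hε1 : ε ≤ 1 := (min_le_left _ _).trans (min_le_left _ _)
  have hερ : ε ≤ ρ / 2 := (min_le_left _ _).trans (min_le_right _ _)
  have hεa : ε ≤ a := (min_le_right _ _).trans (min_le_left _ _)
  have hεv : ε ≤ a ^ k * v := (min_le_right _ _).trans (min_le_right _ _)
  have hπ : ∀ y z, dist (c.π y) (c.π z) ≤ dist y z := fun y z => by
    rw [dist_eq_norm, dist_eq_norm, ← map_sub]
    exact (c.π.le_opNorm _).trans (mul_le_of_le_one_left (norm_nonneg _) c.norm_π_le)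
  refine ⟨c.O ∩ Metric.ball p₀ (ρ / 2), inter_mem (c.isOpen_O.mem_nhds c.mem_O)
    (Metric.ball_mem_nhds _ (by positivity)), ε, hε0, hε1, fun p hp hpt δ hδ hδε x hx => ?_⟩
  obtain ⟨hpO, hpb⟩ := hp
  rw [Metric.mem_ball, Prod.dist_eq, max_lt_iff] at hpb
  have hxδ : dist x p.1 < a * δ := hx.trans_le (by gcongr)
  have haδ : a * δ ≤ ρ / 2 := by
    have : a ≤ 1 / 2 := min_le_right _ _
    nlinarith
  have hin : ∀ x' w, dist x' p.1 < a * δ → dist w (c.π p.2) < a * δ → (x', w) ∈ c.Ω := by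
    intro x' w h1 h2
    refine hρΩ ?_
    rw [Metric.mem_ball, Prod.dist_eq, max_lt_iff]
    have h3 := dist_triangle x' p.1 p₀.1
    have h4 := dist_triangle w (c.π p.2) (c.π p₀.2)
    have h5 := hπ p.2 p₀.2
    constructor <;> simp only <;> linarith
  have hsub : Metric.ball (c.π p.2) (a * δ) ⊆
      c.π '' ({y | Φ (x, y) = t} ∩ Metric.ball p.2 δ) := by
    intro w hw
    have hxw := hin x w hxδ hw
    refine ⟨c.γ (x, w), ⟨c.Φ_γ _ hxw, ?_⟩, c.π_γ _ hxw⟩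
    have h1 := c.lipschitzOnWith_γ.dist_le_mul _ hxw _ (c.mem_Ω p hpO hpt)
    rw [c.γ_π p hpO hpt, Prod.dist_eq] at h1
    have h2 : max (dist x p.1) (dist w (c.π p.2)) < a * δ := max_lt hxδ hw
    have h3 : ((c.L : ℝ) + 1) * a ≤ 1 := by
      calc ((c.L : ℝ) + 1) * a ≤ (c.L + 1) * (1 / (c.L + 1)) := by gcongr; exact min_le_left _ _
        _ = 1 := by field_simp
    rw [Metric.mem_ball]
    refine h1.trans_lt ?_
    have h4 : (0 : ℝ) ≤ max (dist x p.1) (dist w (c.π p.2)) := by positivity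
    simp only at h1 ⊢
    nlinarith
  have h1 := euclideanHausdorffMeasure_image_le_of_dist_le (f := c.π) (h := fun y : F => y)
    (s := {y | Φ (x, y) = t} ∩ Metric.ball p.2 δ) (C := 1) (k := k)
    fun y _ z _ => by simpa using hπ y z
  rw [image_id', ENNReal.coe_one, one_pow, one_mul] at h1
  refine le_trans ?_ h1
  refine le_trans ?_ (measure_mono hsub)
  rw [EuclideanSpace.euclideanHausdorffMeasure_eq_volume, ← ofReal_measureReal
    (h := measure_ball_lt_top.ne)]
  refine ENNReal.ofReal_le_ofReal ?_
  rw [measureReal_ball_eq _ (by positivity), mul_pow]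
  calc ε * δ ^ k ≤ a ^ k * v * δ ^ k := by gcongr
    _ = _ := by ring

theorem exists_le_measure_inter_ball (hk : m + k = d) {Φ : F × F → Fin m → ℝ}
    (hΦ : ContDiff ℝ ∞ Φ) {t : Fin m → ℝ} {S : Set (F × F)} (hS : IsCompact S)
    (hSt : ∀ p ∈ S, Φ p = t)
    (hx : ∀ p ∈ S, Function.Surjective ((fderiv ℝ Φ p).comp (ContinuousLinearMap.inl ℝ F F)))
    (hy : ∀ p ∈ S, Function.Surjective ((fderiv ℝ Φ p).comp (ContinuousLinearMap.inr ℝ F F))) :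
    ∃ ε : ℝ, 0 < ε ∧ ε ≤ 1 ∧ ∀ p ∈ S, ∀ δ : ℝ, 0 < δ → δ ≤ ε → ∀ x, dist x p.1 < ε * δ →
      ENNReal.ofReal (ε * δ ^ k) ≤ μHE[k] ({y | Φ (x, y) = t} ∩ Metric.ball p.2 δ) := by
  refine hS.induction_on ⟨1, one_pos, le_rfl, by simp⟩ ?_ ?_ ?_
  · rintro A B hAB ⟨ε, h0, h1, h⟩
    exact ⟨ε, h0, h1, fun p hp => h p (hAB hp)⟩
  · rintro A B ⟨ε, h0, h1, h⟩ ⟨ε', h0', h1', h'⟩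
    refine ⟨min ε ε', lt_min h0 h0', (min_le_left _ _).trans h1, fun p hp δ hδ hδε x hx => ?_⟩
    rcases hp with hp | hp
    · refine le_trans (ENNReal.ofReal_le_ofReal ?_) (h p hp δ hδ (hδε.trans (min_le_left _ _)) x
        (hx.trans_le ?_))
      all_goals gcongr; exact min_le_left _ _
    · refine le_trans (ENNReal.ofReal_le_ofReal ?_) (h' p hp δ hδ (hδε.trans (min_le_right _ _)) x
        (hx.trans_le ?_))
      all_goals gcongr; exact min_le_right _ _
  · intro p hp
    obtain ⟨c⟩ := nonempty_levelSetChart hk hΦ (hSt p hp) (hx p hp) (hy p hp)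
    obtain ⟨U, hU, ε, h0, h1, h⟩ := c.exists_le_measure_inter_ball (hSt p hp)
    exact ⟨S ∩ U, inter_mem self_mem_nhdsWithin (mem_nhdsWithin_of_mem_nhds hU), ε, h0, h1,
      fun q hq => h q hq.2 (hSt q hq.1)⟩

/-- A nonzero functional vanishing on the range of `A` would be a linear relation between the
gradients. -/
theorem surjective_fderiv_of_linearIndependent_gradient {H : Type*} [NormedAddCommGroup H]
    [InnerProductSpace ℝ H] [CompleteSpace H] {u : Fin m → H → ℝ} {x : H}
    {A : H →L[ℝ] Fin m → ℝ} (hu : ∀ l, HasFDerivAt (u l) ((ContinuousLinearMap.proj l).comp A) x)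
    (hli : LinearIndependent ℝ fun l => gradient (u l) x) : Function.Surjective A := by
  have hA : ∀ l v, A v l = inner ℝ (gradient (u l) x) v := fun l v => by
    rw [gradient, InnerProductSpace.toDual_symm_apply, (hu l).fderiv]
    rfl
  by_contra hns
  have hlt : LinearMap.range (A : H →ₗ[ℝ] Fin m → ℝ) < ⊤ :=
    lt_top_iff_ne_top.2 fun h => hns (LinearMap.range_eq_top.1 h)
  obtain ⟨g, hg, hgA⟩ := Submodule.exists_le_ker_of_lt_top _ hlt
  have hgs : ∀ w : Fin m → ℝ, g w = ∑ l, w l * g (Pi.single l 1) := fun w => by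
    rw [LinearMap.pi_apply_eq_sum_univ g w]
    refine Finset.sum_congr rfl fun l _ => ?_
    rw [smul_eq_mul]
    congr 2
    funext j
    simp [Pi.single_apply, eq_comm]
  have hsum : ∑ l, g (Pi.single l 1) • gradient (u l) x = 0 := by
    refine ext_inner_right ℝ fun v => ?_
    have h1 : g (A v) = 0 := hgA ⟨v, rfl⟩
    rw [hgs] at h1
    rw [sum_inner, inner_zero_left, ← h1]
    refine Finset.sum_congr rfl fun l _ => ?_
    rw [real_inner_smul_left, hA, mul_comm]
  have hz := Fintype.linearIndependent_iff.1 hli _ hsum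
  exact hg (LinearMap.ext fun w => by rw [hgs]; simp [hz])

theorem surjective_fderiv_comp_inl {φ : Fin m → F × F → ℝ} (hφ : ∀ l, ContDiff ℝ ∞ (φ l)) {x y : F}
    (hli : LinearIndependent ℝ fun l => gradient (fun x' => φ l (x', y)) x) :
    Function.Surjective
      ((fderiv ℝ (fun q l => φ l q) (x, y)).comp (ContinuousLinearMap.inl ℝ F F)) := by
  refine surjective_fderiv_of_linearIndependent_gradient (fun l => ?_) hli
  have h1 : HasFDerivAt (fun q l => φ l q) (fderiv ℝ (fun q l => φ l q) (x, y)) (x, y) :=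
    ((contDiff_pi.2 hφ).differentiable (by simp) _).hasFDerivAt
  exact HasFDerivAt.comp (g := φ l) (f := fun x' => (x', y)) x (hasFDerivAt_pi'.1 h1 l) (hasFDerivAt_prodMk_left x y)

theorem surjective_fderiv_comp_inr {φ : Fin m → F × F → ℝ} (hφ : ∀ l, ContDiff ℝ ∞ (φ l)) {x y : F}
    (hli : LinearIndependent ℝ fun l => gradient (fun y' => φ l (x, y')) y) :
    Function.Surjective
      ((fderiv ℝ (fun q l => φ l q) (x, y)).comp (ContinuousLinearMap.inr ℝ F F)) := by
  refine surjective_fderiv_of_linearIndependent_gradient (fun l => ?_) hli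
  have h1 : HasFDerivAt (fun q l => φ l q) (fderiv ℝ (fun q l => φ l q) (x, y)) (x, y) :=
    ((contDiff_pi.2 hφ).differentiable (by simp) _).hasFDerivAt
  exact HasFDerivAt.comp (g := φ l) (f := fun y' => (x, y')) y (hasFDerivAt_pi'.1 h1 l) (hasFDerivAt_prodMk_right x y)

end Packing

/-! ### Counting separated points. -/

section Counting

variable {d m k : ℕ}

local notation "F" => EuclideanSpace ℝ (Fin d)

theorem card_nsmul_le_lintegral_of_pairwiseDisjoint {X ι : Type*} [MeasurableSpace X] {μ : Measure X}
    {u : X → ℝ≥0∞} {Z : Set X} {P : Finset ι} {A : ι → Set X} {a b : ℝ≥0∞}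
    (hA : ∀ i ∈ P, MeasurableSet (A i)) (hAZ : ∀ i ∈ P, A i ⊆ Z) (hd : (P : Set ι).PairwiseDisjoint A)
    (hu : ∀ i ∈ P, ∀ x ∈ A i, a ≤ u x) (hb : ∀ i ∈ P, b ≤ μ (A i)) :
    P.card * (a * b) ≤ ∫⁻ x in Z, u x ∂μ := by
  have hm : MeasurableSet (⋃ i ∈ P, A i) := P.measurableSet_biUnion hA
  calc (P.card : ℝ≥0∞) * (a * b) = a * ∑ i ∈ P, b := by simp; ring
    _ ≤ a * ∑ i ∈ P, μ (A i) := by gcongr with i hi; exact hb i hi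
    _ = ∫⁻ x in ⋃ i ∈ P, A i, a ∂μ := by
      rw [setLIntegral_const, measure_biUnion_finset hd hA]
    _ ≤ ∫⁻ x in ⋃ i ∈ P, A i, u x ∂μ := by
      refine setLIntegral_mono' hm fun x hx => ?_
      obtain ⟨i, hi, hx⟩ := mem_iUnion₂.1 hx
      exact hu i hi x hx
    _ ≤ _ := lintegral_mono_set (iUnion₂_subset hAZ)

theorem IsCompact.pairedLevelSet {φ : Fin m → F × F → ℝ} (hφ : ∀ l, Continuous (φ l))
    (t : Fin m → ℝ) {E : Set F} (hE : IsCompact E) : IsCompact (pairedLevelSet φ t E) := by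
  have h : _root_.pairedLevelSet φ t E = E ×ˢ E ∩ ⋂ l, {p | φ l p = t l} := by
    ext p
    simp [_root_.pairedLevelSet, and_assoc]
  rw [h]
  exact (hE.prod hE).inter_right (isClosed_iInter fun l => isClosed_eq (hφ l) continuous_const)

/-- The integral of `f(x) f(y) ψ(x, y)` over the level sets is bounded uniformly in `δ`, while each
point of `P` contributes at least a constant times `δ ^ (2 α - m)`. -/
theorem exists_card_le_of_separated (hk : m + k = d) (hd : 0 < d) {E : Set F} (hE : IsCompact E)
    {μ : Measure F} (hμE : μ Eᶜ = 0) {α C : ℝ} (hC : 0 < C)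
    (hμ : ∀ x ∈ E, ∀ δ : ℝ, 0 < δ → δ ≤ 1 → ENNReal.ofReal (C⁻¹ * δ ^ α) ≤ μ (Metric.ball x δ) ∧
      μ (Metric.ball x δ) ≤ ENNReal.ofReal (C * δ ^ α))
    (hα : 0 ≤ α) (hαd : α ≤ d) {φ : Fin m → F × F → ℝ} (hφ : ∀ l, ContDiff ℝ ∞ (φ l))
    {ψ : F × F → ℝ} (hψ : ContDiff ℝ ∞ ψ) (hψc : HasCompactSupport ψ) {t : Fin m → ℝ}
    (hψS : ∀ p ∈ pairedLevelSet φ t E, ψ p = 1)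
    (hx : ∀ p ∈ tsupport ψ, (∀ l, φ l p = t l) → Function.Surjective
      ((fderiv ℝ (fun q l => φ l q) p).comp (ContinuousLinearMap.inl ℝ F F)))
    (hy : ∀ p ∈ tsupport ψ, (∀ l, φ l p = t l) → Function.Surjective
      ((fderiv ℝ (fun q l => φ l q) p).comp (ContinuousLinearMap.inr ℝ F F)))
    {s C₀ : ℝ} (hs : (d : ℝ) - α < s)
    (hsob : IsL2SobolevBounded s C₀ (generalizedRadonTransform φ ψ t)) :
    ∃ C₂ ε₀ : ℝ, 0 < C₂ ∧ 0 < ε₀ ∧ ∀ δ : ℝ, 0 < δ → δ ≤ ε₀ → ∀ P : Finset (F × F),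
      ↑P ⊆ pairedLevelSet φ t E → (P : Set (F × F)).Pairwise (fun p q => 2 * δ ≤ dist p q) →
      (P.card : ℝ) ≤ C₂ * δ ^ (-(2 * α - m)) := by
  obtain ⟨ι, _, b, hb⟩ := exists_generalizedRadonTransform_eq_sum hk hφ hψ hψc hx hy
  obtain rfl : k = d - m := by omega
  have hbounded : IsL2SobolevBounded s |C₀| (sumTransform b) := by
    intro f hf hfc
    have h1 : sumTransform b f = generalizedRadonTransform φ ψ t f :=
      funext fun x => (hb f hf.continuous x).2.symm
    obtain ⟨hg, h, e, hn⟩ := hsob f hf hfc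
    rw [h1]
    exact ⟨hg, h, e, hn.trans (mul_le_mul_of_nonneg_right (le_abs_self _) ENNReal.toReal_nonneg)⟩
  obtain ⟨M, hM, hmoll⟩ := exists_mollification hE hμE hC hμ hα hαd
  obtain ⟨C₁, hC₁⟩ := exists_norm_integral_sumTransform_mul_self_le b hd (abs_nonneg _) hM hαd hs
    hbounded
  set S := pairedLevelSet φ t E with hS
  set Φ : F × F → Fin m → ℝ := fun q l => φ l q with hΦdef
  have hΦ : ContDiff ℝ ∞ Φ := contDiff_pi.2 hφ
  have hΦt : ∀ p, Φ p = t ↔ ∀ l, φ l p = t l := fun p => funext_iff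
  have hSc : IsCompact S := hE.pairedLevelSet (fun l => (hφ l).continuous) t
  have hSψ : ∀ p ∈ S, p ∈ tsupport ψ := fun p hp =>
    subset_tsupport _ (by rw [Function.mem_support, hψS p hp]; exact one_ne_zero)
  obtain ⟨ε, hε0, hε1, hεball⟩ := exists_le_measure_inter_ball hk hΦ hSc
    (fun p hp => (hΦt p).2 hp.2.2) (fun p hp => hx p (hSψ p hp) hp.2.2)
    fun p hp => hy p (hSψ p hp) hp.2.2
  -- `ψ` may be negative far from `E × E`. Near it, `ψ > 1 / 2` on the level set, and `f(x) f(y)`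
  -- vanishes beyond distance `3 δ ≤ ρ`, so the integrand is nonnegative throughout.
  obtain ⟨ρ, hρ, hρsub⟩ := (hE.prod hE).exists_thickening_subset_open
    (t := {p | 1 / 2 < ψ p} ∪ {p | Φ p ≠ t})
    ((isOpen_lt continuous_const hψ.continuous).union
      (isOpen_ne_fun hΦ.continuous continuous_const)) (fun p hp => by
        by_cases h : Φ p = t
        · left
          have : ψ p = 1 := hψS p ⟨hp.1, hp.2, (hΦt p).1 h⟩
          change 1 / 2 < ψ p
          rw [this]
          norm_num
        · exact Or.inr h)
  set v : ℝ := volume.real (Metric.ball (0 : F) 1) with hv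
  have hv0 : 0 < v := ENNReal.toReal_pos (Metric.measure_ball_pos _ _ one_pos).ne'
    measure_ball_lt_top.ne
  -- `C⁻¹ ^ 2 / 2` bounds the integrand, `ε` the surface measure, and `ε ^ d * v` the volume of the
  -- ball of radius `ε δ` in `x`, each up to its power of `δ`.
  set c₀ : ℝ := C⁻¹ ^ 2 / 2 * ε * (ε ^ d * v) with hc₀
  have hc₀0 : 0 < c₀ := by positivity
  refine ⟨(|C₁| + 1) / c₀, min ε (ρ / 3), by positivity, by positivity, fun δ hδ hδε P hP hsep => ?_⟩
  have hδε' : δ ≤ ε := hδε.trans (min_le_left _ _)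
  have hδρ : 3 * δ ≤ ρ := by linarith [hδε.trans (min_le_right _ _)]
  obtain ⟨f, g, hgf, hf0, hflow, hfsupp, hfrost⟩ := hmoll δ hδ (hδε'.trans hε1)
  set a : ℝ := C⁻¹ * δ ^ (α - d) with ha
  have ha0 : 0 < a := by positivity
  set Z : F → Set F := fun x => {y | Φ (x, y) = t} with hZ
  have hZm : ∀ x, MeasurableSet (Z x) := fun x =>
    (isClosed_eq (hΦ.continuous.comp (by fun_prop)) continuous_const).measurableSet
  have hZ' : ∀ x, {y | ∀ l, φ l (x, y) = t l} = Z x := fun x => by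
    ext y; exact (hΦt _).symm
  set q : F → F → ℝ := fun x y => f x * (f y * ψ (x, y)) with hq
  have hψhalf : ∀ x y, y ∈ Z x → f x ≠ 0 → f y ≠ 0 → 1 / 2 ≤ ψ (x, y) := by
    intro x y hyZ hfx hfy
    obtain ⟨z, hz, hxz⟩ := hfsupp x hfx
    obtain ⟨w, hw, hyw⟩ := hfsupp y hfy
    have h1 : (x, y) ∈ Metric.thickening ρ (E ×ˢ E) := by
      refine Metric.mem_thickening_iff.2 ⟨(z, w), ⟨hz, hw⟩, ?_⟩
      rw [Prod.dist_eq, max_lt_iff]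
      constructor <;> simp only <;> linarith
    rcases hρsub h1 with h | h
    · exact le_of_lt h
    · exact absurd hyZ h
  have hq0 : ∀ x, ∀ y ∈ Z x, 0 ≤ q x y := by
    intro x y hyZ
    by_cases hfx : f x = 0
    · simp [hq, hfx]
    by_cases hfy : f y = 0
    · simp [hq, hfy]
    have := hψhalf x y hyZ hfx hfy
    exact mul_nonneg (hf0 x) (mul_nonneg (hf0 y) (by linarith))
  have hq1 : ∀ p ∈ S, ∀ x y, y ∈ Z x → dist x p.1 ≤ δ → dist y p.2 ≤ δ → a ^ 2 / 2 ≤ q x y := by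
    intro p hp x y hyZ hxp hyp
    have h1 : a ≤ f x := hflow x p.1 hp.1 hxp
    have h2 : a ≤ f y := hflow y p.2 hp.2.1 hyp
    have h3 := hψhalf x y hyZ (by linarith) (by linarith)
    calc a ^ 2 / 2 = a * (a * (1 / 2)) := by ring
      _ ≤ f x * (f y * ψ (x, y)) := by gcongr <;> linarith
  -- Integrability is essential to the lower bound: otherwise the Bochner integral `r x` would take
  -- the default value `0`.
  have hTint : ∀ x, IntegrableOn (fun y => f y * ψ (x, y)) (Z x) μHE[d - m] := by
    intro x
    have h1 := (hb g g.continuous x).1.re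
    rw [hZ'] at h1
    refine h1.congr (Eventually.of_forall fun y => ?_)
    simp [hgf]
  set r : F → ℝ := fun x => ∫ y in Z x, q x y ∂μHE[d - m] with hr
  have hTr : ∀ x, sumTransform b g x * g x = (r x : ℂ) := by
    intro x
    have h1 : sumTransform b g x = generalizedRadonTransform φ ψ t g x :=
      (hb g g.continuous x).2.symm
    rw [h1, generalizedRadonTransform, hZ', hr]
    simp only [hq, integral_const_mul, hgf]
    rw [Complex.ofReal_mul, ← integral_complex_ofReal, mul_comm]
    simp only [Complex.ofReal_mul]
  have hrint : Integrable r := by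
    have h1 := (integral_sumTransform_mul b g.continuous g.continuous).1.re
    simpa only [hTr, RCLike.re_to_complex, Complex.ofReal_re] using h1
  have hrle : ∫ x, r x ≤ |C₁| := by
    have h1 := hC₁ g hfrost
    simp only [hTr] at h1
    rw [integral_complex_ofReal, Complex.norm_real] at h1
    exact (le_abs_self _).trans (h1.trans (le_abs_self _))
  set κ : ℝ := a ^ 2 / 2 * (ε * δ ^ (d - m)) with hκ
  have hκ0 : 0 ≤ κ := by positivity
  have hεδ : ε * δ ≤ δ := mul_le_of_le_one_left hδ.le hε1
  have hlow : ∀ x, ∑ p ∈ P, (Metric.ball p.1 (ε * δ)).indicator (fun _ => κ) x ≤ r x := by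
    intro x
    classical
    set Q := P.filter fun p => x ∈ Metric.ball p.1 (ε * δ) with hQ
    have h1 : ∑ p ∈ P, (Metric.ball p.1 (ε * δ)).indicator (fun _ => κ) x = Q.card * κ := by
      simp only [indicator_apply]
      rw [← Finset.sum_filter, Finset.sum_const, nsmul_eq_mul]
    have h2 := card_nsmul_le_lintegral_of_pairwiseDisjoint (μ := μHE[d - m])
      (u := fun y => ENNReal.ofReal (q x y)) (Z := Z x) (P := Q)
      (A := fun p => Z x ∩ Metric.ball p.2 δ) (a := ENNReal.ofReal (a ^ 2 / 2))
      (b := ENNReal.ofReal (ε * δ ^ (d - m)))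
      (fun p _ => (hZm x).inter measurableSet_ball) (fun p _ => inter_subset_left) ?_ ?_ ?_
    · rw [h1]
      have h3 : Integrable (q x) (μHE[d - m].restrict (Z x)) := (hTint x).const_mul (f x)
      rw [← ofReal_integral_eq_lintegral_ofReal h3
        ((ae_restrict_iff' (hZm x)).2 (Eventually.of_forall fun y hy => hq0 x y hy)),
        ← ENNReal.ofReal_mul (p := a ^ 2 / 2) (by positivity), ← ENNReal.ofReal_natCast Q.card,
        ← ENNReal.ofReal_mul (p := (Q.card : ℝ)) (Nat.cast_nonneg _)] at h2
      exact (ENNReal.ofReal_le_ofReal_iff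
        (setIntegral_nonneg (hZm x) fun y hy => hq0 x y hy)).1 h2
    -- The first coordinates of points in `Q` are all within `ε δ ≤ δ` of `x`, so in the product
    -- metric the `2 δ` separation must come from the second coordinates.
    · intro p hp p' hp' hne
      have hp := Finset.mem_filter.1 (Finset.mem_coe.1 hp)
      have hp' := Finset.mem_filter.1 (Finset.mem_coe.1 hp')
      rw [Metric.mem_ball] at hp hp'
      refine disjoint_left.2 fun y hy hy' => ?_
      have h4 := hsep hp.1 hp'.1 hne
      have h5 : dist p p' < 2 * δ := by
        rw [Prod.dist_eq, max_lt_iff]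
        have h6 := dist_triangle_left p.1 p'.1 x
        have h7 := dist_triangle_left p.2 p'.2 y
        have h8 : dist y p.2 < δ := hy.2
        have h9 : dist y p'.2 < δ := hy'.2
        constructor <;> linarith [hp.2, hp'.2]
      linarith
    · intro p hp y hy
      have hp := Finset.mem_filter.1 hp
      exact ENNReal.ofReal_le_ofReal (hq1 p (hP hp.1) x y hy.1
        ((Metric.mem_ball.1 hp.2).le.trans hεδ) (Metric.mem_ball.1 hy.2).le)
    · intro p hp
      have hp := Finset.mem_filter.1 hp
      exact hεball p (hP hp.1) δ hδ hδε' x hp.2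
  have hii : ∀ p ∈ P, Integrable ((Metric.ball p.1 (ε * δ)).indicator fun _ : F => κ) := fun p _ =>
    (integrable_indicator_iff measurableSet_ball).2 (integrableOn_const measure_ball_lt_top.ne)
  have hfinal : (P.card : ℝ) * ((ε * δ) ^ d * v * κ) ≤ |C₁| := by
    refine le_trans (le_trans (le_of_eq ?_) (integral_mono (integrable_finsetSum P hii) hrint hlow))
      hrle
    rw [integral_finsetSum P hii]
    simp only [integral_indicator measurableSet_ball, setIntegral_const, smul_eq_mul,
      measureReal_ball_eq _ (by positivity : 0 < ε * δ), Finset.sum_const, nsmul_eq_mul]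
    rfl
  have hpow : (ε * δ) ^ d * v * κ = c₀ * δ ^ (2 * α - m) := by
    have h1 : (δ ^ (α - d)) ^ 2 * δ ^ (d - m) * δ ^ d = δ ^ (2 * α - m) := by
      rw [← Real.rpow_natCast, ← Real.rpow_natCast, ← Real.rpow_natCast, ← Real.rpow_mul hδ.le,
        ← Real.rpow_add hδ, ← Real.rpow_add hδ, Nat.cast_sub (by omega)]
      congr 1
      push_cast
      ring
    rw [← h1, hκ, ha, hc₀]
    ring
  rw [hpow] at hfinal
  rw [Real.rpow_neg hδ.le, ← div_eq_mul_inv, div_div, le_div_iff₀ (by positivity)]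
  linarith

theorem packingNumber_le_of_card_le {X : Type*} [MetricSpace X] {S : Set X} {δ : ℝ} (hδ : 0 < δ)
    {B : ℝ} (hB : 0 ≤ B)
    (h : ∀ P : Finset X, ↑P ⊆ S → (P : Set X).Pairwise (fun p q => δ ≤ dist p q) → (P.card : ℝ) ≤ B) :
    ((Metric.packingNumber δ.toNNReal S : ℕ∞) : ℝ≥0∞) ≤ ENNReal.ofReal B := by
  have h1 : Metric.packingNumber δ.toNNReal S ≤ (⌊B⌋₊ : ℕ∞) := by
    refine iSup_le fun A => iSup_le fun hA => iSup_le fun hsep => ?_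
    have hP : ∀ P : Finset X, ↑P ⊆ A → P.card ≤ ⌊B⌋₊ := fun P hPA => by
      refine Nat.le_floor (h P (hPA.trans hA) fun p hp q hq hne => ?_)
      have h2 := hsep (hPA hp) (hPA hq) hne
      change ENNReal.ofReal δ < edist p q at h2
      rw [edist_dist] at h2
      exact ((ENNReal.ofReal_lt_ofReal_iff_of_nonneg hδ.le).1 h2).le
    have hfin : A.Finite := by
      by_contra hinf
      obtain ⟨P, hPA, hcard⟩ := Set.Infinite.exists_subset_card_eq hinf (⌊B⌋₊ + 1)
      have := hP P hPA
      omega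
    rw [← hfin.coe_toFinset, Set.encard_coe_eq_coe_finsetCard]
    exact_mod_cast hP hfin.toFinset (by simp)
  calc ((Metric.packingNumber δ.toNNReal S : ℕ∞) : ℝ≥0∞) ≤ ((⌊B⌋₊ : ℕ∞) : ℝ≥0∞) := by
        exact_mod_cast h1
    _ = ENNReal.ofReal (⌊B⌋₊ : ℝ) := by simp
    _ ≤ ENNReal.ofReal B := ENNReal.ofReal_le_ofReal (Nat.floor_le hB)

/-- A maximal separated set is a net, so covering numbers are at most packing numbers. The constant
`C` disappears after division by `log (1 / δ)`. -/
theorem upperMinkowskiDim_le_of_card_le {X : Type*} [MetricSpace X] {S : Set X} {C ε β : ℝ}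
    (hC : 0 < C) (hε : 0 < ε)
    (h : ∀ δ : ℝ, 0 < δ → δ ≤ ε → ∀ P : Finset X, ↑P ⊆ S →
      (P : Set X).Pairwise (fun p q => 2 * δ ≤ dist p q) → (P.card : ℝ) ≤ C * δ ^ (-β)) :
    upperMinkowskiDim S ≤ (β : EReal) := by
  set A : ℝ := Real.log (C * 2 ^ β) with hA
  have hlog : Tendsto (fun δ : ℝ => Real.log (1 / δ)) (𝓝[>] 0) atTop := by
    simp only [one_div]
    exact Real.tendsto_log_atTop.comp tendsto_inv_nhdsGT_zero
  have hlim : Tendsto (fun δ : ℝ => ((A / Real.log (1 / δ) + β : ℝ) : EReal)) (𝓝[>] 0) (𝓝 (β : EReal)) := by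
    refine (continuous_coe_real_ereal.tendsto β).comp ?_
    simpa using (hlog.const_div_atTop A).add_const β
  rw [upperMinkowskiDim, ← hlim.limsup_eq]
  refine limsup_le_limsup ?_
  filter_upwards [Ioo_mem_nhdsGT (by positivity : 0 < min (2 * ε) 1)] with δ hδ
  have hδ0 : 0 < δ := hδ.1
  have hδε : δ / 2 ≤ ε := by linarith [hδ.2.trans_le (min_le_left _ _)]
  have hδ1 : δ < 1 := hδ.2.trans_le (min_le_right _ _)
  have hlogpos : 0 < Real.log (1 / δ) := Real.log_pos ((one_lt_div hδ0).2 hδ1)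
  have h1 : ((Metric.coveringNumber δ.toNNReal S : ℕ∞) : ℝ≥0∞) ≤
      ENNReal.ofReal (C * (δ / 2) ^ (-β)) := by
    refine le_trans (by exact_mod_cast Metric.coveringNumber_le_packingNumber _ _)
      (packingNumber_le_of_card_le hδ0 (by positivity) fun P hP hsep => ?_)
    -- The hypothesis at scale `δ / 2` concerns `δ`-separated sets; this is the origin of the `2 ^
    -- β` in `A`.
    exact h (δ / 2) (by positivity) hδε P hP (by simpa [mul_div_cancel₀] using hsep)
  have h2 := ENNReal.log_monotone h1
  rw [ENNReal.log_ofReal_of_pos (by positivity)] at h2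
  refine (EReal.div_le_div_right_of_nonneg (by exact_mod_cast hlogpos.le) h2).trans_eq ?_
  rw [← EReal.coe_div, EReal.coe_eq_coe_iff]
  have h3 : Real.log (C * (δ / 2) ^ (-β)) = A + β * Real.log (1 / δ) := by
    rw [hA, Real.log_mul hC.ne' (by positivity), Real.log_mul hC.ne' (by positivity),
      Real.log_rpow (by positivity), Real.log_rpow (by positivity), Real.log_div hδ0.ne' two_ne_zero,
      Real.log_div one_ne_zero hδ0.ne', Real.log_one]
    ring
  rw [h3, add_div, mul_div_cancel_right₀ _ hlogpos.ne']

end Counting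

/-! ### The dimension bound. -/

theorem theorem1p1 (d m : ℕ) (hd : 2 ≤ d) (hm : 1 ≤ m)
    (E : Set (EuclideanSpace ℝ (Fin d))) (hE : IsCompact E) (hreg : IsAhlforsDavidRegular E)
    (φ : Fin m → EuclideanSpace ℝ (Fin d) × EuclideanSpace ℝ (Fin d) → ℝ)
    (hφ : ∀ l, ContDiff ℝ ∞ (φ l))
    -- the box `T = T_1 × ⋯ × T_m`
    (T : Fin m → Set ℝ) (hT : ∀ l, (T l).OrdConnected)
    -- the cut-off function, equal to `1` on the part of `E × E` where `φ` takes values in the box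
    (ψ : EuclideanSpace ℝ (Fin d) × EuclideanSpace ℝ (Fin d) → ℝ)
    (hψ : ContDiff ℝ ∞ ψ) (hψc : HasCompactSupport ψ)
    (hψE : ∀ x ∈ E, ∀ y ∈ E, (∀ l, φ l (x, y) ∈ T l) → ψ (x, y) = 1)
    -- linear independence of the gradients on the level sets, within the support of `ψ`
    (hindep : ∀ x y, (x, y) ∈ tsupport ψ → (∀ l, φ l (x, y) ∈ T l) →
      LinearIndependent ℝ (fun l => gradient (fun x' => φ l (x', y)) x) ∧
        LinearIndependent ℝ (fun l => gradient (fun y' => φ l (x, y')) y))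
    (s : ℝ) (hs : 0 < s)
    -- the Radon transforms map `L²` to `L²_s`, with constants uniform in `t ∈ T`
    (hsob : ∃ C : ℝ, ∀ t : Fin m → ℝ, (∀ l, t l ∈ T l) →
      IsL2SobolevBounded s C (generalizedRadonTransform φ ψ t))
    (hdim : (((d : ℝ) - s : ℝ) : EReal) < (dimH E : EReal))
    (t : Fin m → ℝ) (ht : ∀ l, t l ∈ T l) :
    upperMinkowskiDim (pairedLevelSet φ t E) ≤ 2 * (dimH E : EReal) - (m : EReal) := by
  have hd0 : 0 < d := by omega
  have hdimle : dimH E ≤ (d : ℝ≥0∞) := by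
    refine (dimH_mono (subset_univ E)).trans_eq ?_
    rw [Real.dimH_univ_eq_finrank, finrank_euclideanSpace_fin]
  have hdimtop : dimH E ≠ ⊤ := (hdimle.trans_lt (ENNReal.natCast_lt_top d)).ne
  obtain ⟨μ, hμE, C, hC, hμ⟩ := hreg
  set α : ℝ := (dimH E).toReal with hα
  have hα0 : 0 ≤ α := ENNReal.toReal_nonneg
  have hαd : α ≤ d := ENNReal.toReal_le_of_le_ofReal (by positivity) (by simpa using hdimle)
  have hdimα : (dimH E : EReal) = (α : EReal) := (EReal.coe_ennreal_toReal hdimtop).symm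
  rw [hdimα, EReal.coe_lt_coe_iff] at hdim
  obtain ⟨C₀, hsob⟩ := hsob
  have hgoal : (2 : EReal) * (α : EReal) - (m : EReal) = ((2 * α - m : ℝ) : EReal) := by
    push_cast
    rfl
  rw [hdimα, hgoal]
  have hT' : ∀ p : EuclideanSpace ℝ (Fin d) × EuclideanSpace ℝ (Fin d),
      (∀ l, φ l p = t l) → ∀ l, φ l p ∈ T l := fun p hp l => by rw [hp l]; exact ht l
  -- A point of the level set is needed to derive `m ≤ d` from the independence of `m` gradients,
  -- which makes the natural subtraction `d - m` the true dimension.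
  rcases (pairedLevelSet φ t E).eq_empty_or_nonempty with hempty | ⟨p, hp⟩
  · refine upperMinkowskiDim_le_of_card_le one_pos one_pos fun δ hδ _ P hP _ => ?_
    rw [hempty, subset_empty_iff, Finset.coe_eq_empty] at hP
    rw [hP]
    simpa using by positivity
  have hψS : ∀ p ∈ pairedLevelSet φ t E, ψ p = 1 := fun p hp =>
    hψE p.1 hp.1 p.2 hp.2.1 (hT' p hp.2.2)
  have hpψ : p ∈ tsupport ψ :=
    subset_tsupport _ (by rw [Function.mem_support, hψS p hp]; exact one_ne_zero)
  have hmd : m ≤ d := by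
    simpa using (hindep p.1 p.2 hpψ (hT' p hp.2.2)).1.fintype_card_le_finrank
  obtain ⟨C₂, ε₀, hC₂, hε₀, hcard⟩ := exists_card_le_of_separated (Nat.add_sub_cancel' hmd) hd0 hE hμE hC
    hμ hα0 hαd hφ hψ hψc hψS
    (fun p hp hpt => surjective_fderiv_comp_inl hφ (hindep p.1 p.2 hp (hT' p hpt)).1)
    (fun p hp hpt => surjective_fderiv_comp_inr hφ (hindep p.1 p.2 hp (hT' p hpt)).2)
    (by linarith) (hsob t ht)
  exact upperMinkowskiDim_le_of_card_le hC₂ hε₀ hcard
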